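/- **Setting.** Let $\Pi$ be a classical public-coin interactive proof system for a language $L$. On a common input $x$ with $|x|=\lambda$ (the security parameter) there are $k=k(\lambda)$ rounds; the prover (who may hold a private input $w$, e.g. a witness, admissible for $x$) sends messages $a_1,\dots,a_{k+1}\in\{0,1\}^{\ell(\lambda)}$ and the verifier sends uniformly random challenges $c_1,\dots,c_k\in\{0,1\}^{m(\lambda)}$, in the order $a_1,c_1,a_2,\dots,c_k,a_{k+1}$; $a_{i+1}$ is sampled from a distribution depending on $x$, $w$ and $a_1,c_1,\dots,a_i,c_i$. ($k=1$ gives $\Sigma$-protocols.) The functions $k,\ell,m$, and a further function $n$, are computable in polynomial time (in unary). "Polynomial time" for a family of quantum channels indexed by $x$ means: computed by circuits that a classical polynomial-time program writes out on input $x$. Two families of channels indexed by pairs $(x,w)$, $x\in L$, $w$ admissible for $x$, are *computationally* (resp. *statistically*) *indistinguishable* if every circuit of size $\mathrm{poly}(|x|)$ (resp. every quantum channel) with one measured output bit, given the output of the channel and a side register of $\mathrm{poly}(|x|)$ (resp. any number of) qubits, the channel's input and the side register being prepared in an arbitrary joint state, distinguishes them with advantage negligible in $|x|$. $\Pi$ is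 *special quantum honest-verifier computational (resp. statistical) zero-knowledge* if there is a polynomial-time simulator $\mathcal S(x,c_1,\dots,c_k)$ such that the channels that measure a query $(c_1,\dots,c_k)$ and answer with the measured output of $\mathcal S(x,c_1,\dots,c_k)$, respectively with the honest prover messages $(a_1,\dots,a_{k+1})$ when the challenges are fixed to $(c_1,\dots,c_k)$, are computationally (resp. statistically) indistinguishable. The two-message protocol $\mathsf{RR}[\Pi]$: the verifier sends registers $P_1C_1\cdots P_kC_k$, where $P_i$ holds, for each of the $\ell$ bits of $a_i$, $n(\lambda)$ qubits in uniformly random states among $|0\rangle,|1\rangle,|+\rangle,|-\rangle$, and $C_i$ holds a uniformly random $c_i\in\{0,1\}^m$. The prover draws $a_1$ and then, for $i=1,\dots,k$ in this order, commits to $a_i$ by measuring the qubits of $P_i$ belonging to its $j$-th bit in the computational basis if this bit is $0$ and in the Hadamard basis if it is $1$, with outcomes $z_i$; measures $C_i$ to get $c_i$; and draws $a_{i+1}$ as the prover of $\Pi$ would. It sends $(a_1,\dots,a_{k+1},z_1,\dots,z_k)$. The verifier accepts if the $z_i$ agree with the states it prepared wherever the bases agree and $(a_1,\dots,a_{k+1},c_1,\dots,c_k)$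 is accepting for $\Pi$. A malicious verifier $V^*$ is a pair of quantum channels: the first maps an auxiliary input register $E$ to its message and a private quantum memory of any size (no memory bound applies to it); the second maps the prover's message and this memory to an output register. A polynomial-time $V^*$ has channels computable in polynomial time, input and output registers of polynomially bounded size, and a private memory whose size is computable in polynomial time. The *interaction channel* maps $E$ to the output register. **Theorem.** 1. If $\Pi$ is special quantum honest-verifier computational zero-knowledge, then $\mathsf{RR}[\Pi]$ is computationally quantum zero-knowledge: for every polynomial-time $V^*$ there is a polynomial-time simulator, given $x$ and $E$, whose channel is computationally indistinguishable from the interaction channel of $V^*$ with the honest prover. 2. If $\Pi$ is special quantum honest-verifier statistical zero-knowledge, then $\mathsf{RR}[\Pi]$ is statistically quantum zero-knowledge: for every unbounded $V^*$ there is a polynomial-time channel from the verifier's message to the prover's message, not using $w$, such that the interaction channel of $V^*$ with it is statistically indistinguishable from the interaction channel of $V^*$ with the honest prover; and for every polynomial-time $V^*$ there is a polynomial-time simulator, given $x$ and $E$, whose channel is statistically indistinguishable from the interaction channel of $V^*$ with the honest prover. 3. In both cases the simulator can be taken on the prover's side: for every special honest-verifier simulator $\mathcal S$ of $\Pi$ of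 the respective type, the channel that first measures all of $C_1,\dots,C_k$, then runs $\mathcal S$ on the outcomes $c_1,\dots,c_k$ to get $a_1,\dots,a_{k+1}$, then measures $P_1,\dots,P_k$ as in commitments to $a_1,\dots,a_k$ with outcomes $z_1,\dots,z_k$, and returns $(a_1,\dots,a_{k+1},z_1,\dots,z_k)$, is polynomial time and is computationally (resp. statistically) indistinguishable from the channel of the honest prover of $\mathsf{RR}[\Pi]$. -/

import Mathlib

/-! ### Qubit registers, operators, channels -/

/-- Operators on the Hilbert space of a register whose qubits are indexed by `ι`
(matrices in the computational basis `ι → Bool`). -/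
abbrev Op (ι : Type) : Type := Matrix (ι → Bool) (ι → Bool) ℂ

open scoped ComplexOrder in
/-- Density operators. -/
def IsDensity {ι : Type} [Fintype ι] [DecidableEq ι] (ρ : Op ι) : Prop :=
  ρ.PosSemidef ∧ ρ.trace = 1

/-- Completely positive trace-preserving maps (Kraus form). -/
def IsCPTP {ι κ : Type} [Fintype ι] [DecidableEq ι] [Fintype κ] [DecidableEq κ]
    (Φ : Op ι → Op κ) : Prop :=
  ∃ (r : ℕ) (K : Fin r → Matrix (κ → Bool) (ι → Bool) ℂ),
    (∀ ρ, Φ ρ = ∑ j, K j * ρ * (K j).conjTranspose) ∧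
      ∑ j, (K j).conjTranspose * K j = 1

/-- `Φ ⊗ id_K`, acting on the first part of a bipartite register. -/
def onFirst {ι κ : Type} (K : Type) (Φ : Op ι → Op κ) (σ : Op (ι ⊕ K)) : Op (κ ⊕ K) :=
  Matrix.of fun x y =>
    Φ (Matrix.of fun a b => σ (Sum.elim a (x ∘ Sum.inr)) (Sum.elim b (y ∘ Sum.inr)))
      (x ∘ Sum.inl) (y ∘ Sum.inl)

open Classical in
/-- The classical state `|b⟩⟨b|`. -/
noncomputable def basisState {ι : Type} (b : ι → Bool) : Op ι :=
  Matrix.of fun x y => if x = b ∧ y = b then 1 else 0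

/-! ### Quantum circuits -/

/-- Elementary gates on wires `W`: Hadamard, the `π/8`-gate `T`, controlled-NOT and
controlled-Hadamard (control first). All wires other than the inputs start in `|0⟩`, and all
wires other than the outputs are traced out at the end. -/
inductive Gate (W : Type) : Type
  | had (w : W)
  | tee (w : W)
  | cnot (c t : W)
  | chad (c t : W)

/-- Relabelling the wires of a gate. -/
def Gate.map {W W' : Type} (f : W → W') : Gate W → Gate W'
  | .had w => .had (f w)
  | .tee w => .tee (f w)
  | .cnot c t => .cnot (f c) (f t)
  | .chad c t => .chad (f c) (f t)

/-- The wires that a gate touches. -/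
def Gate.wires {W : Type} : Gate W → List W
  | .had w => [w]
  | .tee w => [w]
  | .cnot c t => [c, t]
  | .chad c t => [c, t]

/-- The `(s, t)` entry of the Hadamard matrix. -/
noncomputable def hadEntry (s t : Bool) : ℂ :=
  if s && t then -((Real.sqrt 2 : ℝ) : ℂ)⁻¹ else ((Real.sqrt 2 : ℝ) : ℂ)⁻¹

/-- The `(s, t)` entry of `T = diag(1, e^{iπ/4})`. -/
noncomputable def teeEntry (s t : Bool) : ℂ :=
  if s = t then (if s then Complex.exp (Complex.I * (Real.pi / 4 : ℝ)) else 1) else 0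

/-- The `(s, t)` entry of the NOT matrix. -/
def notEntry (s t : Bool) : ℂ := if s = t then 0 else 1

open Classical in
/-- Matrix entry of the one-qubit operator `u` applied to wire `w`. -/
noncomputable def localEntry {W : Type} (u : Bool → Bool → ℂ) (w : W) (x y : W → Bool) : ℂ :=
  if ∀ v, v ≠ w → x v = y v then u (x w) (y w) else 0

open Classical in
/-- Matrix entry of `u` on the target `t`, controlled by `c`
(a controlled gate whose two wires coincide does nothing). -/
noncomputable def ctrlEntry {W : Type} (u : Bool → Bool → ℂ) (c t : W) (x y : W → Bool) : ℂ :=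
  if c ≠ t ∧ y c = true then localEntry u t x y else if x = y then 1 else 0

/-- Matrix entry of a gate between two computational basis configurations of the wires. -/
noncomputable def Gate.entry {W : Type} : Gate W → (W → Bool) → (W → Bool) → ℂ
  | .had w => localEntry hadEntry w
  | .tee w => localEntry teeEntry w
  | .cnot c t => ctrlEntry notEntry c t
  | .chad c t => ctrlEntry hadEntry c t

/-- A configuration of the wires in `F`, all other wires being `0`. -/
def extendZero {W : Type} [DecidableEq W] (F : Finset W) (x : F → Bool) (w : W) : Bool :=
  if h : w ∈ F then x ⟨w, h⟩ else false

/-- The unitary of a circuit on the finite wire set `F` (the head of the list is applied first). -/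
noncomputable def circuitUnitary {W : Type} [DecidableEq W] (F : Finset W) (G : List (Gate W)) :
    Op F :=
  G.foldl (fun U g => (Matrix.of fun x y => g.entry (extendZero F x) (extendZero F y)) * U) 1

open Classical in
/-- The isometry `|b⟩ ↦ |b⟩|0…0⟩` that puts the input register on the wires `inp`. -/
noncomputable def inputIsometry {W ι : Type} [DecidableEq W] (F : Finset W) (inp : ι → W) :
    Matrix (F → Bool) (ι → Bool) ℂ :=
  Matrix.of fun x b =>
    if (∀ i, extendZero F x (inp i) = b i) ∧
      ∀ w, w ∉ Set.range inp → extendZero F x w = false then 1 else 0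

open Classical in
/-- Partial trace over all wires of `F` that are not among the wires `out`. -/
noncomputable def traceOut {W κ : Type} [DecidableEq W] (F : Finset W) (out : κ → W)
    (M : Op F) : Op κ :=
  Matrix.of fun y y' => ∑ x : F → Bool, ∑ x' : F → Bool,
    if (∀ j, extendZero F x (out j) = y j) ∧ (∀ j, extendZero F x' (out j) = y' j) ∧
      (∀ w, w ∉ Set.range out → extendZero F x w = extendZero F x' w) then M x x' else 0

/-- The finite set of wires relevant for a circuit with given inputs and outputs. -/
def circuitWires {W ι κ : Type} [DecidableEq W] [Fintype ι] [Fintype κ]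
    (G : List (Gate W)) (inp : ι → W) (out : κ → W) : Finset W :=
  (G.flatMap Gate.wires).toFinset ∪ Finset.univ.image inp ∪ Finset.univ.image out

/-- The channel computed by a circuit, on a finite wire set `F` that contains the relevant ones. -/
noncomputable def circuitChannelOn {W ι κ : Type} [DecidableEq W] [Fintype ι] [DecidableEq ι]
    (F : Finset W) (G : List (Gate W)) (inp : ι → W) (out : κ → W) (ρ : Op ι) : Op κ :=
  traceOut F out ((circuitUnitary F G * inputIsometry F inp) * ρ *
    (circuitUnitary F G * inputIsometry F inp).conjTranspose)

/-- The channel computed by a circuit. -/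
noncomputable def circuitChannel {W ι κ : Type} [DecidableEq W] [Fintype ι] [DecidableEq ι]
    [Fintype κ] (G : List (Gate W)) (inp : ι → W) (out : κ → W) : Op ι → Op κ :=
  circuitChannelOn (circuitWires G inp out) G inp out

/-! ### Polynomial time: uniformly generated circuits -/

/-- Wires are array cells: a register name together with a list of indices. -/
abbrev Wire : Type := List ℕ × List ℕ

/-- Programs of a multi-stack machine (stacks of bits, named by `ℕ`) that write out a circuit.
`emit g` appends a gate; its wires are given by a register name and the list of the stacks whose
current heights are the indices of the array cell. -/
inductive Prog : Type
  | skip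
  | push (b : Bool) (v : ℕ)
  | pop (v : ℕ)
  | emit (g : Gate (List ℕ × List ℕ))
  | seq (p q : Prog)
  | ifTop (v : ℕ) (p q : Prog)
  | whileNonempty (v : ℕ) (p : Prog)

/-- The wire `name[v₁, …, v_r]` denoted by an address in the memory state `s`. -/
def resolve (s : ℕ → List Bool) (a : List ℕ × List ℕ) : Wire :=
  (a.1, a.2.map fun v => (s v).length)

/-- `Exec p s s' G t`: from memory `s` the program `p` halts in memory `s'` after `t` steps,
having written the circuit `G`. -/
inductive Exec : Prog → (ℕ → List Bool) → (ℕ → List Bool) → List (Gate Wire) → ℕ → Prop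
  | skip (s : ℕ → List Bool) : Exec .skip s s [] 1
  | push (b : Bool) (v : ℕ) (s : ℕ → List Bool) :
      Exec (.push b v) s (Function.update s v (b :: s v)) [] 1
  | pop (v : ℕ) (s : ℕ → List Bool) :
      Exec (.pop v) s (Function.update s v (s v).tail) [] 1
  | emit (g : Gate (List ℕ × List ℕ)) (s : ℕ → List Bool) :
      Exec (.emit g) s s [g.map (resolve s)] 1
  | seq {p q : Prog} {s₀ s₁ s₂ : ℕ → List Bool} {G₁ G₂ : List (Gate Wire)} {t₁ t₂ : ℕ} :
      Exec p s₀ s₁ G₁ t₁ → Exec q s₁ s₂ G₂ t₂ → Exec (.seq p q) s₀ s₂ (G₁ ++ G₂) (t₁ + t₂)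
  | ifTrue {v : ℕ} {p q : Prog} {s₀ s₁ : ℕ → List Bool} {G : List (Gate Wire)} {t : ℕ} :
      (s₀ v).head? = some true → Exec p s₀ s₁ G t → Exec (.ifTop v p q) s₀ s₁ G (t + 1)
  | ifFalse {v : ℕ} {p q : Prog} {s₀ s₁ : ℕ → List Bool} {G : List (Gate Wire)} {t : ℕ} :
      (s₀ v).head? ≠ some true → Exec q s₀ s₁ G t → Exec (.ifTop v p q) s₀ s₁ G (t + 1)
  | whileStop {v : ℕ} {p : Prog} {s : ℕ → List Bool} :
      s v = [] → Exec (.whileNonempty v p) s s [] 1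
  | whileStep {v : ℕ} {p : Prog} {s₀ s₁ s₂ : ℕ → List Bool} {G₁ G₂ : List (Gate Wire)}
      {t₁ t₂ : ℕ} :
      s₀ v ≠ [] → Exec p s₀ s₁ G₁ t₁ → Exec (.whileNonempty v p) s₁ s₂ G₂ t₂ →
        Exec (.whileNonempty v p) s₀ s₂ (G₁ ++ G₂) (t₁ + t₂ + 1)

/-- Initial memory: the input string on stack `0`, all other stacks empty. -/
def initMem (x : List Bool) : ℕ → List Bool := fun v => if v = 0 then x else []

/-- Length functions computable in polynomial time (hence polynomially bounded): some program
run on `x` halts in `poly(|x|)` steps with a stack of height `f |x|`. -/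
def PolyTimeLength (f : ℕ → ℕ) : Prop :=
  ∃ (p : Prog) (b : Polynomial ℕ), ∀ x : List Bool, ∃ s G t,
    Exec p (initMem x) s G t ∧ t ≤ b.eval x.length ∧ (s 1).length = f x.length

/-- A family of qubit registers, one for each value of the security parameter, together with
names for the qubits. -/
structure Register where
  Idx : ℕ → Type
  fin : ∀ n, Fintype (Idx n)
  dec : ∀ n, DecidableEq (Idx n)
  label : ∀ n, Idx n → Wire
  label_inj : ∀ n, Function.Injective (label n)

attribute [instance] Register.fin Register.dec

/-- Put a tag in front of the register name of a wire. -/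
def tagWire (r : ℕ) (w : Wire) : Wire := (r :: w.1, w.2)

theorem tagWire_inj {r r' : ℕ} {w w' : Wire} (h : tagWire r w = tagWire r' w') :
    r = r' ∧ w = w' := by
  obtain ⟨a, b⟩ := w
  obtain ⟨a', b'⟩ := w'
  simp only [tagWire, Prod.mk.injEq, List.cons.injEq] at h
  exact ⟨h.1.1, Prod.ext h.1.2 h.2⟩

/-- A register of `e n` qubits. -/
def Register.ofSize (e : ℕ → ℕ) : Register where
  Idx n := Fin (e n)
  fin n := inferInstance
  dec n := inferInstance
  label n j := ([], [j.val])
  label_inj n i j h := by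
    simp only [Prod.mk.injEq, List.cons.injEq] at h
    exact Fin.ext h.2.1

/-- The joint register of two registers. -/
def Register.sum (A B : Register) : Register where
  Idx n := A.Idx n ⊕ B.Idx n
  fin n := inferInstance
  dec n := inferInstance
  label n := Sum.elim (fun i => tagWire 0 (A.label n i)) (fun i => tagWire 1 (B.label n i))
  label_inj n i j h := by
    rcases i with i | i <;> rcases j with j | j <;> simp only [Sum.elim_inl, Sum.elim_inr] at h
    · exact congrArg _ (A.label_inj n (tagWire_inj h).2)
    · exact absurd (tagWire_inj h).1 (by decide)
    · exact absurd (tagWire_inj h).1 (by decide)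
    · exact congrArg _ (B.label_inj n (tagWire_inj h).2)

/-- A family of channels indexed by strings `x` is polynomial time if a classical program, run on
`x`, writes in `poly(|x|)` steps a quantum circuit that computes the channel. The input wires are
tagged `0`, the output wires `1`. -/
def PolyTime (A B : Register)
    (Φ : ∀ x : List Bool, Op (A.Idx x.length) → Op (B.Idx x.length)) : Prop :=
  ∃ (p : Prog) (b : Polynomial ℕ), ∀ x : List Bool, ∃ s G t,
    Exec p (initMem x) s G t ∧ t ≤ b.eval x.length ∧
      Φ x = circuitChannel G (fun i => tagWire 0 (A.label x.length i))
        (fun j => tagWire 1 (B.label x.length j))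

/-- Polynomially bounded functions. -/
def PolyBounded (e : ℕ → ℕ) : Prop := ∃ b : Polynomial ℕ, ∀ n, e n ≤ b.eval n

/-! ### Indistinguishability of channel families -/

/-- Negligible functions. -/
def Negligible (ε : ℕ → ℝ) : Prop :=
  Asymptotics.SuperpolynomialDecay Filter.atTop (fun n : ℕ => (n : ℝ)) ε

/-- A (non-uniform) measurement circuit on a register `ι`, with one output qubit. -/
structure MeasCircuit (ι : Type) where
  gates : List (Gate Wire)
  input : ι → Wire
  input_inj : Function.Injective input
  output : Wire

/-- The probability that the measurement circuit outputs `1` on `ρ`. -/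
noncomputable def MeasCircuit.prob {ι : Type} [Fintype ι] [DecidableEq ι]
    (D : MeasCircuit ι) (ρ : Op ι) : ℝ :=
  (circuitChannel D.gates D.input (fun _ : Unit => D.output) ρ
    (fun _ => true) (fun _ => true)).re

/-- Families of channels, indexed by a common input `x` and a private input `w` of the prover. -/
abbrev ChannelFamily (A B : Register) : Type :=
  ∀ x _w : List Bool, Op (A.Idx x.length) → Op (B.Idx x.length)

/-- Computational indistinguishability over the index set `J`: polynomial-size circuits, with an
arbitrary state on the input register and a side register of polynomial size, have negligible
advantage in `|x|`. -/
def CompIndist {A B : Register} (J : Set (List Bool × List Bool))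
    (Φ Ψ : ChannelFamily A B) : Prop :=
  ∀ b : Polynomial ℕ, ∃ ε : ℕ → ℝ, Negligible ε ∧ ∀ x w : List Bool, (x, w) ∈ J →
    ∀ (K : Type) [Fintype K] [DecidableEq K], Fintype.card K ≤ b.eval x.length →
    ∀ D : MeasCircuit (B.Idx x.length ⊕ K), D.gates.length ≤ b.eval x.length →
    ∀ σ : Op (A.Idx x.length ⊕ K), IsDensity σ →
      |D.prob (onFirst K (Φ x w) σ) - D.prob (onFirst K (Ψ x w) σ)| ≤ ε x.length

/-- Statistical indistinguishability: the same for arbitrary side registers and arbitrary channels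
with a one-qubit output, which is then measured. -/
def StatIndist {A B : Register} (J : Set (List Bool × List Bool))
    (Φ Ψ : ChannelFamily A B) : Prop :=
  ∃ ε : ℕ → ℝ, Negligible ε ∧ ∀ x w : List Bool, (x, w) ∈ J →
    ∀ (K : Type) [Fintype K] [DecidableEq K],
    ∀ D : Op (B.Idx x.length ⊕ K) → Op Unit, IsCPTP D →
    ∀ σ : Op (A.Idx x.length ⊕ K), IsDensity σ →
      |(D (onFirst K (Φ x w) σ) (fun _ => true) (fun _ => true)).re
        - (D (onFirst K (Ψ x w) σ) (fun _ => true) (fun _ => true)).re| ≤ ε x.length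

/-! ### Classical public-coin interactive proofs and special honest-verifier zero-knowledge -/

/-- A classical public-coin interactive proof system for a language: on a common input of length
`n` there are `rounds n` uniformly random challenges of `chalLen n` bits and `rounds n + 1` prover
messages of `msgLen n` bits; the prover sends the first and the last message.
`next x w [(a₁, c₁), …, (aᵢ, cᵢ)]` is the distribution of the prover's message `aᵢ₊₁`, where `w` is
the prover's private input; `wit x w` says that `w` is admissible for `x` (e.g. a witness). -/
structure PublicCoinProof where
  lang : Set (List Bool)
  wit : List Bool → List Bool → Prop
  wit_exists : ∀ x ∈ lang, ∃ w, wit x w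
  rounds : ℕ → ℕ
  msgLen : ℕ → ℕ
  chalLen : ℕ → ℕ
  rounds_polyTime : PolyTimeLength rounds
  msgLen_polyTime : PolyTimeLength msgLen
  chalLen_polyTime : PolyTimeLength chalLen
  next : ∀ x _w : List Bool,
    List ((Fin (msgLen x.length) → Bool) × (Fin (chalLen x.length) → Bool)) →
      PMF (Fin (msgLen x.length) → Bool)
  accept : ∀ x : List Bool,
    (Fin (rounds x.length + 1) × Fin (msgLen x.length) → Bool) →
      (Fin (rounds x.length) × Fin (chalLen x.length) → Bool) → Prop

namespace PublicCoinProof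

variable (I : PublicCoinProof)

/-- The instances: `x` in the language with an admissible private input of the prover. -/
def instances : Set (List Bool × List Bool) := {q | q.1 ∈ I.lang ∧ I.wit q.1 q.2}

/-- The register of all challenges `c₁, …, c_k`. -/
def chalReg : Register where
  Idx n := Fin (I.rounds n) × Fin (I.chalLen n)
  fin n := inferInstance
  dec n := inferInstance
  label n q := ([], [q.1.val, q.2.val])
  label_inj n p q h := by
    simp only [Prod.mk.injEq, List.cons.injEq] at h
    exact Prod.ext (Fin.ext h.2.1) (Fin.ext h.2.2.1)

/-- The register of all prover messages `a₁, …, a_{k+1}`. -/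
def ansReg : Register where
  Idx n := Fin (I.rounds n + 1) × Fin (I.msgLen n)
  fin n := inferInstance
  dec n := inferInstance
  label n q := ([], [q.1.val, q.2.val])
  label_inj n p q h := by
    simp only [Prod.mk.injEq, List.cons.injEq] at h
    exact Prod.ext (Fin.ext h.2.1) (Fin.ext h.2.2.1)

/-- The first `i` pairs (prover message, challenge). -/
def history {n : ℕ} (a : (I.ansReg.Idx n) → Bool) (c : (I.chalReg.Idx n) → Bool)
    (i : Fin (I.rounds n + 1)) : List ((Fin (I.msgLen n) → Bool) × (Fin (I.chalLen n) → Bool)) :=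
  List.ofFn fun j : Fin i.val =>
    ((fun q => a (⟨j.val, by omega⟩, q)), (fun q => c (⟨j.val, by omega⟩, q)))

/-- The probability that the prover's message number `i` (counted from `0`) is the one in `a`,
given the transcript so far. -/
noncomputable def nextProb (x w : List Bool) (a : I.ansReg.Idx x.length → Bool)
    (c : I.chalReg.Idx x.length → Bool) (i : Fin (I.rounds x.length + 1)) : ℝ :=
  (I.next x w (I.history a c i) (fun q => a (i, q))).toReal

/-- The probability of the prover messages `a` when the challenges are fixed to `c`. -/
noncomputable def transcriptProb (x w : List Bool) (a : I.ansReg.Idx x.length → Bool)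
    (c : I.chalReg.Idx x.length → Bool) : ℝ :=
  ∏ i, I.nextProb x w a c i

/-- The oracle that measures a query `c` and answers with the prover messages of an honest
execution in which the challenges are fixed to `c`. -/
noncomputable def realOracle : ChannelFamily I.chalReg I.ansReg := fun x w ρ =>
  Matrix.diagonal fun a => ∑ c, ρ c c * (I.transcriptProb x w a c : ℂ)

/-- The probability that a simulator outputs `a` on the challenges `c`. -/
noncomputable def simProb
    (S : ∀ x : List Bool, Op (I.chalReg.Idx x.length) → Op (I.ansReg.Idx x.length))
    (x : List Bool) (a : I.ansReg.Idx x.length → Bool) (c : I.chalReg.Idx x.length → Bool) : ℂ :=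
  S x (basisState c) a a

/-- The oracle that measures a query `c` and answers with the (measured) output of `S` on `c`. -/
noncomputable def simOracle
    (S : ∀ x : List Bool, Op (I.chalReg.Idx x.length) → Op (I.ansReg.Idx x.length)) :
    ChannelFamily I.chalReg I.ansReg := fun x _ ρ =>
  Matrix.diagonal fun a => ∑ c, ρ c c * I.simProb S x a c

/-- `S` is a simulator witnessing computational special honest-verifier zero-knowledge. -/
def IsSpecialCompSimulator
    (S : ∀ x : List Bool, Op (I.chalReg.Idx x.length) → Op (I.ansReg.Idx x.length)) : Prop :=
  PolyTime I.chalReg I.ansReg S ∧ CompIndist I.instances (I.simOracle S) I.realOracle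

/-- `S` is a simulator witnessing statistical special honest-verifier zero-knowledge. -/
def IsSpecialStatSimulator
    (S : ∀ x : List Bool, Op (I.chalReg.Idx x.length) → Op (I.ansReg.Idx x.length)) : Prop :=
  PolyTime I.chalReg I.ansReg S ∧ StatIndist I.instances (I.simOracle S) I.realOracle

/-- Special quantum honest-verifier computational zero-knowledge. -/
def IsSpecialHVCZK : Prop := ∃ S, I.IsSpecialCompSimulator S

/-- Special quantum honest-verifier statistical zero-knowledge. -/
def IsSpecialHVSZK : Prop := ∃ S, I.IsSpecialStatSimulator S

end PublicCoinProof

/-! ### Two-message quantum proofs and quantum zero-knowledge -/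

/-- A two-message quantum interactive proof: the verifier draws uniform coins and sends a quantum
message, the prover answers by a channel, and the verifier decides from its coins and the
(classical) answer. -/
structure TwoMessageProof where
  lang : Set (List Bool)
  wit : List Bool → List Bool → Prop
  fromVerifier : Register
  fromProver : Register
  prover : ChannelFamily fromVerifier fromProver
  Coins : ℕ → Type
  coins_fin : ∀ n, Fintype (Coins n)
  coins_nonempty : ∀ n, Nonempty (Coins n)
  message : ∀ x : List Bool, Coins x.length → Op (fromVerifier.Idx x.length)
  accept : ∀ x : List Bool, Coins x.length → (fromProver.Idx x.length → Bool) → Prop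

namespace TwoMessageProof

variable (T : TwoMessageProof)

/-- The instances: `x` in the language with an admissible private input of the prover. -/
def instances : Set (List Bool × List Bool) := {q | q.1 ∈ T.lang ∧ T.wit q.1 q.2}

/-- A possibly malicious verifier with auxiliary input register of size `e`, private memory of
size `e'` kept between the two messages (of any size, there is no memory bound), and output
register of size `o`. -/
structure Verifier (e e' o : ℕ → ℕ) where
  first : ∀ x : List Bool, Op ((Register.ofSize e).Idx x.length) →
    Op ((T.fromVerifier.sum (Register.ofSize e')).Idx x.length)
  second : ∀ x : List Bool, Op ((T.fromProver.sum (Register.ofSize e')).Idx x.length) →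
    Op ((Register.ofSize o).Idx x.length)

/-- Both actions of the verifier are polynomial time. -/
def Verifier.IsPolyTime {T : TwoMessageProof} {e e' o : ℕ → ℕ} (V : T.Verifier e e' o) : Prop :=
  PolyTime (Register.ofSize e) (T.fromVerifier.sum (Register.ofSize e')) V.first ∧
    PolyTime (T.fromProver.sum (Register.ofSize e')) (Register.ofSize o) V.second

/-- Both actions of the verifier are quantum channels (otherwise arbitrary). -/
def Verifier.IsChannel {T : TwoMessageProof} {e e' o : ℕ → ℕ} (V : T.Verifier e e' o) : Prop :=
  ∀ x, IsCPTP (V.first x) ∧ IsCPTP (V.second x)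

/-- The channel from the verifier's auxiliary input to its output that is induced by the
interaction of the verifier with a party answering its message by the channel `P`. -/
def Verifier.interact {T : TwoMessageProof} {e e' o : ℕ → ℕ} (V : T.Verifier e e' o)
    (P : ChannelFamily T.fromVerifier T.fromProver) :
    ChannelFamily (Register.ofSize e) (Register.ofSize o) := fun x w ρ =>
  V.second x (onFirst (Fin (e' x.length)) (P x w) (V.first x ρ))

/-- Computational quantum zero-knowledge: for every polynomial-time verifier there is a
polynomial-time simulator computing a computationally indistinguishable channel. The verifier's
input and output registers have polynomially bounded size; the size of its private memory, which
is part of its algorithm, is computable in polynomial time (otherwise it could encode advice). -/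
def IsCompQZK : Prop :=
  ∀ e e' o : ℕ → ℕ, PolyBounded e → PolyTimeLength e' → PolyBounded o →
    ∀ V : T.Verifier e e' o, V.IsPolyTime →
      ∃ S : ∀ x : List Bool, Op ((Register.ofSize e).Idx x.length) →
          Op ((Register.ofSize o).Idx x.length),
        PolyTime (Register.ofSize e) (Register.ofSize o) S ∧
          CompIndist T.instances (V.interact T.prover) (fun x _ => S x)

/-- Statistical quantum zero-knowledge. For an unbounded verifier the simulator is polynomial time
relative to the verifier: it runs the verifier once, as a black box, and answers its message by a
polynomial-time channel `S`. If the verifier is polynomial time, so is the whole simulator. -/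
def IsStatQZK : Prop :=
  (∀ (e e' o : ℕ → ℕ) (V : T.Verifier e e' o), V.IsChannel →
    ∃ S : ∀ x : List Bool, Op (T.fromVerifier.Idx x.length) → Op (T.fromProver.Idx x.length),
      PolyTime T.fromVerifier T.fromProver S ∧
        StatIndist T.instances (V.interact T.prover) (V.interact fun x _ => S x)) ∧
  ∀ e e' o : ℕ → ℕ, PolyBounded e → PolyTimeLength e' → PolyBounded o →
    ∀ V : T.Verifier e e' o, V.IsPolyTime →
      ∃ S : ∀ x : List Bool, Op ((Register.ofSize e).Idx x.length) →
          Op ((Register.ofSize o).Idx x.length),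
        PolyTime (Register.ofSize e) (Register.ofSize o) S ∧
          StatIndist T.instances (V.interact T.prover) (fun x _ => S x)

end TwoMessageProof

/-! ### The round-compression transform -/

/-- The amplitudes of the state `|s⟩` in the computational basis (`θ = false`) or in the Hadamard
basis (`θ = true`). -/
noncomputable def conjugateCoding (θ s : Bool) (y : Bool) : ℂ :=
  if θ then hadEntry y s else if y = s then 1 else 0

namespace PublicCoinProof

variable (I : PublicCoinProof) (N : ℕ → ℕ)

/-- The commitment registers `P₁, …, P_k`: `N n` qubits for each bit of each of the first `k`
prover messages. The same shape holds the opening strings `z₁, …, z_k`. -/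
def commitReg : Register where
  Idx n := Fin (I.rounds n) × Fin (I.msgLen n) × Fin (N n)
  fin n := inferInstance
  dec n := inferInstance
  label n q := ([], [q.1.val, q.2.1.val, q.2.2.val])
  label_inj n p q h := by
    simp only [Prod.mk.injEq, List.cons.injEq] at h
    exact Prod.ext (Fin.ext h.2.1) (Prod.ext (Fin.ext h.2.2.1) (Fin.ext h.2.2.2.1))

/-- The verifier's message: all registers `Pᵢ` and `Cᵢ`. -/
def rrQuery : Register := (I.commitReg N).sum I.chalReg

/-- The prover's message: `a₁, …, a_{k+1}` and `z₁, …, z_k`. -/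
def rrReply : Register := I.ansReg.sum (I.commitReg N)

open Classical in
/-- The projector for outcome `zᵢ` when register `Pᵢ` is measured as in a commitment to `aᵢ`:
the qubits that belong to bit `j` of `aᵢ` are measured in the computational basis if this bit is
`0` and in the Hadamard basis if it is `1`. -/
noncomputable def commitProj {n : ℕ} (a : I.ansReg.Idx n → Bool) (z : (I.commitReg N).Idx n → Bool)
    (i : Fin (I.rounds n)) : Op ((I.rrQuery N).Idx n) :=
  Matrix.of fun x y =>
    if (∀ q : (I.commitReg N).Idx n, q.1 ≠ i → x (Sum.inl q) = y (Sum.inl q)) ∧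
        (∀ q : I.chalReg.Idx n, x (Sum.inr q) = y (Sum.inr q)) then
      ∏ j : Fin (I.msgLen n), ∏ t : Fin (N n),
        conjugateCoding (a (i.castSucc, j)) (z (i, j, t)) (x (Sum.inl (i, j, t))) *
          star (conjugateCoding (a (i.castSucc, j)) (z (i, j, t)) (y (Sum.inl (i, j, t))))
    else 0

open Classical in
/-- The projector for outcome `cᵢ` when register `Cᵢ` is measured in the computational basis. -/
noncomputable def chalProj {n : ℕ} (c : I.chalReg.Idx n → Bool) (i : Fin (I.rounds n)) :
    Op ((I.rrQuery N).Idx n) :=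
  Matrix.of fun x y =>
    if x = y ∧ ∀ j : Fin (I.chalLen n), x (Sum.inr (i, j)) = c (i, j) then 1 else 0

/-- The unnormalised state on the branch `(a, z, c)` of the honest prover's execution. First `a₁`
is drawn; then, for `i = 1, …, k` in this order, `Pᵢ` is measured as a commitment to `aᵢ` with
outcome `zᵢ`, then `Cᵢ` is measured with outcome `cᵢ`, and `aᵢ₊₁` is drawn. -/
noncomputable def rrBranch (x w : List Bool) (a : I.ansReg.Idx x.length → Bool)
    (z : (I.commitReg N).Idx x.length → Bool) (c : I.chalReg.Idx x.length → Bool)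
    (ρ : Op ((I.rrQuery N).Idx x.length)) : Op ((I.rrQuery N).Idx x.length) :=
  (List.finRange (I.rounds x.length)).foldl
    (fun ρ i =>
      (I.nextProb x w a c i.succ : ℂ) •
        (I.chalProj N c i * (I.commitProj N a z i * ρ * I.commitProj N a z i) * I.chalProj N c i))
    ((I.nextProb x w a c 0 : ℂ) • ρ)

/-- The channel of the honest prover of the compressed protocol. -/
noncomputable def rrProver : ChannelFamily (I.rrQuery N) (I.rrReply N) := fun x w ρ =>
  Matrix.diagonal fun r => ∑ c,
    (I.rrBranch N x w (r ∘ Sum.inl) (r ∘ Sum.inr) c ρ).trace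

/-- The round compression `RR[I]`, with `N n` qubits per committed bit. The verifier's coins are
the bases, the encoded bits and the challenges. -/
noncomputable def RR : TwoMessageProof where
  lang := I.lang
  wit := I.wit
  fromVerifier := I.rrQuery N
  fromProver := I.rrReply N
  prover := I.rrProver N
  Coins n := ((I.commitReg N).Idx n → Bool) × ((I.commitReg N).Idx n → Bool) ×
    (I.chalReg.Idx n → Bool)
  coins_fin _ := inferInstance
  coins_nonempty _ := inferInstance
  message x r :=
    let ψ : ((I.rrQuery N).Idx x.length → Bool) → ℂ := fun y =>
      (∏ q, conjugateCoding (r.1 q) (r.2.1 q) (y (Sum.inl q))) *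
        ∏ q, conjugateCoding false (r.2.2 q) (y (Sum.inr q))
    Matrix.vecMulVec ψ (star ψ)
  accept x r y :=
    (∀ q : (I.commitReg N).Idx x.length,
      r.1 q = y (Sum.inl (q.1.castSucc, q.2.1)) → y (Sum.inr q) = r.2.1 q) ∧
      I.accept x (y ∘ Sum.inl) r.2.2

/-- The unnormalised state on a branch of the prover-side simulator: all registers `Cᵢ` are
measured first, then `S` is run on the outcomes `c`, and then every `Pᵢ` is measured as a
commitment to the message `aᵢ` output by `S`. -/
noncomputable def rrSimBranch
    (S : ∀ x : List Bool, Op (I.chalReg.Idx x.length) → Op (I.ansReg.Idx x.length))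
    (x : List Bool) (a : I.ansReg.Idx x.length → Bool)
    (z : (I.commitReg N).Idx x.length → Bool) (c : I.chalReg.Idx x.length → Bool)
    (ρ : Op ((I.rrQuery N).Idx x.length)) : Op ((I.rrQuery N).Idx x.length) :=
  (List.finRange (I.rounds x.length)).foldl
    (fun ρ i => I.commitProj N a z i * ρ * I.commitProj N a z i)
    (I.simProb S x a c •
      (List.finRange (I.rounds x.length)).foldl
        (fun ρ i => I.chalProj N c i * ρ * I.chalProj N c i) ρ)

/-- The prover-side simulator for `RR[I]` built from a simulator `S` for `I`. -/
noncomputable def rrSimulator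
    (S : ∀ x : List Bool, Op (I.chalReg.Idx x.length) → Op (I.ansReg.Idx x.length))
    (x : List Bool) (ρ : Op ((I.rrQuery N).Idx x.length)) : Op ((I.rrReply N).Idx x.length) :=
  Matrix.diagonal fun r => ∑ c,
    (I.rrSimBranch N S x (r ∘ Sum.inl) (r ∘ Sum.inr) c ρ).trace

end PublicCoinProof

/-!
The honest prover measures `P₁, …, Pₖ` as commitments and `C₁, …, Cₖ` in the computational basis,
all on disjoint sets of qubits. These measurements commute, even though the bases of later
commitments depend on challenges measured earlier. Hence the honest prover acts as the algorithm
that measures all of `C₁, …, Cₖ` first, obtains `a₁, …, aₖ₊₁` from the oracle that answers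
challenges with the honest prover messages, and then measures `P₁, …, Pₖ` as in commitments to
`a₁, …, aₖ`. The simulator is the same algorithm with the oracle replaced by the special
honest-verifier simulator. So the two channels are indistinguishable, because (efficient) pre- and
post-processing, here the query of the oracle, the measurement of `P₁, …, Pₖ`, and the two
channels of `V*`, can be absorbed into a distinguisher, and a malicious verifier is simulated by
running it with the simulated prover.

On the side of circuits, a gate acts on kernels over the configurations of all wires in the
Heisenberg picture, so that circuits over infinitely many wire names can be composed without
fixing a finite set of wires that contains both of them.
-/

/-! ### Pulling kernels back through circuits -/

section Pull

variable {W W' ι κ : Type}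

/-- A kernel on pairs of configurations of all wires. Kernels play the role of observables; unlike
operators they make sense without fixing a finite set of wires. -/
abbrev WireKernel (W : Type) : Type := (W → Bool) → (W → Bool) → ℂ

/-- The wire on which a gate acts (for a controlled gate, its target). -/
def Gate.target : Gate W → W
  | .had w => w
  | .tee w => w
  | .cnot _ t => t
  | .chad _ t => t

open Classical in
/-- The one-qubit matrix that a gate applies to its target in the configuration `y`. -/
noncomputable def Gate.mat : Gate W → (W → Bool) → Bool → Bool → ℂ
  | .had _, _ => hadEntry
  | .tee _, _ => teeEntry
  | .cnot c t, y => if c ≠ t ∧ y c = true then notEntry else fun s s' => if s = s' then 1 else 0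
  | .chad c t, y => if c ≠ t ∧ y c = true then hadEntry else fun s s' => if s = s' then 1 else 0

theorem Gate.target_mem_wires (g : Gate W) : g.target ∈ g.wires := by
  cases g <;> simp [Gate.target, Gate.wires]

theorem Gate.target_map (f : W → W') (g : Gate W) : (g.map f).target = f g.target := by
  cases g <;> rfl

theorem Gate.map_map {W'' : Type} (f : W → W') (f' : W' → W'') (g : Gate W) :
    (g.map f).map f' = g.map (f' ∘ f) := by
  cases g <;> rfl

open Classical in
theorem Gate.mat_map {f : W → W'} (hf : Function.Injective f) (g : Gate W) (X : W' → Bool) :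
    (g.map f).mat X = g.mat (X ∘ f) := by
  rcases g with w | w | ⟨c, t⟩ | ⟨c, t⟩
  · rfl
  · rfl
  all_goals exact if_congr (by simp [hf.eq_iff]) rfl rfl

theorem Gate.mat_update [DecidableEq W] (g : Gate W) (y : W → Bool) (s : Bool) :
    g.mat (Function.update y g.target s) = g.mat y := by
  rcases g with w | w | ⟨c, t⟩ | ⟨c, t⟩
  · rfl
  · rfl
  all_goals by_cases h : c = t <;> simp [Gate.mat, Gate.target, h]

open Classical in
theorem ctrlEntry_eq (u : Bool → Bool → ℂ) (c t : W) (x y : W → Bool) :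
    ctrlEntry u c t x y = if ∀ v, v ≠ t → x v = y v then
      (if c ≠ t ∧ y c = true then u else fun s s' => if s = s' then 1 else 0) (x t) (y t)
      else 0 := by
  have hxy : x = y ↔ (∀ v, v ≠ t → x v = y v) ∧ x t = y t :=
    ⟨fun h => by simp [h], fun h => funext fun v => (eq_or_ne v t).elim (· ▸ h.2) (h.1 v)⟩
  unfold ctrlEntry localEntry
  by_cases hc : c ≠ t ∧ y c = true
  · rw [if_pos hc, if_pos hc]
  · rw [if_neg hc, if_neg hc, ← ite_and]
    exact if_congr hxy rfl rfl

open Classical in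
theorem Gate.entry_eq (g : Gate W) (x y : W → Bool) :
    g.entry x y = if ∀ v, v ≠ g.target → x v = y v then
      g.mat y (x g.target) (y g.target) else 0 := by
  cases g with
  | had w => rfl
  | tee w => rfl
  | cnot c t => exact ctrlEntry_eq _ _ _ _ _
  | chad c t => exact ctrlEntry_eq _ _ _ _ _

/-- The pullback of a kernel through a gate `U`: the Heisenberg picture `Q ↦ Uᴴ Q U`, with the
row index of `Q` belonging to the ket side. -/
noncomputable def Gate.pull [DecidableEq W] (g : Gate W) : WireKernel W →ₗ[ℂ] WireKernel W where
  toFun Q X X' := ∑ s : Bool, ∑ s' : Bool,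
    g.mat X s (X g.target) * star (g.mat X' s' (X' g.target)) *
      Q (Function.update X g.target s) (Function.update X' g.target s')
  map_add' Q Q' := by
    funext X X'
    simp only [Pi.add_apply, mul_add, Finset.sum_add_distrib]
  map_smul' c Q := by
    funext X X'
    simp only [Pi.smul_apply, RingHom.id_apply, Finset.smul_sum, mul_smul_comm]

/-- The pullback of a kernel through a circuit. -/
noncomputable def pull [DecidableEq W] (G : List (Gate W)) : Module.End ℂ (WireKernel W) :=
  (G.map Gate.pull).prod

theorem pull_nil [DecidableEq W] (Q : WireKernel W) : pull [] Q = Q := rfl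

theorem pull_cons [DecidableEq W] (g : Gate W) (G : List (Gate W)) (Q : WireKernel W) :
    pull (g :: G) Q = g.pull (pull G Q) := by
  rw [pull, List.map_cons, List.prod_cons]
  rfl

theorem pull_append [DecidableEq W] (G G' : List (Gate W)) (Q : WireKernel W) :
    pull (G ++ G') Q = pull G (pull G' Q) := by
  rw [pull, List.map_append, List.prod_append]
  rfl

theorem extend_update [DecidableEq W'] {f : W → W'} (hf : Function.Injective f)
    (R : W → Bool) (X : W' → Bool) (w : W) (s : Bool) :
    Function.extend f R (Function.update X (f w) s) =
      Function.extend f R X := by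
  funext v
  by_cases hv : ∃ u, f u = v
  · obtain ⟨u, rfl⟩ := hv
    rw [hf.extend_apply, hf.extend_apply]
  · rw [Function.extend_apply' _ _ _ hv, Function.extend_apply' _ _ _ hv,
      Function.update_of_ne fun h => hv ⟨w, h.symm⟩]

theorem pull_map [DecidableEq W] [DecidableEq W'] {f : W → W'} (hf : Function.Injective f)
    (G : List (Gate W)) (Q : WireKernel W') (X X' : W' → Bool) :
    pull (G.map (Gate.map f)) Q X X' =
      pull G (fun R R' => Q (Function.extend f R X) (Function.extend f R' X'))
        (X ∘ f) (X' ∘ f) := by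
  induction G generalizing X X' with
  | nil =>
    have extend_self (X : W' → Bool) : Function.extend f (X ∘ f) X = X := by
      funext v
      by_cases hv : ∃ u, f u = v
      · obtain ⟨u, rfl⟩ := hv
        exact hf.extend_apply _ _ _
      · exact Function.extend_apply' _ _ _ hv
    simp only [List.map_nil, pull_nil, extend_self]
  | cons g G ih =>
    simp only [List.map_cons, pull_cons, Gate.pull, LinearMap.coe_mk, AddHom.coe_mk,
      Gate.target_map, Gate.mat_map hf, ih, extend_update hf,
      Function.update_comp_eq_of_injective _ hf, Function.comp_apply]

end Pull

/-! ### The kernel of the channel computed by a circuit -/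

section CircuitKernel

variable {W ι κ : Type}

/-- The configuration with the bits `b` on the wires `inp` and zeros elsewhere. -/
noncomputable def inputConfig (inp : ι → W) (b : ι → Bool) : W → Bool :=
  Function.extend inp b fun _ => false

open Classical in
/-- The kernel that selects the outcome pair `(y, y')` on the wires `out` and traces out all other
wires. -/
noncomputable def selectKernel (out : κ → W) (y y' : κ → Bool) : WireKernel W := fun Z Z' =>
  if (∀ j, Z (out j) = y j) ∧ (∀ j, Z' (out j) = y' j) ∧
    ∀ w, w ∉ Set.range out → Z w = Z' w then 1 else 0

theorem inputConfig_apply {inp : ι → W} (h : Function.Injective inp) (b : ι → Bool) (i : ι) :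
    inputConfig inp b (inp i) = b i :=
  h.extend_apply _ _ _

theorem inputConfig_of_notMem_range {inp : ι → W} (b : ι → Bool) {w : W}
    (hw : w ∉ Set.range inp) : inputConfig inp b w = false :=
  Function.extend_apply' _ _ _ hw

theorem eq_inputConfig_iff {inp : ι → W} (h : Function.Injective inp) (b : ι → Bool)
    (X : W → Bool) :
    X = inputConfig inp b ↔ (∀ i, X (inp i) = b i) ∧ ∀ w, w ∉ Set.range inp → X w = false := by
  refine ⟨?_, fun ⟨h1, h2⟩ => funext fun w => ?_⟩
  · rintro rfl
    exact ⟨inputConfig_apply h b, fun w => inputConfig_of_notMem_range b⟩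
  · by_cases hw : w ∈ Set.range inp
    · obtain ⟨i, rfl⟩ := hw
      rw [h1, inputConfig_apply h]
    · rw [h2 w hw, inputConfig_of_notMem_range b hw]

variable [DecidableEq W]

theorem extendZero_update (F : Finset W) (x : F → Bool) (t : F) (s : Bool) :
    extendZero F (Function.update x t s) = Function.update (extendZero F x) t s := by
  funext w
  by_cases h : w = t
  · subst h
    simp [extendZero]
  · rw [Function.update_of_ne h]
    unfold extendZero
    split_ifs with h'
    · exact Function.update_of_ne (fun e => h (congrArg Subtype.val e)) _ _
    · rfl

theorem extendZero_coe {F : Finset W} (x : F → Bool) (w : F) : extendZero F x w = x w := by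
  simp [extendZero]

theorem extendZero_injective (F : Finset W) : Function.Injective (extendZero F) := fun x y h =>
  funext fun w => by simpa only [extendZero_coe] using congrFun h w

theorem extendZero_inputConfig {F : Finset W} {inp : ι → W} (hF : ∀ i, inp i ∈ F)
    (b : ι → Bool) : extendZero F (fun w => inputConfig inp b w) = inputConfig inp b := by
  funext w
  unfold extendZero
  split_ifs with hw
  · rfl
  · refine (inputConfig_of_notMem_range b ?_).symm
    rintro ⟨i, rfl⟩
    exact hw (hF i)

/-- The trace pairing of an operator on the finite wire set `F` with a kernel on all wires. -/
noncomputable def pairing (F : Finset W) (M : Op F) (Q : WireKernel W) : ℂ :=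
  ∑ x, ∑ x', M x x' * Q (extendZero F x) (extendZero F x')

theorem pairing_mul_mul_conjTranspose {β : Type} [Fintype β] (F : Finset W)
    (A : Matrix (F → Bool) β ℂ) (M : Matrix β β ℂ) (Q : WireKernel W) :
    pairing F (A * M * A.conjTranspose) Q = ∑ y, ∑ y', M y y' *
      ∑ x, A x y * ∑ x', star (A x' y') * Q (extendZero F x) (extendZero F x') := by
  simp only [pairing, Matrix.mul_apply, Matrix.conjTranspose_apply, Finset.mul_sum,
    Finset.sum_mul]
  simp_rw [Finset.sum_comm (s := (Finset.univ : Finset (F → Bool)))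
    (t := (Finset.univ : Finset β))]
  rw [Finset.sum_comm]
  refine Finset.sum_congr rfl fun y _ => Finset.sum_congr rfl fun y' _ =>
    Finset.sum_congr rfl fun x _ => Finset.sum_congr rfl fun x' _ => by ring

/-- The matrix of a gate on the finite wire set `F`. -/
noncomputable def gateMatrix (F : Finset W) (g : Gate W) : Op F :=
  Matrix.of fun x y => g.entry (extendZero F x) (extendZero F y)

theorem sum_gateMatrix_mul {F : Finset W} (g : Gate W) (ht : g.target ∈ F) (y : F → Bool)
    (φ : (F → Bool) → ℂ) :
    ∑ z, gateMatrix F g z y * φ z = ∑ s : Bool, g.mat (extendZero F y) s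
      (extendZero F y g.target) * φ (Function.update y ⟨g.target, ht⟩ s) := by
  refine (Finset.sum_of_injOn (fun s => Function.update y ⟨g.target, ht⟩ s)
    (fun s _ s' _ h => by simpa using congrFun h ⟨g.target, ht⟩) (by simp) ?_ ?_).symm
  · intro z _ hz
    simp only [gateMatrix, Matrix.of_apply]
    rw [Gate.entry_eq, if_neg, zero_mul]
    refine fun h => hz ⟨z ⟨g.target, ht⟩, by simp, funext fun w => ?_⟩
    by_cases hw : w = ⟨g.target, ht⟩
    · simp [hw]
    · have := h w.1 fun e => hw (Subtype.ext e)
      simpa only [Function.update_of_ne hw, extendZero_coe] using this.symm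
  · intro s _
    simp only [gateMatrix, Matrix.of_apply, extendZero_update]
    rw [Gate.entry_eq, if_pos fun v hv => Function.update_of_ne hv _ _, Function.update_self]

theorem pairing_gateMatrix {F : Finset W} (g : Gate W) (ht : g.target ∈ F) (M : Op F)
    (Q : WireKernel W) :
    pairing F (gateMatrix F g * M * (gateMatrix F g).conjTranspose) Q = pairing F M (g.pull Q) := by
  have sum_star_mul (y' : F → Bool) (φ : (F → Bool) → ℂ) :
      ∑ x', star (gateMatrix F g x' y') * φ x' = ∑ s' : Bool, star (g.mat (extendZero F y') s'
        (extendZero F y' g.target)) * φ (Function.update y' ⟨g.target, ht⟩ s') := by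
    simpa using congrArg star (sum_gateMatrix_mul g ht y' (star φ))
  rw [pairing_mul_mul_conjTranspose]
  simp_rw [sum_star_mul, sum_gateMatrix_mul g ht]
  simp only [pairing, Gate.pull, LinearMap.coe_mk, AddHom.coe_mk, extendZero_update,
    Finset.mul_sum, mul_assoc]

theorem circuitUnitary_cons (F : Finset W) (g : Gate W) (G : List (Gate W)) :
    circuitUnitary F (g :: G) = circuitUnitary F G * gateMatrix F g := by
  have foldl_mul (G : List (Gate W)) (U : Op F) :
      G.foldl (fun U g => gateMatrix F g * U) U =
        G.foldl (fun U g => gateMatrix F g * U) 1 * U := by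
    induction G generalizing U with
    | nil => simp
    | cons g G ih => rw [List.foldl_cons, List.foldl_cons, ih, ih (_ * 1), mul_one, mul_assoc]
  exact (foldl_mul G (gateMatrix F g * 1)).trans (by rw [mul_one]; rfl)

theorem pairing_circuitUnitary {F : Finset W} {G : List (Gate W)} (hG : ∀ g ∈ G, g.target ∈ F)
    (M : Op F) (Q : WireKernel W) :
    pairing F (circuitUnitary F G * M * (circuitUnitary F G).conjTranspose) Q =
      pairing F M (pull G Q) := by
  induction G generalizing M with
  | nil => simp [circuitUnitary, pull_nil]
  | cons g G ih =>
    rw [pull_cons, ← pairing_gateMatrix g (hG g (by simp)),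
      ← ih fun g hg => hG g (by simp [hg]), circuitUnitary_cons, Matrix.conjTranspose_mul]
    simp only [Matrix.mul_assoc]

theorem inputIsometry_apply {F : Finset W} {inp : ι → W} (h : Function.Injective inp)
    (hF : ∀ i, inp i ∈ F) (x : F → Bool) (b : ι → Bool) :
    inputIsometry F inp x b = if x = (fun w : F => inputConfig inp b w) then 1 else 0 := by
  classical
  refine if_congr ?_ rfl rfl
  rw [← (extendZero_injective F).eq_iff, extendZero_inputConfig hF, eq_inputConfig_iff h]

theorem pairing_inputIsometry [Fintype ι] [DecidableEq ι] {F : Finset W} {inp : ι → W}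
    (h : Function.Injective inp) (hF : ∀ i, inp i ∈ F) (ρ : Op ι) (Q : WireKernel W) :
    pairing F (inputIsometry F inp * ρ * (inputIsometry F inp).conjTranspose) Q =
      ∑ b, ∑ b', ρ b b' * Q (inputConfig inp b) (inputConfig inp b') := by
  simp [pairing_mul_mul_conjTranspose, inputIsometry_apply h hF, extendZero_inputConfig hF,
    apply_ite (starRingEnd ℂ)]

theorem traceOut_apply (F : Finset W) (out : κ → W) (M : Op F) (y y' : κ → Bool) :
    traceOut F out M y y' = pairing F M (selectKernel out y y') := by
  simp only [traceOut, Matrix.of_apply, pairing, selectKernel, mul_ite, mul_one, mul_zero]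

theorem target_mem_circuitWires [Fintype ι] [Fintype κ] {G : List (Gate W)} {g : Gate W}
    (hg : g ∈ G) (inp : ι → W) (out : κ → W) : g.target ∈ circuitWires G inp out := by
  simp only [circuitWires, Finset.mem_union, List.mem_toFinset, List.mem_flatMap]
  exact Or.inl (Or.inl ⟨g, hg, g.target_mem_wires⟩)

theorem inp_mem_circuitWires [Fintype ι] [Fintype κ] (G : List (Gate W)) (inp : ι → W)
    (out : κ → W) (i : ι) : inp i ∈ circuitWires G inp out := by
  simp [circuitWires]

theorem circuitChannel_apply [Fintype ι] [DecidableEq ι] [Fintype κ] (G : List (Gate W))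
    {inp : ι → W} (hinp : Function.Injective inp) (out : κ → W) (ρ : Op ι) (y y' : κ → Bool) :
    circuitChannel G inp out ρ y y' = ∑ b, ∑ b', ρ b b' *
      pull G (selectKernel out y y') (inputConfig inp b) (inputConfig inp b') := by
  rw [circuitChannel, circuitChannelOn, traceOut_apply,
    ← pairing_inputIsometry hinp (inp_mem_circuitWires G inp out),
    ← pairing_circuitUnitary fun g hg => target_mem_circuitWires hg inp out,
    Matrix.conjTranspose_mul]
  simp only [Matrix.mul_assoc]

end CircuitKernel

/-! ### Composition rules for circuits -/

section Composition

variable {W W' W₁ W₂ ι ι' μ κ K : Type}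

theorem sum_sumArrow [Fintype ι] [DecidableEq ι] [Fintype K] [DecidableEq K] {M : Type}
    [AddCommMonoid M] (f : (ι ⊕ K → Bool) → M) :
    ∑ b, f b = ∑ b₁ : ι → Bool, ∑ b₂ : K → Bool, f (Sum.elim b₁ b₂) := by
  rw [← (Equiv.sumArrowEquivProdArrow ι K Bool).symm.sum_comp, Fintype.sum_prod_type]
  rfl

theorem inputConfig_comp {f : W → W'} (hf : Function.Injective f) {inp : ι → W}
    (hinp : Function.Injective inp) (b : ι → Bool) :
    inputConfig (f ∘ inp) b = Function.extend f (inputConfig inp b) fun _ => false := by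
  refine ((eq_inputConfig_iff (hf.comp hinp) b _).2 ⟨fun i => ?_, fun w hw => ?_⟩).symm
  · rw [Function.comp_apply, hf.extend_apply, inputConfig_apply hinp]
  · by_cases h : ∃ v, f v = w
    · obtain ⟨v, rfl⟩ := h
      rw [hf.extend_apply]
      exact inputConfig_of_notMem_range b fun ⟨i, hi⟩ => hw ⟨i, congrArg f hi⟩
    · exact Function.extend_apply' _ _ _ h

theorem inputConfig_comp_comp {f : W → W'} (hf : Function.Injective f) {inp : ι → W}
    (hinp : Function.Injective inp) (b : ι → Bool) :
    inputConfig (f ∘ inp) b ∘ f = inputConfig inp b := by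
  rw [inputConfig_comp hf hinp, Function.extend_comp hf]

open Classical in
theorem selectKernel_comp_extend {f : W → W'} (hf : Function.Injective f) (out : κ → W)
    (y y' : κ → Bool) (R R' : W → Bool) (X X' : W' → Bool) :
    selectKernel (f ∘ out) y y' (Function.extend f R X) (Function.extend f R' X') =
      if ∀ w ∉ Set.range f, X w = X' w then selectKernel out y y' R R' else 0 := by
  have extend_eq_iff :
      (∀ w ∉ Set.range (f ∘ out), Function.extend f R X w = Function.extend f R' X' w) ↔
        (∀ w ∉ Set.range f, X w = X' w) ∧ ∀ w ∉ Set.range out, R w = R' w := by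
    refine ⟨fun h => ⟨fun w hw => ?_, fun w hw => ?_⟩, fun h w hw => ?_⟩
    · simpa only [Function.extend_apply' _ _ _ hw] using
        h w fun hw' => hw (Set.range_comp_subset_range _ _ hw')
    · simpa only [hf.extend_apply] using h (f w) fun ⟨j, hj⟩ => hw ⟨j, hf hj⟩
    · by_cases hwf : w ∈ Set.range f
      · obtain ⟨v, rfl⟩ := hwf
        simpa only [hf.extend_apply] using h.2 v fun ⟨j, hj⟩ => hw ⟨j, congrArg f hj⟩
      · simpa only [Function.extend_apply' _ _ _ hwf] using h.1 w hwf
  unfold selectKernel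
  rw [← ite_and]
  refine if_congr ?_ rfl rfl
  simp only [Function.comp_apply, hf.extend_apply, extend_eq_iff]
  tauto

open Classical in
theorem pull_map_selectKernel [DecidableEq W] [DecidableEq W'] {f : W → W'}
    (hf : Function.Injective f) (G : List (Gate W)) (out : κ → W) (y y' : κ → Bool)
    (X X' : W' → Bool) :
    pull (G.map (Gate.map f)) (selectKernel (f ∘ out) y y') X X' =
      if ∀ w ∉ Set.range f, X w = X' w then
        pull G (selectKernel out y y') (X ∘ f) (X' ∘ f) else 0 := by
  rw [pull_map hf]
  simp only [selectKernel_comp_extend hf]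
  split_ifs
  · rfl
  · exact congrFun₂ (map_zero (pull G)) _ _

open Classical in
theorem sum_mul_selectKernel [Fintype κ] [DecidableEq κ] (out : κ → W)
    (c : (κ → Bool) → (κ → Bool) → ℂ) (R R' : W → Bool) :
    ∑ u, ∑ u', c u u' * selectKernel out u u' R R' =
      if ∀ w ∉ Set.range out, R w = R' w then c (R ∘ out) (R' ∘ out) else 0 := by
  have selectKernel_eq (u u' : κ → Bool) : selectKernel out u u' R R' =
      if u = R ∘ out then if u' = R' ∘ out then
        if ∀ w ∉ Set.range out, R w = R' w then 1 else 0 else 0 else 0 := by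
    unfold selectKernel
    rw [← ite_and, ← ite_and]
    congr 1
    simp only [funext_iff, Function.comp_apply, eq_comm (a := u _), eq_comm (a := u' _),
      and_assoc]
  simp [selectKernel_eq]

theorem extend_inputConfig_comp {f₁ : W₁ → W} {f₂ : W₂ → W} (hf₁ : Function.Injective f₁)
    (hf₂ : Function.Injective f₂) {inp : ι → W₁} (hinp : Function.Injective inp) {out₁ : μ → W₁}
    {inp₂ : μ → W₂} (hmid : f₁ ∘ out₁ = f₂ ∘ inp₂) (hinp₂ : Function.Injective inp₂)
    (hmeet : ∀ w₁ w₂, f₁ w₁ = f₂ w₂ → w₁ ∈ Set.range out₁) (b : ι → Bool) (R : W₁ → Bool) :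
    Function.extend f₁ R (inputConfig (f₁ ∘ inp) b) ∘ f₂ = inputConfig inp₂ (R ∘ out₁) := by
  refine (eq_inputConfig_iff hinp₂ _ _).2 ⟨fun j => ?_, fun w hw => ?_⟩
  · rw [Function.comp_apply, ← Function.comp_apply (f := f₂), ← hmid, Function.comp_apply,
      hf₁.extend_apply, Function.comp_apply]
  · have hw₁ : ¬ ∃ v, f₁ v = f₂ w := by
      rintro ⟨v, hv⟩
      obtain ⟨j, rfl⟩ := hmeet v w hv
      exact hw ⟨j, hf₂ ((congrFun hmid j).symm.trans hv)⟩
    simp only [Function.comp_apply, Function.extend_apply' _ _ _ hw₁, inputConfig_comp hf₁ hinp]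

theorem extend_inputConfig_agree_iff {f₁ : W₁ → W} {f₂ : W₂ → W} (hf₁ : Function.Injective f₁)
    {inp : ι → W₁} (hinp : Function.Injective inp) {out₁ : μ → W₁} {inp₂ : μ → W₂}
    (hmid : f₁ ∘ out₁ = f₂ ∘ inp₂) (hmeet : ∀ w₁ w₂, f₁ w₁ = f₂ w₂ → w₁ ∈ Set.range out₁)
    (b b' : ι → Bool) (R R' : W₁ → Bool) :
    (∀ w ∉ Set.range f₂, Function.extend f₁ R (inputConfig (f₁ ∘ inp) b) w =
      Function.extend f₁ R' (inputConfig (f₁ ∘ inp) b') w) ↔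
        ∀ w ∉ Set.range out₁, R w = R' w := by
  refine ⟨fun h w hw => ?_, fun h w hw => ?_⟩
  · simpa only [hf₁.extend_apply] using h (f₁ w) fun ⟨v, hv⟩ => hw (hmeet w v hv.symm)
  · by_cases hw₁ : ∃ v, f₁ v = w
    · obtain ⟨v, rfl⟩ := hw₁
      simp only [hf₁.extend_apply]
      exact h v fun ⟨j, hj⟩ => hw ⟨inp₂ j, hj ▸ (congrFun hmid j).symm⟩
    · simp only [Function.extend_apply' _ _ _ hw₁, inputConfig_comp hf₁ hinp]

open Classical in
theorem selectKernel_sumMap (out : κ → W) (y y' : κ ⊕ K → Bool) (R R' : W → Bool)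
    (d d' : K → Bool) :
    selectKernel (Sum.map out id) y y' (Sum.elim R d) (Sum.elim R' d') =
      (if d = y ∘ Sum.inr ∧ d' = y' ∘ Sum.inr then 1 else 0) *
        selectKernel out (y ∘ Sum.inl) (y' ∘ Sum.inl) R R' := by
  unfold selectKernel
  rw [ite_zero_mul_ite_zero, one_mul]
  refine if_congr ?_ rfl rfl
  simp only [Sum.forall, Sum.map_inl, Sum.map_inr, Sum.elim_inl, Sum.elim_inr, funext_iff,
    Function.comp_apply, id, Set.mem_range, Sum.exists, reduceCtorEq, Sum.inl.injEq,
    Sum.inr.injEq]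
  simp only [exists_false, or_false, not_exists, ↓existsAndEq, or_true, not_true_eq_false,
    IsEmpty.forall_iff, implies_true, and_true]
  tauto

variable [DecidableEq W] [DecidableEq W'] [DecidableEq W₁] [DecidableEq W₂]
  [Fintype ι] [DecidableEq ι] [Fintype μ] [DecidableEq μ]
  [Fintype κ] [Fintype K] [DecidableEq K]

theorem circuitChannel_map {f : W → W'} (hf : Function.Injective f) (G : List (Gate W))
    {inp : ι → W} (hinp : Function.Injective inp) (out : κ → W) :
    circuitChannel (G.map (Gate.map f)) (f ∘ inp) (f ∘ out) = circuitChannel G inp out := by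
  classical
  funext ρ
  ext y y'
  have agree_off_range (b b' : ι → Bool) :
      ∀ w ∉ Set.range f, inputConfig (f ∘ inp) b w = inputConfig (f ∘ inp) b' w := by
    intro w hw
    simp only [inputConfig_comp hf hinp, Function.extend_apply' _ _ _ hw]
  simp only [circuitChannel_apply _ (hf.comp hinp), circuitChannel_apply _ hinp,
    pull_map_selectKernel hf, if_pos (agree_off_range _ _), inputConfig_comp_comp hf hinp]

theorem circuitChannel_append {f₁ : W₁ → W} {f₂ : W₂ → W} (hf₁ : Function.Injective f₁)
    (hf₂ : Function.Injective f₂) (G₁ : List (Gate W₁)) (G₂ : List (Gate W₂)) {inp : ι → W₁}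
    (hinp : Function.Injective inp) {out₁ : μ → W₁} {inp₂ : μ → W₂}
    (hmid : f₁ ∘ out₁ = f₂ ∘ inp₂) (hinp₂ : Function.Injective inp₂)
    (hmeet : ∀ w₁ w₂, f₁ w₁ = f₂ w₂ → w₁ ∈ Set.range out₁) (out : κ → W₂) :
    circuitChannel (G₁.map (Gate.map f₁) ++ G₂.map (Gate.map f₂)) (f₁ ∘ inp) (f₂ ∘ out) =
      circuitChannel G₂ inp₂ out ∘ circuitChannel G₁ inp out₁ := by
  classical
  have kernel_after_G₁ (b b' : ι → Bool) (y y' : κ → Bool) :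
      (fun R R' => pull (G₂.map (Gate.map f₂)) (selectKernel (f₂ ∘ out) y y')
        (Function.extend f₁ R (inputConfig (f₁ ∘ inp) b))
        (Function.extend f₁ R' (inputConfig (f₁ ∘ inp) b'))) =
      ∑ u, ∑ u', pull G₂ (selectKernel out y y') (inputConfig inp₂ u) (inputConfig inp₂ u') •
        selectKernel out₁ u u' := by
    funext R R'
    simp only [pull_map_selectKernel hf₂, extend_inputConfig_agree_iff hf₁ hinp hmid hmeet,
      extend_inputConfig_comp hf₁ hf₂ hinp hmid hinp₂ hmeet, Finset.sum_apply, Pi.smul_apply,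
      smul_eq_mul]
    exact (sum_mul_selectKernel out₁ (fun u u' => pull G₂ (selectKernel out y y')
      (inputConfig inp₂ u) (inputConfig inp₂ u')) R R').symm
  funext ρ
  ext y y'
  rw [circuitChannel_apply _ (hf₁.comp hinp), Function.comp_apply, circuitChannel_apply _ hinp₂]
  simp only [circuitChannel_apply _ hinp, pull_append, pull_map hf₁, kernel_after_G₁, map_sum,
    map_smul, Finset.sum_apply, Pi.smul_apply, smul_eq_mul, Finset.mul_sum, Finset.sum_mul,
    inputConfig_comp_comp hf₁ hinp]
  simp_rw [Finset.sum_comm (s := (Finset.univ : Finset (ι → Bool)))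
    (t := (Finset.univ : Finset (μ → Bool)))]
  exact Finset.sum_congr rfl fun u _ => Finset.sum_congr rfl fun u' _ =>
    Finset.sum_congr rfl fun b _ => Finset.sum_congr rfl fun b' _ => by ring

theorem circuitChannel_map_inl (G : List (Gate W)) {inp : ι → W} (hinp : Function.Injective inp)
    (out : κ → W) :
    circuitChannel (G.map (Gate.map Sum.inl)) (Sum.map inp id) (Sum.map out (id : K → K)) =
      onFirst K (circuitChannel G inp out) := by
  classical
  have inputConfig_map (b : ι → Bool) (d : K → Bool) :
      inputConfig (Sum.map inp id) (Sum.elim b d) = Sum.elim (inputConfig inp b) d := by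
    refine ((eq_inputConfig_iff (hinp.sumMap Function.injective_id) _ _).2 ⟨?_, ?_⟩).symm
    · rintro (i | k)
      · exact inputConfig_apply hinp b i
      · rfl
    · rintro (w | k) hw
      · exact inputConfig_of_notMem_range b fun ⟨i, hi⟩ => hw ⟨Sum.inl i, congrArg Sum.inl hi⟩
      · exact absurd ⟨Sum.inr k, rfl⟩ hw
  have extend_elim (R R₀ : W → Bool) (d : K → Bool) :
      Function.extend Sum.inl R (Sum.elim R₀ d) = Sum.elim R d := by
    funext w
    rcases w with w | k
    · exact Sum.inl_injective.extend_apply _ _ _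
    · exact Function.extend_apply' _ _ _ (by simp)
  have pull_const_mul (c : ℂ) (Q : WireKernel W) : pull G (fun R R' => c * Q R R') = c • pull G Q :=
    map_smul (pull G) c Q
  funext σ
  ext y y'
  rw [circuitChannel_apply _ (hinp.sumMap Function.injective_id)]
  simp only [sum_sumArrow, inputConfig_map, pull_map Sum.inl_injective, extend_elim,
    selectKernel_sumMap, pull_const_mul, Sum.elim_comp_inl, Pi.smul_apply, smul_eq_mul]
  refine (Finset.sum_congr rfl fun b _ => ?_).trans
    (circuitChannel_apply G hinp out _ (y ∘ Sum.inl) (y' ∘ Sum.inl)).symm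
  rw [Finset.sum_comm]
  refine Finset.sum_congr rfl fun b' _ => ?_
  rw [Finset.sum_eq_single (y ∘ Sum.inr), Finset.sum_eq_single (y' ∘ Sum.inr)]
  · simp
  all_goals simp +contextual

/-- Relabelling the qubits of a register along a bijection. -/
def relabel (e : κ ≃ ι) (ρ : Op ι) : Op κ :=
  Matrix.of fun b b' => ρ (b ∘ e.symm) (b' ∘ e.symm)

theorem circuitChannel_comp_equiv [Fintype ι'] [DecidableEq ι'] (G : List (Gate W)) {inp : ι → W}
    (hinp : Function.Injective inp) (out : κ → W) (e : ι' ≃ ι) (ρ : Op ι') :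
    circuitChannel G (inp ∘ e) out ρ = circuitChannel G inp out (relabel e.symm ρ) := by
  have inputConfig_comp_equiv (b : ι' → Bool) :
      inputConfig (inp ∘ e) b = inputConfig inp (b ∘ e.symm) := by
    refine (eq_inputConfig_iff hinp _ _).2 ⟨fun i => ?_, fun w hw => ?_⟩
    · simpa using inputConfig_apply (hinp.comp e.injective) b (e.symm i)
    · exact inputConfig_of_notMem_range _ ((e.surjective.range_comp inp).symm ▸ hw)
  ext y y'
  rw [circuitChannel_apply _ (hinp.comp e.injective), circuitChannel_apply _ hinp,
    ← (e.arrowCongr (Equiv.refl Bool)).sum_comp]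
  refine Finset.sum_congr rfl fun b _ => ?_
  rw [← (e.arrowCongr (Equiv.refl Bool)).sum_comp]
  refine Finset.sum_congr rfl fun b' _ => ?_
  rw [inputConfig_comp_equiv, inputConfig_comp_equiv]
  simp [relabel, Equiv.arrowCongr, Function.comp_def]

end Composition

/-! ### Moving and copying qubits -/

section MoveCopy

variable {W ι κ : Type}

/-- The classical action of a controlled-NOT gate. -/
def cnotConfig [DecidableEq W] (c t : W) (X : W → Bool) : W → Bool :=
  Function.update X t (xor (X t) (X c))

theorem pull_cnot [DecidableEq W] {c t : W} (h : c ≠ t) (G : List (Gate W)) (Q : WireKernel W)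
    (X X' : W → Bool) :
    pull (.cnot c t :: G) Q X X' = pull G Q (cnotConfig c t X) (cnotConfig c t X') := by
  simp only [pull_cons, Gate.pull, LinearMap.coe_mk, AddHom.coe_mk, Gate.target, Gate.mat,
    cnotConfig]
  cases hx : X c <;> cases hx' : X' c <;> cases ht : X t <;> cases ht' : X' t <;>
    simp_all [notEntry]

theorem cnotConfig_inl_inr [DecidableEq ι] (i : ι) (b d : ι → Bool) :
    cnotConfig (.inl i) (.inr i) (Sum.elim b d) =
      Sum.elim b (Function.update d i (xor (d i) (b i))) :=
  Sum.update_elim_inr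

theorem cnotConfig_inr_inl [DecidableEq ι] (i : ι) (b d : ι → Bool) :
    cnotConfig (.inr i) (.inl i) (Sum.elim b d) =
      Sum.elim (Function.update b i (xor (b i) (d i))) d :=
  Sum.update_elim_inl

/-- The gates that copy the qubits `i ∈ l` from the wires `src i` to the fresh wires `dst i`, in
the computational basis. -/
def copyGates (src dst : ι → W) (l : List ι) : List (Gate W) :=
  l.map fun i => .cnot (src i) (dst i)

/-- The gates that move the qubits `i ∈ l` from the wires `src i` to the fresh wires `dst i`. -/
def moveGates (src dst : ι → W) (l : List ι) : List (Gate W) :=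
  l.flatMap fun i => [.cnot (src i) (dst i), .cnot (dst i) (src i)]

theorem map_moveGates {W' : Type} (f : W → W') (src dst : ι → W) (l : List ι) :
    (moveGates src dst l).map (Gate.map f) = moveGates (f ∘ src) (f ∘ dst) l := by
  simp [moveGates, Gate.map, List.map_flatMap]

theorem pull_copyGates [DecidableEq ι] (Q : WireKernel (ι ⊕ ι)) {l : List ι} (hl : l.Nodup)
    (b b' d d' : ι → Bool) :
    pull (copyGates Sum.inl Sum.inr l) Q (Sum.elim b d) (Sum.elim b' d') =
      Q (Sum.elim b fun i => if i ∈ l then xor (d i) (b i) else d i)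
        (Sum.elim b' fun i => if i ∈ l then xor (d' i) (b' i) else d' i) := by
  induction l generalizing d d' with
  | nil => simp [copyGates, pull_nil]
  | cons i l ih =>
    obtain ⟨hi, hl⟩ := List.nodup_cons.1 hl
    have copy_head (b d : ι → Bool) (j : ι) :
        (if j ∈ l then xor (Function.update d i (xor (d i) (b i)) j) (b j)
          else Function.update d i (xor (d i) (b i)) j) =
          if j ∈ i :: l then xor (d j) (b j) else d j := by
      obtain rfl | hj := eq_or_ne j i <;> simp_all
    rw [copyGates, List.map_cons, pull_cnot Sum.inl_ne_inr, cnotConfig_inl_inr,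
      cnotConfig_inl_inr]
    exact (ih hl _ _).trans (by simp only [copy_head])

theorem pull_moveGates [DecidableEq ι] (Q : WireKernel (ι ⊕ ι)) {l : List ι} (hl : l.Nodup)
    (b b' d d' : ι → Bool) :
    pull (moveGates Sum.inl Sum.inr l) Q (Sum.elim b d) (Sum.elim b' d') =
      Q (Sum.elim (fun i => if i ∈ l then d i else b i)
          fun i => if i ∈ l then xor (d i) (b i) else d i)
        (Sum.elim (fun i => if i ∈ l then d' i else b' i)
          fun i => if i ∈ l then xor (d' i) (b' i) else d' i) := by
  induction l generalizing b b' d d' with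
  | nil => simp [moveGates, pull_nil]
  | cons i l ih =>
    obtain ⟨hi, hl⟩ := List.nodup_cons.1 hl
    have move_head_src (b d : ι → Bool) (j : ι) :
        (if j ∈ l then Function.update d i (xor (d i) (b i)) j
          else Function.update b i (d i) j) = if j ∈ i :: l then d j else b j := by
      obtain rfl | hj := eq_or_ne j i <;> simp_all
    have move_head_dst (b d : ι → Bool) (j : ι) :
        (if j ∈ l then
          xor (Function.update d i (xor (d i) (b i)) j) (Function.update b i (d i) j)
          else Function.update d i (xor (d i) (b i)) j) =
          if j ∈ i :: l then xor (d j) (b j) else d j := by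
      obtain rfl | hj := eq_or_ne j i <;> simp_all
    have swap_value (p q : Bool) : xor p (xor q p) = q := by cases p <;> cases q <;> rfl
    rw [moveGates, List.flatMap_cons, List.cons_append, List.cons_append, List.nil_append,
      pull_cnot Sum.inl_ne_inr, pull_cnot Sum.inr_ne_inl]
    simp only [cnotConfig_inl_inr, cnotConfig_inr_inl, Function.update_self, swap_value]
    exact (ih hl _ _ _ _).trans (by simp only [move_head_src, move_head_dst])

theorem inputConfig_inl (b : ι → Bool) :
    inputConfig (Sum.inl : ι → ι ⊕ κ) b = Sum.elim b fun _ => false :=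
  ((eq_inputConfig_iff Sum.inl_injective b _).2 ⟨fun _ => rfl, by
    rintro (i | k) hw
    · exact absurd ⟨i, rfl⟩ hw
    · rfl⟩).symm

open Classical in
theorem selectKernel_inr (y y' b b' : κ → Bool) (a a' : ι → Bool) :
    selectKernel (Sum.inr : κ → ι ⊕ κ) y y' (Sum.elim a b) (Sum.elim a' b') =
      if b = y ∧ b' = y' ∧ a = a' then 1 else 0 := by
  simp [selectKernel, funext_iff]

/-- Measurement of all qubits in the computational basis. -/
def dephase [DecidableEq ι] [Fintype ι] (ρ : Op ι) : Op ι := Matrix.diagonal fun b => ρ b b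

theorem dephase_eq_sum [DecidableEq ι] [Fintype ι] (ρ : Op ι) :
    dephase ρ = ∑ b, ρ b b • basisState b := by
  ext b b'
  simp [dephase, basisState, Matrix.sum_apply, Matrix.diagonal_apply, ite_and, eq_comm]

variable [DecidableEq W] [Fintype ι] [DecidableEq ι] {l : List ι} {src dst : ι → W}

theorem circuitChannel_copyGates (hl : l.Nodup) (hmem : ∀ i, i ∈ l)
    (hsd : Function.Injective (Sum.elim src dst)) :
    circuitChannel (copyGates src dst l) src dst = dephase := by
  have copyGates_eq : copyGates src dst l =
      (copyGates Sum.inl Sum.inr l).map (Gate.map (Sum.elim src dst)) := by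
    simp [copyGates, Gate.map]
  rw [copyGates_eq]
  refine (circuitChannel_map hsd _ Sum.inl_injective Sum.inr).trans ?_
  funext ρ
  ext y y'
  rw [circuitChannel_apply _ Sum.inl_injective]
  simp only [inputConfig_inl, pull_copyGates _ hl, hmem, if_true, Bool.false_xor,
    selectKernel_inr, dephase, Matrix.diagonal_apply]
  obtain rfl | h := eq_or_ne y y'
  · simp [ite_and]
  · simp [ite_and, h]

theorem circuitChannel_moveGates (hl : l.Nodup) (hmem : ∀ i, i ∈ l)
    (hsd : Function.Injective (Sum.elim src dst)) :
    circuitChannel (moveGates src dst l) src dst = id := by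
  have moveGates_eq : moveGates src dst l =
      (moveGates Sum.inl Sum.inr l).map (Gate.map (Sum.elim src dst)) :=
    (map_moveGates (Sum.elim src dst) Sum.inl Sum.inr l).symm
  rw [moveGates_eq]
  refine (circuitChannel_map hsd _ Sum.inl_injective Sum.inr).trans ?_
  funext ρ
  ext y y'
  rw [circuitChannel_apply _ Sum.inl_injective]
  simp only [inputConfig_inl, pull_moveGates _ hl, hmem, if_true, Bool.false_xor,
    selectKernel_inr, and_true, id]
  simp [ite_and]

end MoveCopy

section CompositionByMoves

variable {W W₁ W₂ ι κ μ : Type} [DecidableEq W] [DecidableEq W₁] [DecidableEq W₂]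
  [Fintype ι] [DecidableEq ι] [Fintype κ] [Fintype μ] {l : List κ}

theorem circuitChannel_append_moveGates [DecidableEq κ] (hl : l.Nodup) (hmem : ∀ i, i ∈ l)
    (G : List (Gate W)) {inp : ι → W} (hinp : Function.Injective inp) {out : κ → W}
    (hout : Function.Injective out) :
    circuitChannel (G.map (Gate.map Sum.inl) ++ moveGates (Sum.inl ∘ out) Sum.inr l)
      (Sum.inl ∘ inp) Sum.inr = circuitChannel G inp out := by
  have key := circuitChannel_append Sum.inl_injective (hout.sumMap Function.injective_id) G
    (moveGates Sum.inl Sum.inr l) hinp (out₁ := out) rfl Sum.inl_injective ?_ Sum.inr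
  · rw [circuitChannel_moveGates hl hmem (by simpa using Function.injective_id),
      map_moveGates] at key
    exact key
  · rintro w (i | i) h
    · exact ⟨i, (Sum.inl_injective h).symm⟩
    · cases h

theorem circuitChannel_moves_onFirst {K : Type} [Fintype K] [DecidableEq K] {l : List (κ ⊕ K)}
    (hl : l.Nodup) (hmem : ∀ i, i ∈ l) {f : W₁ → W} {side : K → W} {dst : κ ⊕ K → W}
    (hf : Function.Injective (Sum.elim (Sum.elim f side) dst)) (G : List (Gate W₁)) {inp : ι → W₁}
    (hinp : Function.Injective inp) {out : κ → W₁} (hout : Function.Injective out) :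
    circuitChannel (G.map (Gate.map f) ++ moveGates (Sum.elim (f ∘ out) side) dst l)
      (Sum.elim (f ∘ inp) side) dst = onFirst K (circuitChannel G inp out) := by
  classical
  have key := circuitChannel_append_moveGates hl hmem (G.map (Gate.map Sum.inl))
    (hinp.sumMap Function.injective_id) (hout.sumMap (Function.injective_id (α := K)))
  rw [circuitChannel_map_inl G hinp, ← circuitChannel_map hf _
    (Sum.inl_injective.comp (hinp.sumMap Function.injective_id))] at key
  simpa only [List.map_append, List.map_map, map_moveGates, Gate.map_map, Function.comp_def,
    Sum.elim_inl, Sum.elim_inr, Sum.elim_map, id] using key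

theorem circuitChannel_comp [DecidableEq κ] (hl : l.Nodup) (hmem : ∀ i, i ∈ l) {f₁ : W₁ → W}
    {f₂ : W₂ → W} (hf : Function.Injective (Sum.elim f₁ f₂)) (G₁ : List (Gate W₁))
    (G₂ : List (Gate W₂)) {inp : ι → W₁} (hinp : Function.Injective inp) {out₁ : κ → W₁}
    (hout₁ : Function.Injective out₁) {inp₂ : κ → W₂} (hinp₂ : Function.Injective inp₂)
    (out : μ → W₂) :
    circuitChannel (G₁.map (Gate.map f₁) ++ moveGates (f₁ ∘ out₁) (f₂ ∘ inp₂) l ++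
      G₂.map (Gate.map f₂)) (f₁ ∘ inp) (f₂ ∘ out) =
        circuitChannel G₂ inp₂ out ∘ circuitChannel G₁ inp out₁ := by
  have hf₁₂ : Function.Injective (Sum.elim f₁ (f₂ ∘ inp₂)) := by
    simpa only [Sum.elim_comp_map, Function.comp_id] using
      hf.comp (Function.injective_id.sumMap hinp₂)
  have key := circuitChannel_append hf₁₂ (hf.comp Sum.inr_injective)
    (G₁.map (Gate.map Sum.inl) ++ moveGates (Sum.inl ∘ out₁) Sum.inr l) G₂
    (Sum.inl_injective.comp hinp) (out₁ := Sum.inr) rfl hinp₂ ?_ out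
  · rw [circuitChannel_append_moveGates hl hmem G₁ hinp hout₁] at key
    simpa [map_moveGates, Gate.map_map, Function.comp_def] using key
  · rintro (w | i) w₂ h
    · cases hf (a₁ := .inl w) (a₂ := .inr w₂) h
    · exact ⟨i, rfl⟩

end CompositionByMoves

/-! ### Channels -/

section TensorOne

variable {ι κ μ : Type} (K : Type)

open scoped Kronecker in
/-- The operator `M ⊗ 1` on a joint register. -/
def tensorOne [DecidableEq K] [Fintype K] (M : Matrix (κ → Bool) (ι → Bool) ℂ) :
    Matrix (κ ⊕ K → Bool) (ι ⊕ K → Bool) ℂ :=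
  (M ⊗ₖ (1 : Op K)).submatrix (Equiv.sumArrowEquivProdArrow κ K Bool)
    (Equiv.sumArrowEquivProdArrow ι K Bool)

variable [Fintype K] [DecidableEq K]

theorem tensorOne_mul [Fintype κ] [DecidableEq κ] (L : Matrix (μ → Bool) (κ → Bool) ℂ)
    (M : Matrix (κ → Bool) (ι → Bool) ℂ) :
    tensorOne K L * tensorOne K M = tensorOne K (L * M) := by
  rw [tensorOne, tensorOne, Matrix.submatrix_mul_equiv, ← Matrix.mul_kronecker_mul, one_mul,
    tensorOne]

theorem tensorOne_conjTranspose (M : Matrix (κ → Bool) (ι → Bool) ℂ) :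
    (tensorOne K M).conjTranspose = tensorOne K M.conjTranspose := by
  rw [tensorOne, Matrix.conjTranspose_submatrix, Matrix.conjTranspose_kronecker,
    Matrix.conjTranspose_one, tensorOne]

theorem tensorOne_one [Fintype ι] : tensorOne K (1 : Op ι) = 1 := by
  rw [tensorOne, Matrix.one_kronecker_one, Matrix.submatrix_one_equiv]

theorem tensorOne_sum {J : Type} [Fintype J] (M : J → Matrix (κ → Bool) (ι → Bool) ℂ) :
    tensorOne K (∑ j, M j) = ∑ j, tensorOne K (M j) := by
  ext x y
  simp [tensorOne, Matrix.sum_apply, Finset.sum_mul]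

theorem onFirst_mul_mul_conjTranspose [Fintype ι] [DecidableEq ι]
    (M : Matrix (κ → Bool) (ι → Bool) ℂ) (σ : Op (ι ⊕ K)) :
    onFirst K (fun ρ => M * ρ * M.conjTranspose) σ =
      tensorOne K M * σ * (tensorOne K M).conjTranspose := by
  ext x y
  have submatrix_apply {α : Type} (M : Matrix (α → Bool) (ι → Bool) ℂ) (x : α ⊕ K → Bool)
      (b : ι → Bool) (k : K → Bool) : tensorOne K M x (Sum.elim b k) =
        if k = x ∘ Sum.inr then M (x ∘ Sum.inl) b else 0 := by
    simp [tensorOne, Matrix.one_apply, Equiv.sumArrowEquivProdArrow, Function.comp_def, eq_comm]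
  simp only [onFirst, Matrix.of_apply, Matrix.mul_apply, sum_sumArrow,
    Matrix.conjTranspose_apply, submatrix_apply]
  simp [apply_ite (starRingEnd ℂ)]

end TensorOne

section Channels

variable {ι κ μ J : Type} [Fintype ι] [DecidableEq ι] [Fintype κ] [DecidableEq κ]
  [Fintype μ] [DecidableEq μ]

theorem isCPTP_of_kraus [Fintype J] (K : J → Matrix (κ → Bool) (ι → Bool) ℂ) {Φ : Op ι → Op κ}
    (hΦ : ∀ ρ, Φ ρ = ∑ j, K j * ρ * (K j).conjTranspose)
    (hK : ∑ j, (K j).conjTranspose * K j = 1) : IsCPTP Φ := by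
  refine ⟨Fintype.card J, fun i => K ((Fintype.equivFin J).symm i), fun ρ => ?_, ?_⟩
  · rw [hΦ, ← (Fintype.equivFin J).symm.sum_comp]
  · rw [← hK, ← (Fintype.equivFin J).symm.sum_comp]

open Classical in
/-- `Φ` is the isometry `|x⟩ ↦ |y⟩|g⟩`, `(y, g) = φ x`, followed by the trace over `g`. -/
theorem isCPTP_of_injective [Finite J] {φ : (ι → Bool) → (κ → Bool) × J}
    (hφ : Function.Injective φ) {Φ : Op ι → Op κ}
    (hΦ : ∀ ρ y y', Φ ρ y y' = ∑ x, ∑ x',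
      if (φ x).1 = y ∧ (φ x').1 = y' ∧ (φ x).2 = (φ x').2 then ρ x x' else 0) : IsCPTP Φ := by
  have := Fintype.ofFinite J
  refine isCPTP_of_kraus (fun g => Matrix.of fun y x => if φ x = (y, g) then 1 else 0)
    (fun ρ => ?_) ?_
  · ext y y'
    simp only [hΦ, Matrix.sum_apply, Matrix.mul_apply, Matrix.conjTranspose_apply,
      Matrix.of_apply, Finset.sum_mul]
    rw [Finset.sum_comm]
    simp_rw [Finset.sum_comm (s := (Finset.univ : Finset J))]
    refine Finset.sum_congr rfl fun x' _ => Finset.sum_congr rfl fun x _ => ?_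
    rw [Finset.sum_eq_single (φ x).2]
    · by_cases h₁ : (φ x).1 = y <;> by_cases h₂ : (φ x').1 = y' <;>
        by_cases h₃ : (φ x').2 = (φ x).2 <;> simp [Prod.ext_iff, h₁, h₂, h₃, eq_comm]
    · intro g _ hg
      simp [Prod.ext_iff, hg.symm]
    · simp
  · ext x x'
    simp only [Matrix.sum_apply, Matrix.mul_apply, Matrix.conjTranspose_apply, Matrix.of_apply]
    rw [Finset.sum_comm, ← Fintype.sum_prod_type', Finset.sum_eq_single (φ x)]
    · simp [Matrix.one_apply, hφ.eq_iff, eq_comm]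
    · intro p _ hp
      simp [hp.symm]
    · simp

theorem IsCPTP.comp {Φ : Op ι → Op κ} {Ψ : Op κ → Op μ} (hΨ : IsCPTP Ψ) (hΦ : IsCPTP Φ) :
    IsCPTP (Ψ ∘ Φ) := by
  obtain ⟨r, K, hK, hK1⟩ := hΦ
  obtain ⟨s, L, hL, hL1⟩ := hΨ
  refine isCPTP_of_kraus (fun p : Fin s × Fin r => L p.1 * K p.2) (fun ρ => ?_) ?_
  · simp only [Function.comp_apply, hL, hK, Fintype.sum_prod_type, Matrix.mul_sum,
      Matrix.sum_mul, Matrix.conjTranspose_mul, Matrix.mul_assoc]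
  · have conjTranspose_mul_self (i : Fin s) (j : Fin r) :
        (L i * K j).conjTranspose * (L i * K j) =
          (K j).conjTranspose * ((L i).conjTranspose * L i) * K j := by
      simp only [Matrix.conjTranspose_mul, Matrix.mul_assoc]
    rw [Fintype.sum_prod_type, Finset.sum_comm]
    simp only [conjTranspose_mul_self, ← Matrix.sum_mul, ← Matrix.mul_sum, hL1, Matrix.mul_one,
      hK1]

theorem IsCPTP.map_sum_smul {J : Type*} {Φ : Op ι → Op κ} (hΦ : IsCPTP Φ) (s : Finset J)
    (k : J → ℂ) (ρ : J → Op ι) : Φ (∑ j ∈ s, k j • ρ j) = ∑ j ∈ s, k j • Φ (ρ j) := by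
  obtain ⟨r, K, hK, -⟩ := hΦ
  simp only [hK, Matrix.mul_sum, Matrix.sum_mul, Matrix.mul_smul, Matrix.smul_mul,
    Finset.smul_sum]
  exact Finset.sum_comm

open scoped ComplexOrder in
theorem IsCPTP.isDensity {Φ : Op ι → Op κ} (hΦ : IsCPTP Φ) {ρ : Op ι} (hρ : IsDensity ρ) :
    IsDensity (Φ ρ) := by
  obtain ⟨r, K, hK, hK1⟩ := hΦ
  rw [hK]
  refine ⟨Matrix.posSemidef_sum _ fun j _ => hρ.1.mul_mul_conjTranspose_same (K j), ?_⟩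
  have trace_conj (j : Fin r) : (K j * ρ * (K j).conjTranspose).trace =
      ((K j).conjTranspose * K j * ρ).trace := by
    rw [Matrix.trace_mul_comm, Matrix.mul_assoc]
  rw [Matrix.trace_sum]
  simp only [trace_conj]
  rw [← Matrix.trace_sum, ← Matrix.sum_mul, hK1, one_mul, hρ.2]

variable (K : Type) [Fintype K] [DecidableEq K]

theorem IsCPTP.onFirst {Φ : Op ι → Op κ} (hΦ : IsCPTP Φ) : IsCPTP (onFirst K Φ) := by
  obtain ⟨r, M, hM, hM1⟩ := hΦ
  refine ⟨r, fun j => tensorOne K (M j), fun σ => ?_, ?_⟩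
  · simp only [← onFirst_mul_mul_conjTranspose]
    ext x y
    simp only [_root_.onFirst, Matrix.of_apply, hM, Matrix.sum_apply]
  · simp only [tensorOne_conjTranspose, tensorOne_mul, ← tensorOne_sum, hM1, tensorOne_one]

theorem isCPTP_relabel (e : κ ≃ ι) : IsCPTP (relabel e) := by
  refine isCPTP_of_injective (φ := fun x => (x ∘ e, ()))
    (fun x x' h => e.surjective.injective_comp_right (congrArg Prod.fst h)) fun ρ y y' => ?_
  have comp_eq_iff (x : ι → Bool) (y : κ → Bool) : x ∘ e = y ↔ x = y ∘ e.symm := by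
    rw [Equiv.eq_comp_symm]
  simp [comp_eq_iff, relabel, ite_and]

end Channels

/-! ### Circuits compute channels -/

section CircuitCPTP

variable {W ι κ : Type}

theorem sum_star_hadEntry_mul (s s' : Bool) :
    ∑ t, star (hadEntry t s) * hadEntry t s' = if s = s' then 1 else 0 := by
  have inv_sqrt_two_mul_self :
      ((Real.sqrt 2 : ℝ) : ℂ)⁻¹ * ((Real.sqrt 2 : ℝ) : ℂ)⁻¹ = 1 / 2 := by
    rw [← mul_inv, ← Complex.ofReal_mul, Real.mul_self_sqrt (by norm_num)]
    norm_num
  cases s <;> cases s' <;> (simp [hadEntry, inv_sqrt_two_mul_self]; try norm_num)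

theorem sum_star_teeEntry_mul (s s' : Bool) :
    ∑ t, star (teeEntry t s) * teeEntry t s' = if s = s' then 1 else 0 := by
  have exp_unit : star (Complex.exp (Complex.I * (Real.pi / 4 : ℝ))) *
      Complex.exp (Complex.I * (Real.pi / 4 : ℝ)) = 1 := by
    rw [Complex.star_def, ← Complex.exp_conj, ← Complex.exp_add, map_mul, Complex.conj_I,
      Complex.conj_ofReal, neg_mul, neg_add_cancel, Complex.exp_zero]
  cases s <;> cases s' <;> (simp [teeEntry]; try simpa using exp_unit)

theorem sum_star_notEntry_mul (s s' : Bool) :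
    ∑ t, star (notEntry t s) * notEntry t s' = if s = s' then 1 else 0 := by
  cases s <;> cases s' <;> simp [notEntry]

theorem Gate.sum_star_mat_mul_mat (g : Gate W) (y : W → Bool) (s s' : Bool) :
    ∑ t, star (g.mat y t s) * g.mat y t s' = if s = s' then 1 else 0 := by
  have sum_star_one_mul : ∑ t : Bool, star (if t = s then 1 else 0 : ℂ) *
      (if t = s' then 1 else 0) = if s = s' then 1 else 0 := by
    cases s <;> cases s' <;> simp
  rcases g with _ | _ | ⟨c, t⟩ | ⟨c, t⟩
  · exact sum_star_hadEntry_mul s s'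
  · exact sum_star_teeEntry_mul s s'
  · simp only [Gate.mat]
    by_cases h : c ≠ t ∧ y c = true
    · simpa only [if_pos h] using sum_star_notEntry_mul s s'
    · simpa only [if_neg h] using sum_star_one_mul
  · simp only [Gate.mat]
    by_cases h : c ≠ t ∧ y c = true
    · simpa only [if_pos h] using sum_star_hadEntry_mul s s'
    · simpa only [if_neg h] using sum_star_one_mul

variable [DecidableEq W]

theorem gateMatrix_conjTranspose_mul_self {F : Finset W} (g : Gate W) (ht : g.target ∈ F) :
    (gateMatrix F g).conjTranspose * gateMatrix F g = 1 := by
  classical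
  ext x y
  simp only [Matrix.mul_apply, Matrix.conjTranspose_apply, mul_comm (star _)]
  rw [sum_gateMatrix_mul g ht]
  simp only [gateMatrix, Matrix.of_apply, Gate.entry_eq, extendZero_update, Function.update_self]
  have agree_iff (s : Bool) : (∀ v, v ≠ g.target →
      Function.update (extendZero F y) g.target s v = extendZero F x v) ↔
        ∃ r, y = Function.update x ⟨g.target, ht⟩ r := by
    refine ⟨fun h => ⟨y ⟨g.target, ht⟩, extendZero_injective F ?_⟩, ?_⟩
    · funext v
      rw [extendZero_update]
      obtain rfl | hv := eq_or_ne v g.target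
      · rw [Function.update_self, extendZero_coe y ⟨g.target, ht⟩]
      · rw [Function.update_of_ne hv, ← h v hv, Function.update_of_ne hv]
    · rintro ⟨r, rfl⟩ v hv
      rw [Function.update_of_ne hv, extendZero_update, Function.update_of_ne hv]
  simp only [agree_iff]
  split_ifs with h
  · obtain ⟨r, rfl⟩ := h
    simp only [extendZero_update, Gate.mat_update, Function.update_self,
      mul_comm (Gate.mat _ _ _ r)]
    rw [Gate.sum_star_mat_mul_mat, Matrix.one_apply]
    refine if_congr ?_ rfl rfl
    rw [extendZero_coe x ⟨g.target, ht⟩, eq_comm (a := x), Function.update_eq_self_iff, eq_comm]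
  · have hxy : x ≠ y := fun hxy => h ⟨x ⟨g.target, ht⟩, by rw [hxy, Function.update_eq_self]⟩
    simp [hxy]

theorem circuitUnitary_conjTranspose_mul_self {F : Finset W} {G : List (Gate W)}
    (hG : ∀ g ∈ G, g.target ∈ F) : (circuitUnitary F G).conjTranspose * circuitUnitary F G = 1 := by
  induction G with
  | nil => simp [circuitUnitary]
  | cons g G ih =>
    rw [circuitUnitary_cons, Matrix.conjTranspose_mul, Matrix.mul_assoc,
      ← Matrix.mul_assoc (circuitUnitary F G).conjTranspose, ih fun g hg => hG g (by simp [hg]),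
      one_mul, gateMatrix_conjTranspose_mul_self g (hG g (by simp))]

theorem isCPTP_traceOut [Fintype κ] [DecidableEq κ] (F : Finset W) (out : κ → W) :
    IsCPTP (traceOut F out) := by
  classical
  have split_injective : Function.Injective fun x : F → Bool =>
      (extendZero F x ∘ out, fun w : {w : F // w.1 ∉ Set.range out} => x w.1) := by
    intro x x' h
    obtain ⟨h_out, h_rest⟩ := Prod.mk.inj h
    funext w
    by_cases hw : w.1 ∈ Set.range out
    · obtain ⟨j, hj⟩ := hw
      simpa only [Function.comp_apply, hj, extendZero_coe] using congrFun h_out j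
    · exact congrFun h_rest ⟨w, hw⟩
  have agree_iff (x x' : F → Bool) :
      (∀ w, w ∉ Set.range out → extendZero F x w = extendZero F x' w) ↔
        (fun w : {w : F // w.1 ∉ Set.range out} => x w.1) = fun w => x' w.1 := by
    refine ⟨fun h => funext fun w => ?_, fun h w hw => ?_⟩
    · simpa only [extendZero_coe] using h w.1 w.2
    · by_cases hF : w ∈ F
      · simpa only [extendZero_coe _ ⟨w, hF⟩] using congrFun h ⟨⟨w, hF⟩, hw⟩
      · simp [extendZero, hF]
  refine isCPTP_of_injective split_injective fun ρ y y' => ?_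
  simp only [traceOut, Matrix.of_apply, agree_iff, funext_iff (g := y), funext_iff (g := y'),
    Function.comp_apply]

variable [Fintype ι]

theorem inputIsometry_conjTranspose_mul_self {F : Finset W} {inp : ι → W}
    (hinp : Function.Injective inp) (hF : ∀ i, inp i ∈ F) :
    (inputIsometry F inp).conjTranspose * inputIsometry F inp = 1 := by
  have inputConfig_injective (b b' : ι → Bool) :
      (fun w : F => inputConfig inp b w) = (fun w : F => inputConfig inp b' w) ↔ b = b' := by
    refine ⟨fun h => funext fun i => ?_, fun h => h ▸ rfl⟩
    simpa only [inputConfig_apply hinp] using congrFun h ⟨inp i, hF i⟩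
  ext b b'
  simp [Matrix.mul_apply, inputIsometry_apply hinp hF, Matrix.one_apply, inputConfig_injective,
    apply_ite (starRingEnd ℂ), eq_comm]

theorem isCPTP_circuitChannel [DecidableEq ι] [Fintype κ] [DecidableEq κ] (G : List (Gate W))
    {inp : ι → W} (hinp : Function.Injective inp) (out : κ → W) :
    IsCPTP (circuitChannel G inp out) := by
  let F := circuitWires G inp out
  have isometry : (circuitUnitary F G * inputIsometry F inp).conjTranspose *
      (circuitUnitary F G * inputIsometry F inp) = 1 := by
    rw [Matrix.conjTranspose_mul, Matrix.mul_assoc,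
      ← Matrix.mul_assoc (circuitUnitary F G).conjTranspose,
      circuitUnitary_conjTranspose_mul_self fun g hg => target_mem_circuitWires hg inp out,
      Matrix.one_mul, inputIsometry_conjTranspose_mul_self hinp (inp_mem_circuitWires G inp out)]
  exact (isCPTP_traceOut F out).comp (isCPTP_of_kraus
    (fun _ : Unit => circuitUnitary F G * inputIsometry F inp)
    (Φ := fun ρ => circuitUnitary F G * inputIsometry F inp * ρ *
      (circuitUnitary F G * inputIsometry F inp).conjTranspose)
    (fun _ => by rw [Finset.univ_unique, Finset.sum_singleton])
    (by rw [Finset.univ_unique, Finset.sum_singleton, isometry]))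

end CircuitCPTP

/-! ### Programs -/

section Programs

theorem Exec.congr {p : Prog} {s s' s'' : ℕ → List Bool} {G G' : List (Gate Wire)} {t t' : ℕ}
    (h : Exec p s s' G t) (hs : s' = s'') (hG : G = G') (ht : t = t') : Exec p s s'' G' t' :=
  hs ▸ hG ▸ ht ▸ h

theorem Exec.gates_length_le {p : Prog} {s s' : ℕ → List Bool} {G : List (Gate Wire)} {t : ℕ}
    (h : Exec p s s' G t) : G.length ≤ t := by
  induction h with
  | seq _ _ ih₁ ih₂ => rw [List.length_append]; omega
  | whileStep _ _ _ ih₁ ih₂ => rw [List.length_append]; omega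
  | ifTrue _ _ ih => omega
  | ifFalse _ _ ih => omega
  | _ => simp

theorem Exec.height_le {p : Prog} {s s' : ℕ → List Bool} {G : List (Gate Wire)} {t : ℕ}
    (h : Exec p s s' G t) (v : ℕ) : (s' v).length ≤ (s v).length + t := by
  induction h with
  | push b u s => obtain rfl | hv := eq_or_ne v u <;> simp [*]
  | pop u s =>
    obtain rfl | hv := eq_or_ne v u
    · rw [Function.update_self, List.length_tail]; omega
    · simp [hv]
  | seq _ _ ih₁ ih₂ => omega
  | whileStep _ _ _ ih₁ ih₂ => omega
  | ifTrue _ _ ih => omega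
  | ifFalse _ _ ih => omega
  | _ => simp

theorem PolyTimeLength.polyBounded {f : ℕ → ℕ} (h : PolyTimeLength f) : PolyBounded f := by
  obtain ⟨p, b, h⟩ := h
  refine ⟨b, fun n => ?_⟩
  obtain ⟨s, G, t, run, time_le, height⟩ := h (List.replicate n true)
  rw [List.length_replicate] at time_le height
  simpa [height, initMem] using (run.height_le 1).trans (Nat.add_le_add_left time_le _)

/-- The program that emits nothing and otherwise does the same. -/
def Prog.mute : Prog → Prog
  | .emit _ => .skip
  | .seq p q => .seq p.mute q.mute
  | .ifTop v p q => .ifTop v p.mute q.mute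
  | .whileNonempty v p => .whileNonempty v p.mute
  | p => p

theorem Exec.mute {p : Prog} {s s' : ℕ → List Bool} {G : List (Gate Wire)} {t : ℕ}
    (h : Exec p s s' G t) : Exec p.mute s s' [] t := by
  induction h with
  | skip s => exact .skip s
  | push b v s => exact .push b v s
  | pop v s => exact .pop v s
  | emit _ s => exact .skip s
  | seq _ _ ih₁ ih₂ => exact .seq ih₁ ih₂
  | ifTrue h _ ih => exact .ifTrue h ih
  | ifFalse h _ ih => exact .ifFalse h ih
  | whileStop h => exact .whileStop h
  | whileStep h _ _ ih₁ ih₂ => exact .whileStep h ih₁ ih₂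

/-- Renaming the register names of wires. -/
def renameWire (f : List ℕ → List ℕ) (w : Wire) : Wire := (f w.1, w.2)

/-- Renaming the stacks of a program by `r` and the register names of the wires that it emits
by `f`. -/
def Prog.relocate (r : ℕ → ℕ) (f : List ℕ → List ℕ) : Prog → Prog
  | .skip => .skip
  | .push b v => .push b (r v)
  | .pop v => .pop (r v)
  | .emit g => .emit (g.map fun a => (f a.1, a.2.map r))
  | .seq p q => .seq (p.relocate r f) (q.relocate r f)
  | .ifTop v p q => .ifTop (r v) (p.relocate r f) (q.relocate r f)
  | .whileNonempty v p => .whileNonempty (r v) (p.relocate r f)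

theorem extend_update_left {α β γ : Type*} [DecidableEq α] [DecidableEq β] {r : α → β}
    (hr : Function.Injective r) (s : α → γ) (S : β → γ) (v : α) (a : γ) :
    Function.extend r (Function.update s v a) S =
      Function.update (Function.extend r s S) (r v) a := by
  funext w
  by_cases hw : ∃ u, r u = w
  · obtain ⟨u, rfl⟩ := hw
    obtain rfl | hu := eq_or_ne u v
    · rw [hr.extend_apply, Function.update_self, Function.update_self]
    · rw [hr.extend_apply, Function.update_of_ne hu, Function.update_of_ne (hr.ne hu),
        hr.extend_apply]
  · rw [Function.extend_apply' _ _ _ hw, Function.update_of_ne (fun h => hw ⟨v, h.symm⟩),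
      Function.extend_apply' _ _ _ hw]

theorem Exec.relocate {r : ℕ → ℕ} (hr : Function.Injective r) (f : List ℕ → List ℕ)
    (S : ℕ → List Bool) {p : Prog} {s s' : ℕ → List Bool} {G : List (Gate Wire)} {t : ℕ}
    (h : Exec p s s' G t) :
    Exec (p.relocate r f) (Function.extend r s S) (Function.extend r s' S)
      (G.map (Gate.map (renameWire f))) t := by
  have top (s : ℕ → List Bool) (v : ℕ) : Function.extend r s S (r v) = s v :=
    hr.extend_apply s S v
  induction h with
  | skip s => exact .skip _
  | push b v s =>
    rw [extend_update_left hr, ← top s v]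
    exact .push b (r v) _
  | pop v s =>
    rw [extend_update_left hr, ← top s v]
    exact .pop (r v) _
  | emit g s =>
    refine (Exec.emit (g.map fun a => (f a.1, a.2.map r)) _).congr rfl ?_ rfl
    simp [Gate.map_map, Function.comp_def, renameWire, resolve, top]
  | seq _ _ ih₁ ih₂ => rw [List.map_append]; exact .seq ih₁ ih₂
  | ifTrue h _ ih => exact .ifTrue (by rwa [top]) ih
  | ifFalse h _ ih => exact .ifFalse (by rwa [top]) ih
  | whileStop h => exact .whileStop (by rwa [top])
  | whileStep h _ _ ih₁ ih₂ => rw [List.map_append]; exact .whileStep (by rwa [top]) ih₁ ih₂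

/-- Push the bit `b` onto each of the stacks in `l`. -/
def Prog.pushAll (b : Bool) : List ℕ → Prog
  | [] => .skip
  | v :: l => .seq (.push b v) (.pushAll b l)

theorem exec_pushAll (b : Bool) {l : List ℕ} (hl : l.Nodup) (s : ℕ → List Bool) :
    Exec (.pushAll b l) s (fun v => if v ∈ l then b :: s v else s v) [] (l.length + 1) := by
  induction l generalizing s with
  | nil => exact (Exec.skip s).congr (by simp) rfl rfl
  | cons u l ih =>
    obtain ⟨hu, hl⟩ := List.nodup_cons.mp hl
    refine ((Exec.push b u s).seq (ih hl _)).congr ?_ rfl (by simp; omega)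
    funext v
    obtain rfl | hv := eq_or_ne v u <;> simp [*]

/-- Empty stack `a` onto each of the stacks in `l`, which reverses its contents. -/
def Prog.pour (a : ℕ) (l : List ℕ) : Prog :=
  .whileNonempty a (.seq (.ifTop a (.pushAll true l) (.pushAll false l)) (.pop a))

theorem exec_pour {a : ℕ} {l : List ℕ} (hl : l.Nodup) (ha : a ∉ l) (x : List Bool)
    {s : ℕ → List Bool} (hs : s a = x) :
    Exec (.pour a l) s
      (fun v => if v = a then [] else if v ∈ l then x.reverse ++ s v else s v) []
      ((l.length + 4) * x.length + 1) := by
  induction x generalizing s with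
  | nil =>
    refine (Exec.whileStop hs).congr (funext fun v => ?_) rfl (by simp)
    obtain rfl | hv := eq_or_ne v a <;> simp [*]
  | cons b x ih =>
    have branch : Exec (.ifTop a (.pushAll true l) (.pushAll false l)) s
        (fun v => if v ∈ l then b :: s v else s v) [] (l.length + 1 + 1) := by
      cases b
      · exact .ifFalse (by simp [hs]) (exec_pushAll false hl s)
      · exact .ifTrue (by simp [hs]) (exec_pushAll true hl s)
    refine (Exec.whileStep (by simp [hs]) (branch.seq (.pop a _))
      (ih (by simp [ha, hs]))).congr (funext fun v => ?_) rfl ?_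
    · obtain rfl | hv := eq_or_ne v a
      · simp
      · by_cases hvl : v ∈ l <;> simp [hv, hvl]
    · simp only [List.length_cons]; ring

/-- The memory that holds `s₁` on the even and `s₂` on the odd stacks. -/
def interleave (s₁ s₂ : ℕ → List Bool) (v : ℕ) : List Bool :=
  if v % 2 = 0 then s₁ (v / 2) else s₂ (v / 2)

theorem interleave_even (s₁ s₂ : ℕ → List Bool) (v : ℕ) : interleave s₁ s₂ (2 * v) = s₁ v := by
  simp [interleave]

theorem interleave_odd (s₁ s₂ : ℕ → List Bool) (v : ℕ) :
    interleave s₁ s₂ (2 * v + 1) = s₂ v := by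
  have half : (2 * v + 1) / 2 = v := by omega
  simp [interleave, Nat.add_mod, half]

theorem extend_even_interleave (s s₁ s₂ : ℕ → List Bool) :
    Function.extend (fun v => 2 * v) s (interleave s₁ s₂) = interleave s s₂ := by
  have inj : Function.Injective fun v : ℕ => 2 * v := fun u v h => by simpa using h
  funext v
  obtain ⟨u, rfl | rfl⟩ := Nat.even_or_odd' v
  · rw [interleave_even, inj.extend_apply]
  · rw [Function.extend_apply' _ _ _ (by rintro ⟨w, hw⟩; omega), interleave_odd,
      interleave_odd]

theorem extend_odd_interleave (s s₁ s₂ : ℕ → List Bool) :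
    Function.extend (fun v => 2 * v + 1) s (interleave s₁ s₂) = interleave s₁ s := by
  have inj : Function.Injective fun v : ℕ => 2 * v + 1 := fun u v h => by simpa using h
  funext v
  obtain ⟨u, rfl | rfl⟩ := Nat.even_or_odd' v
  · rw [Function.extend_apply' _ _ _ (by rintro ⟨w, hw⟩; omega), interleave_even,
      interleave_even]
  · rw [interleave_odd, inj.extend_apply]

/-- Running two programs one after the other, on separate memories and the same input. -/
def Prog.both (p q : Prog) : Prog :=
  .seq (.seq (.pour 0 [2]) (.pour 2 [0, 1]))
    (.seq (p.relocate (fun v => 2 * v) id) (q.relocate (fun v => 2 * v + 1) id))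

theorem Exec.both {p q : Prog} {x : List Bool} {s₁ s₂ : ℕ → List Bool} {G₁ G₂ : List (Gate Wire)}
    {t₁ t₂ : ℕ} (h₁ : Exec p (initMem x) s₁ G₁ t₁) (h₂ : Exec q (initMem x) s₂ G₂ t₂) :
    Exec (p.both q) (initMem x) (interleave s₁ s₂) (G₁ ++ G₂)
      (11 * x.length + 2 + t₁ + t₂) := by
  have copy_input : Exec (.seq (.pour 0 [2]) (.pour 2 [0, 1])) (initMem x)
      (interleave (initMem x) (initMem x)) [] (11 * x.length + 2) := by
    refine ((exec_pour (by simp) (by simp) x rfl).seq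
      (exec_pour (by simp) (by simp) x.reverse (by simp [initMem]))).congr (funext fun v => ?_)
      rfl (by simp; ring)
    obtain _ | _ | _ | v := v
    all_goals simp [interleave, initMem]
  have run₁ := h₁.relocate (r := fun v => 2 * v) (fun u v h => by simpa using h) id
    (interleave (initMem x) (initMem x))
  have run₂ := h₂.relocate (r := fun v => 2 * v + 1) (fun u v h => by simpa using h) id
    (interleave s₁ (initMem x))
  rw [extend_even_interleave, extend_even_interleave] at run₁
  rw [extend_odd_interleave, extend_odd_interleave] at run₂
  have map_id (G : List (Gate Wire)) : G.map (Gate.map (renameWire id)) = G :=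
    (List.map_congr_left fun g _ => by cases g <;> rfl).trans G.map_id
  rw [map_id] at run₁ run₂
  exact (copy_input.seq (run₁.seq run₂)).congr rfl rfl (by ring)

end Programs

/-! ### Loops -/

section Loops

/-- From any memory with stack heights `h`, the program `p` halts within `T` steps with stack
heights `h'`, having written the circuit `G`. -/
def HeightExec (p : Prog) (h h' : ℕ → ℕ) (G : List (Gate Wire)) (T : ℕ) : Prop :=
  ∀ s : ℕ → List Bool, (∀ v, (s v).length = h v) →
    ∃ s' t, (∀ v, (s' v).length = h' v) ∧ t ≤ T ∧ Exec p s s' G t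

theorem HeightExec.mono {p : Prog} {h h' : ℕ → ℕ} {G : List (Gate Wire)} {T T' : ℕ}
    (e : HeightExec p h h' G T) (hT : T ≤ T') : HeightExec p h h' G T' := fun s hs =>
  let ⟨s', t, hs', ht, run⟩ := e s hs
  ⟨s', t, hs', ht.trans hT, run⟩

theorem HeightExec.seq {p q : Prog} {h h' h'' : ℕ → ℕ} {G G' : List (Gate Wire)} {T T' : ℕ}
    (e : HeightExec p h h' G T) (e' : HeightExec q h' h'' G' T') :
    HeightExec (.seq p q) h h'' (G ++ G') (T + T') := fun s hs =>
  let ⟨s', _, hs', ht, run⟩ := e s hs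
  let ⟨s'', _, hs'', ht', run'⟩ := e' s' hs'
  ⟨s'', _, hs'', Nat.add_le_add ht ht', run.seq run'⟩

theorem heightExec_push (b : Bool) (v : ℕ) (h : ℕ → ℕ) :
    HeightExec (.push b v) h (Function.update h v (h v + 1)) [] 1 := by
  refine fun s hs => ⟨_, 1, fun w => ?_, le_rfl, .push b v s⟩
  obtain rfl | hw := eq_or_ne w v <;> simp [*]

theorem heightExec_pop (v : ℕ) (h : ℕ → ℕ) :
    HeightExec (.pop v) h (Function.update h v (h v - 1)) [] 1 := by
  refine fun s hs => ⟨_, 1, fun w => ?_, le_rfl, .pop v s⟩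
  obtain rfl | hw := eq_or_ne w v <;> simp [*]

/-- Executing `p` once for each height of the counter `c`, from its initial height minus one down
to `0`. -/
def Prog.loop (c : ℕ) (p : Prog) : Prog := .whileNonempty c (.seq (.pop c) p)

theorem heightExec_loop {p : Prog} {c : ℕ} (H : ℕ → ℕ → ℕ) (hH : ∀ i, H i c = i)
    (G : ℕ → List (Gate Wire)) {T : ℕ} (n : ℕ)
    (hp : ∀ i < n, HeightExec p (Function.update (H (i + 1)) c i) (H i) (G i) T) :
    HeightExec (.loop c p) (H n) (H 0) ((List.range n).reverse.flatMap G) (n * (T + 2) + 1) := by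
  induction n with
  | zero =>
    refine fun s hs => ⟨s, 1, hs, by omega, .whileStop ?_⟩
    simpa [hH] using hs c
  | succ n ih =>
    intro s hs
    have pop_counter := heightExec_pop c (H (n + 1))
    rw [hH, Nat.add_sub_cancel] at pop_counter
    obtain ⟨s', t', hs', ht', run'⟩ := (pop_counter.seq (hp n (by omega))) s hs
    obtain ⟨s'', t'', hs'', ht'', run''⟩ := ih (fun i hi => hp i (by omega)) s' hs'
    refine ⟨s'', t' + t'' + 1, hs'', by rw [Nat.add_mul]; omega, ?_⟩
    rw [List.range_succ, List.reverse_append]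
    refine .whileStep (fun empty => ?_) run' run''
    simpa [hH, empty] using hs c

/-- Executing `p` once for each height of the counter `a`, from its initial height minus one down
to `0`, with the help of a stack `c` from which the counter is restored at the end. -/
def Prog.forLoop (a c : ℕ) (p : Prog) : Prog :=
  .seq (.loop a (.seq (.push true c) p)) (.loop c (.push true a))

theorem heightExec_forLoop {p : Prog} {a c n : ℕ} (hac : a ≠ c) {h : ℕ → ℕ} (ha : h a = n)
    (hc : h c = 0) (G : ℕ → List (Gate Wire)) {T : ℕ}
    (hp : ∀ i < n, HeightExec p (Function.update (Function.update h a i) c (n - i))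
      (Function.update (Function.update h a i) c (n - i)) (G i) T) :
    HeightExec (.forLoop a c p) h h ((List.range n).reverse.flatMap G) (n * (T + 6) + 2) := by
  let H (i : ℕ) := Function.update (Function.update h a i) c (n - i)
  have start : H n = h := by
    simp [H, ← ha, ← hc]
  have count : HeightExec (.loop a (.seq (.push true c) p)) (H n) (H 0)
      ((List.range n).reverse.flatMap G) (n * (1 + T + 2) + 1) := by
    refine heightExec_loop H (fun i => by simp [H, hac]) G n fun i hi => ?_
    have push_spare : Function.update (Function.update (H (i + 1)) a i) c
        (Function.update (H (i + 1)) a i c + 1) = H i := by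
      funext v
      obtain rfl | hvc := eq_or_ne v c
      · simp [H, hac.symm]; omega
      · obtain rfl | hva := eq_or_ne v a <;> simp [H, *]
    exact ((push_spare ▸ heightExec_push true c _).seq (hp i hi))
  have restore : HeightExec (.loop c (.push true a)) (H 0) (H n)
      [] (n * (1 + 2) + 1) := by
    have no_gates : (List.range n).reverse.flatMap (fun _ => ([] : List (Gate Wire))) = [] := by
      simp
    let R (i : ℕ) := Function.update (Function.update h c i) a (n - i)
    have reindex {i : ℕ} (hi : i ≤ n) : R i = H (n - i) := by
      simp only [R, H, Nat.sub_sub_self hi]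
      exact Function.update_comm hac.symm _ _ _
    have step (i : ℕ) (hi : i < n) :
        HeightExec (.push true a) (Function.update (R (i + 1)) c i) (R i) [] 1 := by
      convert heightExec_push true a (Function.update (R (i + 1)) c i) using 1
      funext v
      obtain rfl | hva := eq_or_ne v a
      · simp [R, hac]; omega
      · obtain rfl | hvc := eq_or_ne v c
        · simp [R, hva]
        · simp only [R, Function.update_of_ne hva, Function.update_of_ne hvc]
    simpa only [no_gates, reindex le_rfl, reindex n.zero_le, Nat.sub_self, Nat.sub_zero] using
      heightExec_loop R (fun i => by simp [R, hac.symm]) (fun _ => []) n step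
  have both := count.seq restore
  rw [start, List.append_nil] at both
  exact both.mono (by ring_nf; omega)

/-- Write the gates in `l` one after the other. -/
def Prog.emitAll : List (Gate (List ℕ × List ℕ)) → Prog
  | [] => .skip
  | g :: l => .seq (.emit g) (.emitAll l)

theorem heightExec_emitAll (l : List (Gate (List ℕ × List ℕ))) (h : ℕ → ℕ) :
    HeightExec (.emitAll l) h h (l.map (Gate.map fun a => (a.1, a.2.map h))) (l.length + 1) := by
  intro s hs
  refine ⟨s, l.length + 1, hs, le_rfl, ?_⟩
  have resolve_eq : resolve s = fun a => (a.1, a.2.map h) := by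
    funext a
    simp [resolve, hs]
  rw [← resolve_eq]
  induction l with
  | nil => exact .skip s
  | cons g l ih => exact ((Exec.emit g s).seq ih).congr rfl rfl (by simp; ring)

end Loops

/-! ### Circuits written in polynomial time -/

section PolyCircuits

/-- Families of circuits that a classical program, run on `x`, writes out in `poly(|x|)` steps. -/
def PolyCircuit (G : List Bool → List (Gate Wire)) : Prop :=
  ∃ (p : Prog) (b : Polynomial ℕ), ∀ x : List Bool, ∃ s t,
    Exec p (initMem x) s (G x) t ∧ t ≤ b.eval x.length

theorem polyTime_iff {A B : Register}
    {Φ : ∀ x : List Bool, Op (A.Idx x.length) → Op (B.Idx x.length)} :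
    PolyTime A B Φ ↔ ∃ G, PolyCircuit G ∧ ∀ x, Φ x =
      circuitChannel (G x) (fun i => tagWire 0 (A.label x.length i))
        (fun j => tagWire 1 (B.label x.length j)) := by
  refine ⟨fun ⟨p, b, h⟩ => ?_, fun ⟨G, ⟨p, b, h⟩, hΦ⟩ => ⟨p, b, fun x => ?_⟩⟩
  · choose s G t run time_le computes using h
    exact ⟨G, ⟨p, b, fun x => ⟨s x, t x, run x, time_le x⟩⟩, computes⟩
  · obtain ⟨s, t, run, time_le⟩ := h x
    exact ⟨s, G x, t, run, time_le, hΦ x⟩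

theorem PolyCircuit.length_le {G : List Bool → List (Gate Wire)} (h : PolyCircuit G) :
    ∃ b : Polynomial ℕ, ∀ x, (G x).length ≤ b.eval x.length := by
  obtain ⟨p, b, h⟩ := h
  refine ⟨b, fun x => ?_⟩
  obtain ⟨s, t, run, time_le⟩ := h x
  exact run.gates_length_le.trans time_le

theorem PolyCircuit.rename {G : List Bool → List (Gate Wire)} (h : PolyCircuit G)
    (f : List ℕ → List ℕ) : PolyCircuit fun x => (G x).map (Gate.map (renameWire f)) := by
  obtain ⟨p, b, h⟩ := h
  refine ⟨p.relocate id f, b, fun x => ?_⟩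
  obtain ⟨s, t, run, time_le⟩ := h x
  have extend_id (s S : ℕ → List Bool) : Function.extend id s S = s :=
    funext fun v => Function.injective_id.extend_apply s S v
  have run' := run.relocate Function.injective_id f (initMem x)
  rw [extend_id, extend_id] at run'
  exact ⟨s, t, run', time_le⟩

theorem PolyCircuit.append {G G' : List Bool → List (Gate Wire)} (h : PolyCircuit G)
    (h' : PolyCircuit G') : PolyCircuit fun x => G x ++ G' x := by
  obtain ⟨p, b, h⟩ := h
  obtain ⟨p', b', h'⟩ := h'
  refine ⟨p.both p', 11 * Polynomial.X + 2 + b + b', fun x => ?_⟩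
  obtain ⟨s, t, run, time_le⟩ := h x
  obtain ⟨s', t', run', time_le'⟩ := h' x
  refine ⟨_, _, run.both run', ?_⟩
  simp only [Polynomial.eval_add, Polynomial.eval_mul, Polynomial.eval_X, Polynomial.eval_ofNat]
  omega

/-- The gates `T`, in whose wires `m : Fin 3` stands for the `m`-th of the indices `i`, `j`, `k`. -/
def templateGates (T : List (Gate (List ℕ × List (Fin 3)))) (i j k : ℕ) : List (Gate Wire) :=
  T.map (Gate.map fun a => (a.1, a.2.map ![i, j, k]))

/-- Write the gates `T` for all indices `i`, `j`, `k` below the heights of the stacks `5`, `11`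
and `15`. -/
def Prog.tripleLoop (T : List (Gate (List ℕ × List (Fin 3)))) : Prog :=
  .forLoop 5 2 (.forLoop 11 4 (.forLoop 15 6
    (.emitAll (T.map (Gate.map fun a => (a.1, a.2.map ![5, 11, 15]))))))

theorem heightExec_tripleLoop (T : List (Gate (List ℕ × List (Fin 3)))) {h : ℕ → ℕ}
    (h₂ : h 2 = 0) (h₄ : h 4 = 0) (h₆ : h 6 = 0) :
    HeightExec (.tripleLoop T) h h
      ((List.range (h 5)).reverse.flatMap fun i => (List.range (h 11)).reverse.flatMap fun j =>
        (List.range (h 15)).reverse.flatMap fun k => templateGates T i j k)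
      (h 5 * (h 11 * (h 15 * (T.length + 1 + 6) + 2 + 6) + 2 + 6) + 2) := by
  refine heightExec_forLoop (by decide) rfl h₂ _ fun i _ => ?_
  refine heightExec_forLoop (by decide) (by simp) (by simp [h₄]) _ fun j _ => ?_
  refine heightExec_forLoop (by decide) (by simp) (by simp [h₆]) _ fun k _ => ?_
  have gates_eq (H : ℕ → ℕ) (hH : H ∘ ![5, 11, 15] = ![i, j, k]) :
      (T.map (Gate.map fun a => (a.1, a.2.map ![5, 11, 15]))).map
        (Gate.map fun a => (a.1, a.2.map H)) = templateGates T i j k := by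
    simp [templateGates, Gate.map_map, Function.comp_def, ← hH]
  rw [← gates_eq _ ?_, ← List.length_map (as := T)]
  · exact heightExec_emitAll _ _
  · funext m
    fin_cases m <;> simp

theorem exists_prog_lengths {n₁ n₂ n₃ : ℕ → ℕ} (h₁ : PolyTimeLength n₁) (h₂ : PolyTimeLength n₂)
    (h₃ : PolyTimeLength n₃) : ∃ (p : Prog) (b : Polynomial ℕ), ∀ x : List Bool, ∃ s t,
      Exec p (initMem x) s [] t ∧ t ≤ b.eval x.length ∧ s 2 = [] ∧ s 4 = [] ∧ s 6 = [] ∧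
        (s 5).length = n₁ x.length ∧ (s 11).length = n₂ x.length ∧
        (s 15).length = n₃ x.length := by
  obtain ⟨p₁, b₁, h₁⟩ := h₁
  obtain ⟨p₂, b₂, h₂⟩ := h₂
  obtain ⟨p₃, b₃, h₃⟩ := h₃
  refine ⟨.both .skip (.both p₁.mute (.both p₂.mute p₃.mute)),
    33 * Polynomial.X + 7 + b₁ + b₂ + b₃, fun x => ?_⟩
  obtain ⟨s₁, G₁, t₁, run₁, time_le₁, height₁⟩ := h₁ x
  obtain ⟨s₂, G₂, t₂, run₂, time_le₂, height₂⟩ := h₂ x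
  obtain ⟨s₃, G₃, t₃, run₃, time_le₃, height₃⟩ := h₃ x
  refine ⟨_, _, (Exec.skip _).both (run₁.mute.both (run₂.mute.both run₃.mute)), ?_, rfl, rfl, rfl,
    height₁, height₂, height₃⟩
  simp only [Polynomial.eval_add, Polynomial.eval_mul, Polynomial.eval_X, Polynomial.eval_ofNat]
  omega

theorem PolyCircuit.loop {n₁ n₂ n₃ : ℕ → ℕ} (h₁ : PolyTimeLength n₁) (h₂ : PolyTimeLength n₂)
    (h₃ : PolyTimeLength n₃) (T : List (Gate (List ℕ × List (Fin 3)))) :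
    PolyCircuit fun x => (List.range (n₁ x.length)).reverse.flatMap fun i =>
      (List.range (n₂ x.length)).reverse.flatMap fun j =>
        (List.range (n₃ x.length)).reverse.flatMap fun k => templateGates T i j k := by
  obtain ⟨p, b, lengths⟩ := exists_prog_lengths h₁ h₂ h₃
  obtain ⟨b₁, hb₁⟩ := h₁.polyBounded
  obtain ⟨b₂, hb₂⟩ := h₂.polyBounded
  obtain ⟨b₃, hb₃⟩ := h₃.polyBounded
  refine ⟨p.seq (.tripleLoop T),
    b + (b₁ * (b₂ * (b₃ * (Polynomial.C T.length + 1 + 6) + 2 + 6) + 2 + 6) + 2), fun x => ?_⟩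
  obtain ⟨s, t, run, time_le, e₂, e₄, e₆, e₅, e₁₁, e₁₅⟩ := lengths x
  obtain ⟨s', t', -, time_le', run'⟩ := heightExec_tripleLoop T (h := fun v => (s v).length)
    (by simp [e₂]) (by simp [e₄]) (by simp [e₆]) s fun _ => rfl
  rw [e₅, e₁₁, e₁₅] at time_le' run'
  refine ⟨s', t + t', run.seq run', ?_⟩
  simp only [Polynomial.eval_add, Polynomial.eval_mul, Polynomial.eval_C, Polynomial.eval_ofNat,
    Polynomial.eval_one]
  refine Nat.add_le_add time_le (time_le'.trans ?_)
  gcongr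
  exacts [hb₁ _, hb₂ _, hb₃ _]

end PolyCircuits

/-! ### Enumerable registers -/

section Enumerable

/-- Registers whose qubits a polynomial-time program can run through, writing out a fixed sequence
of gates for each of them. A wire `f` of such a gate stands for the qubit's own wire with its name
changed by `f`. -/
def EnumerableRegister (A : Register) : Prop :=
  ∃ l : ∀ n, List (A.Idx n), (∀ n, (l n).Nodup) ∧ (∀ n i, i ∈ l n) ∧
    ∀ T : List (Gate (List ℕ → List ℕ)), PolyCircuit fun x =>
      (l x.length).flatMap fun i => T.map (Gate.map fun f => renameWire f (A.label x.length i))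

theorem EnumerableRegister.polyBounded {A : Register} (hA : EnumerableRegister A) :
    PolyBounded fun n => Fintype.card (A.Idx n) := by
  obtain ⟨l, hl, hmem, gates⟩ := hA
  obtain ⟨b, hb⟩ := (gates [.had id]).length_le
  refine ⟨b, fun n => ?_⟩
  have length_eq_card (n : ℕ) : (l n).length = Fintype.card (A.Idx n) := by
    rw [← List.toFinset_card_of_nodup (hl n), Finset.card_eq_iff_eq_univ]
    exact Finset.eq_univ_iff_forall.2 fun i => List.mem_toFinset.2 (hmem n i)
  have card_le := hb (List.replicate n true)
  rw [List.length_flatMap] at card_le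
  simpa [length_eq_card] using card_le

theorem nodup_map_inl_append_map_inr {α β : Type} {l : List α} {l' : List β} (h : l.Nodup)
    (h' : l'.Nodup) : (l.map (Sum.inl : α → α ⊕ β) ++ l'.map Sum.inr).Nodup := by
  refine (h.map Sum.inl_injective).append (h'.map Sum.inr_injective) fun i hi hi' => ?_
  obtain ⟨a, -, rfl⟩ := List.mem_map.1 hi
  simp at hi'

theorem mem_map_inl_append_map_inr {α β : Type} {l : List α} {l' : List β} (h : ∀ i, i ∈ l)
    (h' : ∀ i, i ∈ l') (i : α ⊕ β) : i ∈ l.map Sum.inl ++ l'.map Sum.inr := by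
  obtain i | i := i <;> simp [h, h']

theorem flatMap_map_inl_append_map_inr {α β γ : Type} (l : List α) (l' : List β)
    (F : α ⊕ β → List γ) : (l.map Sum.inl ++ l'.map Sum.inr).flatMap F =
      (l.flatMap fun i => F (Sum.inl i)) ++ l'.flatMap fun i => F (Sum.inr i) := by
  rw [List.flatMap_append, List.flatMap_map, List.flatMap_map]

theorem EnumerableRegister.sum {A B : Register} (hA : EnumerableRegister A)
    (hB : EnumerableRegister B) : EnumerableRegister (A.sum B) := by
  obtain ⟨l, hl, hmem, gates⟩ := hA
  obtain ⟨l', hl', hmem', gates'⟩ := hB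
  refine ⟨fun n => (l n).map Sum.inl ++ (l' n).map Sum.inr,
    fun n => nodup_map_inl_append_map_inr (hl n) (hl' n),
    fun n => mem_map_inl_append_map_inr (hmem n) (hmem' n), fun T => ?_⟩
  convert (gates (T.map (Gate.map fun f => f ∘ List.cons 0))).append
    (gates' (T.map (Gate.map fun f => f ∘ List.cons 1))) using 2 with x
  refine (flatMap_map_inl_append_map_inr _ _ _).trans ?_
  simp only [List.map_map, Function.comp_def, Gate.map_map]
  rfl

/-- The indices of a three-dimensional array, in descending order. -/
def arrayIndices (n₁ n₂ n₃ : ℕ) : List (Fin n₁ × Fin n₂ × Fin n₃) :=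
  (List.finRange n₁).reverse ×ˢ ((List.finRange n₂).reverse ×ˢ (List.finRange n₃).reverse)

theorem nodup_arrayIndices (n₁ n₂ n₃ : ℕ) : (arrayIndices n₁ n₂ n₃).Nodup :=
  have nodup (n : ℕ) := List.nodup_reverse.2 (List.nodup_finRange n)
  (nodup n₁).product ((nodup n₂).product (nodup n₃))

theorem mem_arrayIndices (n₁ n₂ n₃ : ℕ) (q : Fin n₁ × Fin n₂ × Fin n₃) :
    q ∈ arrayIndices n₁ n₂ n₃ := by
  obtain ⟨i, j, k⟩ := q
  simp [arrayIndices, List.mem_product]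

theorem flatMap_reverse_finRange {β : Type} (n : ℕ) (f : ℕ → List β) :
    ((List.finRange n).reverse.flatMap fun i : Fin n => f i.val) =
      (List.range n).reverse.flatMap f := by
  rw [← List.map_coe_finRange_eq_range, ← List.map_reverse, List.flatMap_map]

theorem PolyCircuit.arrayLoop {n₁ n₂ n₃ : ℕ → ℕ} (h₁ : PolyTimeLength n₁) (h₂ : PolyTimeLength n₂)
    (h₃ : PolyTimeLength n₃) (T : List (Gate (List ℕ × List (Fin 3)))) :
    PolyCircuit fun x => (arrayIndices (n₁ x.length) (n₂ x.length) (n₃ x.length)).flatMap fun q =>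
      templateGates T q.1 q.2.1 q.2.2 := by
  convert PolyCircuit.loop h₁ h₂ h₃ T using 2 with x
  simp only [← flatMap_reverse_finRange, arrayIndices, SProd.sprod, List.product,
    List.flatMap_assoc, List.flatMap_map]

theorem enumerableRegister_of_array (A : Register) {n₁ n₂ n₃ : ℕ → ℕ} (h₁ : PolyTimeLength n₁)
    (h₂ : PolyTimeLength n₂) (h₃ : PolyTimeLength n₃)
    (e : ∀ n, Fin (n₁ n) × Fin (n₂ n) × Fin (n₃ n) ≃ A.Idx n) (dims : List (Fin 3))
    (hA : ∀ n q, A.label n (e n q) = ([], dims.map ![q.1.val, q.2.1.val, q.2.2.val])) :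
    EnumerableRegister A := by
  refine ⟨fun n => (arrayIndices (n₁ n) (n₂ n) (n₃ n)).map (e n),
    fun n => (nodup_arrayIndices _ _ _).map (e n).injective,
    fun n i => List.mem_map.2 ⟨(e n).symm i, mem_arrayIndices _ _ _ _, by simp⟩, fun T => ?_⟩
  convert PolyCircuit.arrayLoop h₁ h₂ h₃ (T.map (Gate.map fun f => (f [], dims))) using 2 with x
  simp only [List.flatMap_map, templateGates, List.map_map, Function.comp_def, Gate.map_map, hA,
    renameWire]

theorem PolyTimeLength.succ {f : ℕ → ℕ} (h : PolyTimeLength f) :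
    PolyTimeLength fun n => f n + 1 := by
  obtain ⟨p, b, h⟩ := h
  refine ⟨.seq p (.push true 1), b + 1, fun x => ?_⟩
  obtain ⟨s, G, t, run, time_le, height⟩ := h x
  exact ⟨_, _, _, run.seq (.push true 1 s), by simpa using time_le, by simp [height]⟩

theorem polyTimeLength_one : PolyTimeLength fun _ => 1 :=
  have zero : PolyTimeLength fun _ => 0 :=
    ⟨.skip, 1, fun x => ⟨_, _, _, .skip _, by simp, by simp [initMem]⟩⟩
  zero.succ

theorem enumerableRegister_ofSize {e : ℕ → ℕ} (he : PolyTimeLength e) :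
    EnumerableRegister (Register.ofSize e) :=
  enumerableRegister_of_array _ he polyTimeLength_one polyTimeLength_one
    (fun _ => ((Equiv.refl _).prodCongr (Equiv.prodUnique _ _)).trans (Equiv.prodUnique _ _)) [0]
    fun _ _ => rfl

end Enumerable

section Protocol

variable (I : PublicCoinProof)

theorem enumerableRegister_chalReg : EnumerableRegister I.chalReg :=
  enumerableRegister_of_array _ I.rounds_polyTime I.chalLen_polyTime polyTimeLength_one
    (fun _ => (Equiv.refl _).prodCongr (Equiv.prodUnique _ _)) [0, 1] fun _ _ => rfl

theorem enumerableRegister_ansReg : EnumerableRegister I.ansReg :=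
  enumerableRegister_of_array _ I.rounds_polyTime.succ I.msgLen_polyTime polyTimeLength_one
    (fun _ => (Equiv.refl _).prodCongr (Equiv.prodUnique _ _)) [0, 1] fun _ _ => rfl

theorem enumerableRegister_commitReg {N : ℕ → ℕ} (hN : PolyTimeLength N) :
    EnumerableRegister (I.commitReg N) :=
  enumerableRegister_of_array _ I.rounds_polyTime I.msgLen_polyTime hN
    (fun _ => Equiv.refl _) [0, 1, 2] fun _ _ => rfl

end Protocol

/-! ### Polynomial-time channels -/

section PolyTimeChannels

theorem renameWire_injective {f : List ℕ → List ℕ} (hf : Function.Injective f) :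
    Function.Injective (renameWire f) :=
  hf.prodMap Function.injective_id

theorem tagWire_injective (r : ℕ) : Function.Injective (tagWire r) := fun _ _ h => (tagWire_inj h).2

theorem tagWire_label_injective (r : ℕ) (A : Register) (n : ℕ) :
    Function.Injective fun i => tagWire r (A.label n i) :=
  (tagWire_injective r).comp (A.label_inj n)

theorem elim_tagWire_injective {α β : Type} {r r' : ℕ} (h : r ≠ r') {f : α → Wire} {g : β → Wire}
    (hf : Function.Injective f) (hg : Function.Injective g) :
    Function.Injective (Sum.elim (fun a => tagWire r (f a)) fun b => tagWire r' (g b)) :=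
  ((tagWire_injective r).comp hf).sumElim ((tagWire_injective r').comp hg)
    fun _ _ e => h (tagWire_inj e).1

theorem PolyTime.isCPTP {A B : Register}
    {Φ : ∀ x : List Bool, Op (A.Idx x.length) → Op (B.Idx x.length)} (hΦ : PolyTime A B Φ)
    (x : List Bool) : IsCPTP (Φ x) := by
  obtain ⟨G, -, hΦ⟩ := polyTime_iff.1 hΦ
  exact hΦ x ▸ isCPTP_circuitChannel _ (tagWire_label_injective 0 A _) _

/-- Keep the names with tag `r` and put the tag `m` in front of all others, so that a circuit shares
only its wires with tag `r` with its environment. -/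
def isolateName (r m : ℕ) (l : List ℕ) : List ℕ := if l.head? = some r then l else m :: l

theorem renameWire_isolateName (r m : ℕ) (w : Wire) :
    renameWire (isolateName r m) (tagWire r w) = tagWire r w := by
  simp [renameWire, isolateName, tagWire]

theorem isolateName_elim_injective {r m r' m' : ℕ} (h : [r, m, r', m'].Nodup) :
    Function.Injective (Sum.elim (renameWire (isolateName r m))
      (renameWire (isolateName r' m'))) := by
  have inj {r m : ℕ} (h : r ≠ m) : Function.Injective (isolateName r m) := fun l l' e => by
    unfold isolateName at e
    grind
  refine (renameWire_injective (inj (by grind))).sumElim (renameWire_injective (inj (by grind)))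
    fun w w' e => ?_
  have head_eq := congrArg (fun w : Wire => w.1.head?) e
  unfold renameWire isolateName at head_eq
  grind

theorem PolyTime.comp {A B C : Register} (hB : EnumerableRegister B)
    {Φ : ∀ x : List Bool, Op (A.Idx x.length) → Op (B.Idx x.length)}
    {Ψ : ∀ x : List Bool, Op (B.Idx x.length) → Op (C.Idx x.length)} (hΨ : PolyTime B C Ψ)
    (hΦ : PolyTime A B Φ) : PolyTime A C fun x => Ψ x ∘ Φ x := by
  obtain ⟨G, hG, hΦ⟩ := polyTime_iff.1 hΦ
  obtain ⟨G', hG', hΨ⟩ := polyTime_iff.1 hΨ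
  obtain ⟨l, hl, hmem, gates⟩ := hB
  let f := isolateName 0 2
  let f' := isolateName 1 3
  have moves := gates [.cnot (f ∘ List.cons 1) (f' ∘ List.cons 0),
    .cnot (f' ∘ List.cons 0) (f ∘ List.cons 1)]
  refine polyTime_iff.2 ⟨_, ((hG.rename f).append moves).append (hG'.rename f'), fun x => ?_⟩
  have wiring := circuitChannel_comp (hl x.length) (hmem x.length)
    (isolateName_elim_injective (r := 0) (m := 2) (r' := 1) (m' := 3) (by decide)) (G x) (G' x)
    (tagWire_label_injective 0 A x.length)
    (tagWire_label_injective 1 B x.length) (tagWire_label_injective 0 B x.length)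
    fun i => tagWire 1 (C.label x.length i)
  simp only [Function.comp_def, renameWire_isolateName] at wiring
  rw [hΦ, hΨ]
  exact wiring.symm

/-- Keep the tag `0` of names, followed by a new tag `0`. -/
def nestName : List ℕ → List ℕ
  | 0 :: l => 0 :: 0 :: l
  | l => 2 :: l

theorem nestName_injective : Function.Injective nestName := by
  intro l l' h
  unfold nestName at h
  split at h <;> split at h <;> simp_all

theorem nestName_ne_zero_cons_one (l l' : List ℕ) : nestName l ≠ 0 :: 1 :: l' := by
  unfold nestName
  split <;> simp

theorem nestName_ne_one_cons (l l' : List ℕ) : nestName l ≠ 1 :: l' := by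
  unfold nestName
  split <;> simp

theorem PolyTime.onFirst {A B R : Register} (hB : EnumerableRegister B) (hR : EnumerableRegister R)
    {Φ : ∀ x : List Bool, Op (A.Idx x.length) → Op (B.Idx x.length)} (hΦ : PolyTime A B Φ) :
    PolyTime (A.sum R) (B.sum R) fun x => onFirst (R.Idx x.length) (Φ x) := by
  obtain ⟨G, hG, hΦ⟩ := polyTime_iff.1 hΦ
  obtain ⟨l, hl, hmem, gates⟩ := hB.sum hR
  let outName : List ℕ → List ℕ
    | 0 :: l => nestName (1 :: l)
    | l => 0 :: l
  have moves := gates [.cnot outName (List.cons 1), .cnot (List.cons 1) outName]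
  refine polyTime_iff.2 ⟨_, (hG.rename nestName).append moves, fun x => ?_⟩
  let n := x.length
  let side i := tagWire 0 (tagWire 1 (R.label n i))
  let dst i := tagWire 1 ((B.sum R).label n i)
  have injective : Function.Injective (Sum.elim (Sum.elim (renameWire nestName) side) dst) := by
    refine Function.Injective.sumElim ((renameWire_injective nestName_injective).sumElim
      ((tagWire_injective 0).comp (tagWire_label_injective 1 R n)) fun w i h => ?_)
      (tagWire_label_injective 1 (B.sum R) n) ?_
    · exact nestName_ne_zero_cons_one _ _ (congrArg Prod.fst h)
    · rintro (w | i) j h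
      · exact nestName_ne_one_cons _ _ (congrArg Prod.fst h)
      · exact zero_ne_one (tagWire_inj h).1
  have wiring := circuitChannel_moves_onFirst (hl n) (hmem n) injective (G x)
    (tagWire_label_injective 0 A n) (tagWire_label_injective 1 B n)
  rw [← hΦ] at wiring
  have src_eq : Sum.elim (renameWire nestName ∘ fun i => tagWire 1 (B.label n i)) side =
      fun i => renameWire outName ((B.sum R).label n i) := by
    funext i
    obtain i | i := i <;> rfl
  have inp_eq : Sum.elim (renameWire nestName ∘ fun i => tagWire 0 (A.label n i)) side =
      fun i => tagWire 0 ((A.sum R).label n i) := by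
    funext i
    obtain i | i := i <;> rfl
  rw [src_eq, inp_eq] at wiring
  exact wiring.symm

theorem polyTime_dephase {A : Register} (hA : EnumerableRegister A) :
    PolyTime A A fun _ => dephase := by
  obtain ⟨l, hl, hmem, gates⟩ := hA
  refine polyTime_iff.2 ⟨_, gates [.cnot (List.cons 0) (List.cons 1)], fun x => ?_⟩
  rw [← circuitChannel_copyGates (hl x.length) (hmem x.length)
    (elim_tagWire_injective zero_ne_one (A.label_inj _) (A.label_inj _))]
  exact congrArg (circuitChannel · _ _) List.map_eq_flatMap

theorem polyTime_sumComm {A B : Register} (hA : EnumerableRegister A) (hB : EnumerableRegister B) :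
    PolyTime (A.sum B) (B.sum A) fun x =>
      relabel (Equiv.sumComm (B.Idx x.length) (A.Idx x.length)) := by
  obtain ⟨l, hl, hmem, gates⟩ := hB.sum hA
  let swapTag : List ℕ → List ℕ
    | 0 :: l => 1 :: l
    | l => 0 :: l.tail
  have moves := gates [.cnot (List.cons 0 ∘ swapTag) (List.cons 1),
    .cnot (List.cons 1) (List.cons 0 ∘ swapTag)]
  refine polyTime_iff.2 ⟨_, moves, fun x => ?_⟩
  let e : A.Idx x.length ⊕ B.Idx x.length ≃ B.Idx x.length ⊕ A.Idx x.length := Equiv.sumComm _ _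
  let src (i : B.Idx x.length ⊕ A.Idx x.length) := tagWire 0 ((A.sum B).label x.length (e.symm i))
  let dst (i : B.Idx x.length ⊕ A.Idx x.length) := tagWire 1 ((B.sum A).label x.length i)
  have hsrc : Function.Injective src :=
    ((tagWire_injective 0).comp ((A.sum B).label_inj _)).comp e.symm.injective
  have hsd : Function.Injective (Sum.elim src dst) :=
    elim_tagWire_injective zero_ne_one (((A.sum B).label_inj _).comp e.symm.injective)
      ((B.sum A).label_inj _)
  have swap (ρ) := (circuitChannel_comp_equiv (moveGates src dst (l x.length)) hsrc dst e ρ).trans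
    (congrFun (circuitChannel_moveGates (hl _) (hmem _) hsd) (relabel e.symm ρ))
  have inp_eq : src ∘ e = fun i => tagWire 0 ((A.sum B).label x.length i) := by
    funext i
    obtain i | i := i <;> rfl
  have src_eq : src = fun i =>
      renameWire (List.cons 0 ∘ swapTag) ((B.sum A).label x.length i) := by
    funext i
    obtain i | i := i <;> rfl
  rw [inp_eq, src_eq] at swap
  exact funext fun ρ => (swap ρ).symm

end PolyTimeChannels

/-! ### Products of one-qubit operators -/

section LocalProducts

variable {ι J : Type} {m : ι → Bool → Bool → ℂ}

open Classical in
/-- The operator that applies the one-qubit matrix `m v` to every qubit `v ∈ s`. -/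
noncomputable def localProd (s : Finset ι) (m : ι → Bool → Bool → ℂ) : Op ι :=
  Matrix.of fun x y => if ∀ v, v ∉ s → x v = y v then ∏ v ∈ s, m v (x v) (y v) else 0

open Classical in
theorem localProd_apply (s : Finset ι) (m : ι → Bool → Bool → ℂ) (x y : ι → Bool) :
    localProd s m x y = if ∀ v, v ∉ s → x v = y v then ∏ v ∈ s, m v (x v) (y v) else 0 := rfl

theorem localProd_empty [DecidableEq (ι → Bool)] (m : ι → Bool → Bool → ℂ) :
    localProd ∅ m = 1 := by
  classical
  ext x y
  rw [localProd_apply, Finset.prod_empty, Matrix.one_apply]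
  exact if_congr (by simp [funext_iff]) rfl rfl

variable [Fintype ι] [DecidableEq ι]

theorem localProd_mul {s t : Finset ι} (hst : Disjoint s t) (m : ι → Bool → Bool → ℂ) :
    localProd s m * localProd t m = localProd (s ∪ t) m := by
  have hts : ∀ v ∈ t, v ∉ s := fun v hv => Finset.disjoint_right.1 hst hv
  ext x z
  rw [Matrix.mul_apply, Finset.sum_eq_single fun v => if v ∈ s then z v else x v]
  · have agree_t : (∀ v, v ∉ t → (if v ∈ s then z v else x v) = z v) ↔
        ∀ v, v ∉ s ∪ t → x v = z v := by
      refine forall_congr' fun v => ?_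
      by_cases hv : v ∈ s <;> simp [hv]
    have prod_s : ∏ v ∈ s, m v (x v) (if v ∈ s then z v else x v) = ∏ v ∈ s, m v (x v) (z v) :=
      Finset.prod_congr rfl fun v hv => by rw [if_pos hv]
    have prod_t : ∏ v ∈ t, m v (if v ∈ s then z v else x v) (z v) = ∏ v ∈ t, m v (x v) (z v) :=
      Finset.prod_congr rfl fun v hv => by rw [if_neg (hts v hv)]
    simp only [localProd_apply, agree_t, prod_s, prod_t, mul_ite, mul_zero]
    rw [if_pos fun v hv => (if_neg hv).symm, Finset.prod_union hst]
    congr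
  · intro y _ hy
    by_contra hne
    simp only [localProd_apply, mul_ite, mul_zero, ite_mul, zero_mul, ite_eq_right_iff,
      Classical.not_imp] at hne
    obtain ⟨ht, hs, -⟩ := hne
    refine hy (funext fun v => ?_)
    split_ifs with hv
    · exact ht v (Finset.disjoint_left.1 hst hv)
    · exact (hs v hv).symm
  · exact fun h => absurd (Finset.mem_univ _) h

theorem localProd_conj {s t : Finset ι} (hst : Disjoint s t) (m : ι → Bool → Bool → ℂ)
    (ρ : Op ι) : localProd s m * (localProd t m * ρ * localProd t m) * localProd s m =
      localProd (s ∪ t) m * ρ * localProd (s ∪ t) m := by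
  nth_rw 2 [Finset.union_comm]
  simp only [← localProd_mul hst, ← localProd_mul hst.symm, Matrix.mul_assoc]

theorem foldl_localProd_conj [DecidableEq J] {U : J → Finset ι}
    (hU : Pairwise (Function.onFun Disjoint U)) (p : J → ℂ) {l : List J} (hl : l.Nodup)
    (m : ι → Bool → Bool → ℂ) (ρ : Op ι) :
    l.foldl (fun ρ i => p i • (localProd (U i) m * ρ * localProd (U i) m)) ρ =
      (l.map p).prod • (localProd (l.toFinset.biUnion U) m * ρ *
        localProd (l.toFinset.biUnion U) m) := by
  induction l generalizing ρ with
  | nil => simp [localProd_empty]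
  | cons i l ih =>
    have hd : Disjoint (l.toFinset.biUnion U) (U i) := by
      rw [Finset.disjoint_biUnion_left]
      exact fun j hj => hU fun h => (List.nodup_cons.1 hl).1 (h ▸ List.mem_toFinset.1 hj)
    rw [List.foldl_cons, ih hl.of_cons, Matrix.mul_smul, Matrix.smul_mul, localProd_conj hd,
      smul_smul, List.map_cons, List.prod_cons, List.toFinset_cons, Finset.biUnion_insert,
      Finset.union_comm, mul_comm]

end LocalProducts

/-! ### Conjugate coding -/

section ConjugateCoding

variable {V P C A : Type} [Fintype V] [Fintype P] [Fintype C] [Fintype A]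

theorem hadEntry_comm (s t : Bool) : hadEntry s t = hadEntry t s := by
  cases s <;> cases t <;> rfl

theorem star_conjugateCoding (θ s y : Bool) :
    star (conjugateCoding θ s y) = conjugateCoding θ s y := by
  unfold conjugateCoding hadEntry
  split_ifs <;> simp

theorem hadEntry_mul_self (s t : Bool) : hadEntry s t * hadEntry s t = 2⁻¹ := by
  have h : ((Real.sqrt 2 : ℝ) : ℂ)⁻¹ * ((Real.sqrt 2 : ℝ) : ℂ)⁻¹ = 2⁻¹ := by
    rw [← mul_inv, ← Complex.ofReal_mul, Real.mul_self_sqrt zero_le_two, Complex.ofReal_ofNat]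
  unfold hadEntry
  split_ifs
  · rw [neg_mul_neg, h]
  · exact h

theorem sum_conjugateCoding_mul_self (θ s : Bool) :
    ∑ y, conjugateCoding θ s y * conjugateCoding θ s y = 1 := by
  cases θ
  · cases s <;> simp [conjugateCoding]
  · simp only [conjugateCoding, if_true, hadEntry_mul_self, Fintype.sum_bool]
    norm_num

/-- The amplitudes of the state that encodes the string `z` in the bases `θ`. -/
noncomputable def codeAmp (θ z p : V → Bool) : ℂ :=
  ∏ v, conjugateCoding (θ v) (z v) (p v)

theorem star_codeAmp (θ z p : V → Bool) : star (codeAmp θ z p) = codeAmp θ z p := by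
  simp only [codeAmp, star_prod, star_conjugateCoding]

theorem codeAmp_elim (θ z p : P → Bool) (θ' z' p' : C → Bool) :
    codeAmp (Sum.elim θ θ') (Sum.elim z z') (Sum.elim p p') = codeAmp θ z p * codeAmp θ' z' p' := by
  simp only [codeAmp, Fintype.prod_sum_type, Sum.elim_inl, Sum.elim_inr]

theorem codeAmp_false (c d : V → Bool) :
    codeAmp (fun _ => false) c d = if d = c then 1 else 0 := by
  simp only [codeAmp, conjugateCoding, Bool.false_eq_true, if_false, Finset.prod_ite_zero,
    Finset.mem_univ, forall_const, Finset.prod_const_one, funext_iff]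

theorem codeAmp_dotProduct_self [DecidableEq V] (θ z : V → Bool) :
    codeAmp θ z ⬝ᵥ codeAmp θ z = 1 := by
  simp only [dotProduct, codeAmp, ← Finset.prod_mul_distrib]
  rw [← Fintype.prod_sum fun v s => conjugateCoding (θ v) (z v) s * conjugateCoding (θ v) (z v) s]
  simp only [sum_conjugateCoding_mul_self, Finset.prod_const_one]

/-- The one-qubit projectors onto the factors of the state that encodes `z` in the bases `θ`. -/
noncomputable def codeProj (θ z : V → Bool) (v : V) (s t : Bool) : ℂ :=
  conjugateCoding (θ v) (z v) s * star (conjugateCoding (θ v) (z v) t)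

theorem localProd_univ_codeProj (θ z : V → Bool) :
    localProd Finset.univ (codeProj θ z) = Matrix.vecMulVec (codeAmp θ z) (codeAmp θ z) := by
  ext x y
  simp only [localProd_apply, Finset.mem_univ, not_true_eq_false, false_imp_iff, implies_true,
    if_true, codeProj, star_conjugateCoding, Finset.prod_mul_distrib, Matrix.vecMulVec_apply,
    codeAmp]

variable [DecidableEq V] [DecidableEq P] [DecidableEq C] [DecidableEq A]

/-- The (unnormalised) probability of the outcome `z` when the qubits of a register in the state
`ρ` are measured in the bases `θ`. -/
noncomputable def codeWeight (θ z : V → Bool) (ρ : Op V) : ℂ :=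
  codeAmp θ z ⬝ᵥ ρ.mulVec (codeAmp θ z)

theorem codeWeight_eq_sum (θ z : V → Bool) (ρ : Op V) :
    codeWeight θ z ρ = ∑ p, ∑ p', codeAmp θ z p * ρ p p' * codeAmp θ z p' := by
  simp only [codeWeight, dotProduct, Matrix.mulVec, Finset.mul_sum, mul_assoc]

theorem codeWeight_sum_smul {J : Type*} (s : Finset J) (θ z : V → Bool) (k : J → ℂ)
    (ρ : J → Op V) :
    codeWeight θ z (∑ j ∈ s, k j • ρ j) = ∑ j ∈ s, k j * codeWeight θ z (ρ j) := by
  simp only [codeWeight, Matrix.sum_mulVec, Matrix.smul_mulVec, dotProduct_sum, dotProduct_smul,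
    smul_eq_mul]

theorem codeWeight_elim_false (θ z : P → Bool) (c : C → Bool) (ρ : Op (P ⊕ C)) :
    codeWeight (Sum.elim θ fun _ => false) (Sum.elim z c) ρ =
      codeWeight θ z (Matrix.of fun p p' => ρ (Sum.elim p c) (Sum.elim p' c)) := by
  simp only [codeWeight_eq_sum, sum_sumArrow, codeAmp_elim, codeAmp_false, Matrix.of_apply,
    mul_ite, mul_one, mul_zero, ite_mul, zero_mul, Finset.sum_ite_irrel, Finset.sum_const_zero,
    Finset.sum_ite_eq', Finset.mem_univ, if_true]

theorem trace_localProd_univ_codeProj (θ z : V → Bool) (ρ : Op V) :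
    (localProd Finset.univ (codeProj θ z) * ρ * localProd Finset.univ (codeProj θ z)).trace =
      codeWeight θ z ρ := by
  rw [localProd_univ_codeProj, Matrix.trace_mul_comm, ← Matrix.mul_assoc,
    Matrix.vecMulVec_mul_vecMulVec, codeAmp_dotProduct_self, one_smul, Matrix.vecMulVec_mul,
    Matrix.trace_vecMulVec, codeWeight, dotProduct_comm, Matrix.dotProduct_mulVec]

end ConjugateCoding

/-! ### Circuits acting on a register -/

section RotateGates

variable {A P : Type}

/-- Controlled Hadamard gates that rotate the qubits in `l` to the bases held by the qubits to which
`ctrl` sends them. -/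
def rotateGates (ctrl : P → A) (l : List P) : List (Gate (A ⊕ P)) :=
  l.map fun q => Gate.chad (Sum.inl (ctrl q)) (Sum.inr q)

theorem chad_mat_elim (c : A) (q : P) (a : A → Bool) (p : P → Bool) :
    (Gate.chad (Sum.inl c : A ⊕ P) (Sum.inr q)).mat (Sum.elim a p) = conjugateCoding (a c) := by
  funext s t
  cases h : a c <;> simp [Gate.mat, conjugateCoding, h, hadEntry_comm t s, eq_comm (a := t)]

theorem chad_entry_elim [DecidableEq (A → Bool)] (c : A) (q : P) (a a' : A → Bool)
    (z p : P → Bool) :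
    (Gate.chad (Sum.inl c : A ⊕ P) (Sum.inr q)).entry (Sum.elim a z) (Sum.elim a' p) =
      if a = a' then localProd {q} (fun _ => conjugateCoding (a c)) z p else 0 := by
  classical
  rw [Gate.entry_eq, chad_mat_elim, localProd_apply, Finset.prod_singleton, ← ite_and]
  have agree_iff :
      (∀ w, w ≠ (Gate.chad (Sum.inl c) (Sum.inr q)).target → Sum.elim a z w = Sum.elim a' p w) ↔
        a = a' ∧ ∀ v, v ∉ ({q} : Finset P) → z v = p v := by
    simp [Gate.target, funext_iff]
  by_cases h : a = a' ∧ ∀ v, v ∉ ({q} : Finset P) → z v = p v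
  · rw [if_pos h, if_pos (agree_iff.2 h), h.1]
    rfl
  · rw [if_neg h, if_neg (mt agree_iff.1 h)]

end RotateGates

section CircuitMatrix

variable {ι A P : Type} [Fintype ι] [DecidableEq ι] [Fintype A] [DecidableEq A] [Fintype P]
  [DecidableEq P]

/-- The matrix of a circuit all of whose wires belong to the register `ι`. -/
noncomputable def circuitMatrix (G : List (Gate ι)) : Op ι :=
  G.foldr (fun g U => U * Matrix.of g.entry) 1

theorem circuitMatrix_cons (g : Gate ι) (G : List (Gate ι)) :
    circuitMatrix (g :: G) = circuitMatrix G * Matrix.of g.entry := rfl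

theorem circuitMatrix_cons_apply (g : Gate ι) (G : List (Gate ι)) (x y : ι → Bool) :
    circuitMatrix (g :: G) x y =
      ∑ s, circuitMatrix G x (Function.update y g.target s) * g.mat y s (y g.target) := by
  have injective : Function.Injective (Function.update y g.target) :=
    fun s s' h => by simpa using congrFun h g.target
  rw [circuitMatrix_cons, Matrix.mul_apply,
    ← Finset.sum_subset (Finset.subset_univ (Finset.univ.map ⟨_, injective⟩)), Finset.sum_map]
  · refine Finset.sum_congr rfl fun s _ => ?_
    rw [Function.Embedding.coeFn_mk, Matrix.of_apply, Gate.entry_eq,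
      if_pos fun v hv => Function.update_of_ne hv _ _, Function.update_self]
  · intro z _ hz
    rw [Matrix.of_apply, Gate.entry_eq, if_neg, mul_zero]
    refine fun h => hz (Finset.mem_map.2 ⟨z g.target, Finset.mem_univ _, funext fun w => ?_⟩)
    obtain rfl | hw := eq_or_ne w g.target
    · exact Function.update_self ..
    · exact (Function.update_of_ne hw _ _).trans (h w hw).symm

theorem pull_eq_sum_circuitMatrix (Q : WireKernel ι) (G : List (Gate ι)) (x x' : ι → Bool) :
    pull G Q x x' =
      ∑ z, ∑ z', circuitMatrix G z x * star (circuitMatrix G z' x') * Q z z' := by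
  induction G generalizing x x' with
  | nil => simp [pull_nil, circuitMatrix, Matrix.one_apply, apply_ite star]
  | cons g G ih =>
    simp only [pull_cons, Gate.pull, LinearMap.coe_mk, AddHom.coe_mk, ih, circuitMatrix_cons_apply,
      Fintype.sum_bool, star_add, star_mul', Finset.mul_sum, ← Finset.sum_add_distrib]
    exact Finset.sum_congr rfl fun z _ => Finset.sum_congr rfl fun z' _ => by ring

theorem circuitChannel_id (G : List (Gate ι)) (ρ : Op ι) :
    circuitChannel G id id ρ = circuitMatrix G * ρ * (circuitMatrix G).conjTranspose := by
  have config_eq (b : ι → Bool) : inputConfig id b = b :=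
    funext fun i => inputConfig_apply Function.injective_id b i
  have kernel_eq (y y' z z' : ι → Bool) :
      selectKernel id y y' z z' = if z = y ∧ z' = y' then 1 else 0 := by
    simp [selectKernel, funext_iff]
  ext y y'
  rw [circuitChannel_apply _ Function.injective_id]
  simp only [config_eq, pull_eq_sum_circuitMatrix, kernel_eq, Matrix.mul_apply,
    Matrix.conjTranspose_apply, mul_ite, mul_one, mul_zero, ite_and, Finset.sum_mul,
    Finset.sum_ite_irrel, Finset.sum_const_zero, Finset.sum_ite_eq', Finset.mem_univ, if_true]
  rw [Finset.sum_comm]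
  exact Finset.sum_congr rfl fun b _ => Finset.sum_congr rfl fun b' _ => by ring

theorem circuitMatrix_rotateGates (ctrl : P → A) {l : List P} (hl : l.Nodup) (a a' : A → Bool)
    (z p : P → Bool) :
    circuitMatrix (rotateGates ctrl l) (Sum.elim a z) (Sum.elim a' p) =
      if a = a' then localProd l.toFinset (fun q => conjugateCoding (a (ctrl q))) z p else 0 := by
  induction l generalizing a' p with
  | nil =>
    rw [List.toFinset_nil, localProd_empty, Matrix.one_apply, ← ite_and]
    exact if_congr (by simp [funext_iff]) rfl rfl
  | cons q l ih =>
    have hd : Disjoint l.toFinset {q} := by simpa using (List.nodup_cons.1 hl).1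
    have gate_eq : localProd {q} (fun _ => conjugateCoding (a (ctrl q))) =
        localProd {q} fun q => conjugateCoding (a (ctrl q)) := by
      ext x y
      simp only [localProd_apply, Finset.prod_singleton]
    rw [List.toFinset_cons, ← Finset.union_singleton, ← localProd_mul hd, Matrix.mul_apply,
      rotateGates, List.map_cons, circuitMatrix_cons, Matrix.mul_apply, sum_sumArrow]
    rw [rotateGates] at ih
    simp only [Matrix.of_apply, chad_entry_elim, ih hl.of_cons, ite_mul, zero_mul, mul_ite,
      mul_zero, Finset.sum_ite_irrel, Finset.sum_const_zero, Finset.sum_ite_eq',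
      Finset.mem_univ, if_true, ← gate_eq]
    split_ifs with h
    · rw [h]
    · rfl

theorem circuitChannel_rotateGates (ctrl : P → A) {l : List P} (hl : l.Nodup) (hmem : ∀ q, q ∈ l)
    (ρ : Op (A ⊕ P)) (r : A ⊕ P → Bool) :
    circuitChannel (rotateGates ctrl l) id id ρ r r =
      codeWeight (r ∘ Sum.inl ∘ ctrl) (r ∘ Sum.inr)
        (Matrix.of fun p p' => ρ (Sum.elim (r ∘ Sum.inl) p) (Sum.elim (r ∘ Sum.inl) p')) := by
  have univ_eq : l.toFinset = Finset.univ :=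
    Finset.eq_univ_of_forall fun q => List.mem_toFinset.2 (hmem q)
  obtain ⟨a, z, rfl⟩ : ∃ a z, r = Sum.elim a z := ⟨_, _, (Sum.elim_comp_inl_inr r).symm⟩
  have amplitude (a' p) : circuitMatrix (rotateGates ctrl l) (Sum.elim a z) (Sum.elim a' p) =
      if a = a' then codeAmp (a ∘ ctrl) z p else 0 := by
    classical
    rw [circuitMatrix_rotateGates ctrl hl, univ_eq, localProd_apply,
      if_pos fun v hv => absurd (Finset.mem_univ v) hv]
    rfl
  rw [circuitChannel_id, codeWeight_eq_sum, Finset.sum_comm]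
  simp only [Matrix.mul_apply, Matrix.conjTranspose_apply, sum_sumArrow, amplitude,
    apply_ite star, star_zero, star_codeAmp, ite_mul, zero_mul, mul_ite, mul_zero,
    Finset.sum_ite_irrel, Finset.sum_const_zero, Finset.sum_ite_eq, Finset.mem_univ, if_true,
    Finset.sum_mul, Sum.elim_comp_inl, Sum.elim_comp_inr, Matrix.of_apply, ← Function.comp_assoc]

end CircuitMatrix

/-! ### The prover of the compressed protocol -/

namespace PublicCoinProof

variable (I : PublicCoinProof) (N : ℕ → ℕ)

/-- The bit of the prover messages to which a qubit of the commitment registers belongs. -/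
def commitBit {n : ℕ} (q : (I.commitReg N).Idx n) : I.ansReg.Idx n := (q.1.castSucc, q.2.1)

/-- The channel that measures the commitment registers as in commitments to the messages `a` held
by the first register, which is measured too. -/
noncomputable def commitChan (n : ℕ) (σ : Op ((I.rrReply N).Idx n)) : Op ((I.rrReply N).Idx n) :=
  Matrix.diagonal fun r => codeWeight (r ∘ Sum.inl ∘ I.commitBit N) (r ∘ Sum.inr)
    (Matrix.of fun p p' => σ (Sum.elim (r ∘ Sum.inl) p) (Sum.elim (r ∘ Sum.inl) p'))

variable {N}

theorem enumerableRegister_rrQuery (hN : PolyTimeLength N) : EnumerableRegister (I.rrQuery N) :=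
  (enumerableRegister_commitReg I hN).sum (enumerableRegister_chalReg I)

theorem enumerableRegister_rrReply (hN : PolyTimeLength N) : EnumerableRegister (I.rrReply N) :=
  (enumerableRegister_ansReg I).sum (enumerableRegister_commitReg I hN)

theorem polyTime_commitChan (hN : PolyTimeLength N) :
    PolyTime (I.rrReply N) (I.rrReply N) fun x => I.commitChan N x.length := by
  obtain ⟨l, hl, hmem, gates⟩ := I.enumerableRegister_rrReply hN
  have rotate := PolyCircuit.arrayLoop I.rounds_polyTime I.msgLen_polyTime hN
    [.chad ([0, 0], [0, 1]) ([0, 1], [0, 1, 2])]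
  refine polyTime_iff.2
    ⟨_, rotate.append (gates [.cnot (List.cons 0) (List.cons 1)]), fun x => ?_⟩
  let q := arrayIndices (I.rounds x.length) (I.msgLen x.length) (N x.length)
  let inp i := tagWire 0 ((I.rrReply N).label x.length i)
  let out i := tagWire 1 ((I.rrReply N).label x.length i)
  have hinp : Function.Injective inp := tagWire_label_injective 0 (I.rrReply N) x.length
  have hsd : Function.Injective (Sum.elim inp out) :=
    elim_tagWire_injective zero_ne_one ((I.rrReply N).label_inj _) ((I.rrReply N).label_inj _)
  have wiring := circuitChannel_append hinp hsd (rotateGates (I.commitBit N) q)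
    (copyGates Sum.inl Sum.inr (l x.length)) Function.injective_id (out₁ := id) (inp₂ := Sum.inl)
    rfl Sum.inl_injective (fun w _ _ => ⟨w, rfl⟩) Sum.inr
  rw [circuitChannel_copyGates (hl _) (hmem _) (by simpa using Function.injective_id)] at wiring
  have rotate_eq : (rotateGates (I.commitBit N) q).map (Gate.map inp) = q.flatMap fun q =>
      templateGates [.chad ([0, 0], [0, 1]) ([0, 1], [0, 1, 2])] q.1 q.2.1 q.2.2 :=
    List.map_map.trans List.map_eq_flatMap
  have copy_eq : (copyGates Sum.inl Sum.inr (l x.length)).map (Gate.map (Sum.elim inp out)) =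
      (l x.length).flatMap fun i => [Gate.cnot (inp i) (out i)] :=
    List.map_map.trans List.map_eq_flatMap
  rw [rotate_eq, copy_eq] at wiring
  refine Eq.trans (funext fun ρ => congrArg Matrix.diagonal (funext fun r => ?_)) wiring.symm
  exact (circuitChannel_rotateGates (I.commitBit N) (nodup_arrayIndices ..)
    (mem_arrayIndices _ _ _) ρ r).symm

/-! ### The measurements on a branch of an execution -/

variable (N) {n : ℕ}

/-- The qubits of `Pᵢ`. -/
def commitBlock (i : Fin (I.rounds n)) : Finset ((I.rrQuery N).Idx n) :=
  Finset.disjSum ({i} ×ˢ Finset.univ) ∅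

/-- The qubits of `Cᵢ`. -/
def chalBlock (i : Fin (I.rounds n)) : Finset ((I.rrQuery N).Idx n) :=
  Finset.disjSum ∅ ({i} ×ˢ Finset.univ)

theorem inl_mem_commitBlock {i : Fin (I.rounds n)} {q : (I.commitReg N).Idx n} :
    Sum.inl q ∈ I.commitBlock N i ↔ q.1 = i := by
  refine Finset.inl_mem_disjSum.trans (Finset.mem_product.trans ?_)
  rw [Finset.mem_singleton, and_iff_left (Finset.mem_univ _)]

theorem inr_notMem_commitBlock {i : Fin (I.rounds n)} {q : I.chalReg.Idx n} :
    Sum.inr q ∉ I.commitBlock N i :=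
  fun h => Finset.notMem_empty _ (Finset.inr_mem_disjSum.1 h)

theorem inl_notMem_chalBlock {i : Fin (I.rounds n)} {q : (I.commitReg N).Idx n} :
    Sum.inl q ∉ I.chalBlock N i :=
  fun h => Finset.notMem_empty _ (Finset.inl_mem_disjSum.1 h)

theorem inr_mem_chalBlock {i : Fin (I.rounds n)} {q : I.chalReg.Idx n} :
    Sum.inr q ∈ I.chalBlock N i ↔ q.1 = i := by
  refine Finset.inr_mem_disjSum.trans (Finset.mem_product.trans ?_)
  rw [Finset.mem_singleton, and_iff_left (Finset.mem_univ _)]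

theorem pairwise_disjoint_commitBlock :
    Pairwise (Function.onFun Disjoint (I.commitBlock N (n := n))) := by
  refine fun i j hij => Finset.disjoint_left.2 ?_
  rintro (q | q) hi hj
  · exact hij (((I.inl_mem_commitBlock N).1 hi).symm.trans ((I.inl_mem_commitBlock N).1 hj))
  · exact I.inr_notMem_commitBlock N hi

theorem pairwise_disjoint_chalBlock :
    Pairwise (Function.onFun Disjoint (I.chalBlock N (n := n))) := by
  refine fun i j hij => Finset.disjoint_left.2 ?_
  rintro (q | q) hi hj
  · exact I.inl_notMem_chalBlock N hi
  · exact hij (((I.inr_mem_chalBlock N).1 hi).symm.trans ((I.inr_mem_chalBlock N).1 hj))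

theorem disjoint_commitBlock_chalBlock (i j : Fin (I.rounds n)) :
    Disjoint (I.commitBlock N i) (I.chalBlock N j) := by
  refine Finset.disjoint_left.2 ?_
  rintro (q | q) hi hj
  · exact I.inl_notMem_chalBlock N hj
  · exact I.inr_notMem_commitBlock N hi

theorem biUnion_commitBlock_union_chalBlock :
    (Finset.univ.biUnion fun i => I.commitBlock N (n := n) i ∪ I.chalBlock N i) = Finset.univ := by
  refine Finset.eq_univ_of_forall ?_
  rintro (q | q) <;> refine Finset.mem_biUnion.2 ⟨q.1, Finset.mem_univ _, ?_⟩
  · exact Finset.mem_union_left _ ((I.inl_mem_commitBlock N).2 rfl)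
  · exact Finset.mem_union_right _ ((I.inr_mem_chalBlock N).2 rfl)

theorem prod_commitBlock (i : Fin (I.rounds n)) (f : (I.rrQuery N).Idx n → ℂ) :
    ∏ v ∈ I.commitBlock N i, f v = ∏ j : Fin (I.msgLen n), ∏ t : Fin (N n), f (Sum.inl (i, j, t)) :=
  (Finset.prod_disjSum ..).trans <| (mul_one _).trans <| (Finset.prod_product ..).trans <|
    (Finset.prod_singleton ..).trans (Fintype.prod_prod_type _)

theorem prod_chalBlock (i : Fin (I.rounds n)) (f : (I.rrQuery N).Idx n → ℂ) :
    ∏ v ∈ I.chalBlock N i, f v = ∏ j : Fin (I.chalLen n), f (Sum.inr (i, j)) :=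
  (Finset.prod_disjSum ..).trans <| (one_mul _).trans <| (Finset.prod_product ..).trans <|
    Finset.prod_singleton ..

/-- The one-qubit projectors applied to the verifier's message on the branch `(a, z, c)`. -/
noncomputable def branchProj (a : I.ansReg.Idx n → Bool) (z : (I.commitReg N).Idx n → Bool)
    (c : I.chalReg.Idx n → Bool) : (I.rrQuery N).Idx n → Bool → Bool → ℂ :=
  codeProj (Sum.elim (a ∘ I.commitBit N) fun _ => false) (Sum.elim z c)

variable (a : I.ansReg.Idx n → Bool) (z : (I.commitReg N).Idx n → Bool) (c : I.chalReg.Idx n → Bool)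

theorem branchProj_inr (q : I.chalReg.Idx n) (b b' : Bool) :
    I.branchProj N a z c (Sum.inr q) b b' = if b = c q ∧ b' = c q then 1 else 0 := by
  change (if b = c q then 1 else 0) * star (if b' = c q then (1 : ℂ) else 0) = _
  rw [apply_ite star, star_one, star_zero, ite_zero_mul_ite_zero, one_mul]

theorem commitProj_eq (i : Fin (I.rounds n)) :
    I.commitProj N a z i = localProd (I.commitBlock N i) (I.branchProj N a z c) := by
  ext x y
  have agree_iff : (∀ v, v ∉ I.commitBlock N i → x v = y v) ↔
      (∀ q : (I.commitReg N).Idx n, q.1 ≠ i → x (Sum.inl q) = y (Sum.inl q)) ∧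
        ∀ q : I.chalReg.Idx n, x (Sum.inr q) = y (Sum.inr q) :=
    Sum.forall.trans (and_congr
      (forall_congr' fun _ => imp_congr_left (not_congr (I.inl_mem_commitBlock N)))
      (forall_congr' fun _ => forall_prop_of_true (I.inr_notMem_commitBlock N)))
  rw [localProd_apply]
  by_cases agree : ∀ v, v ∉ I.commitBlock N i → x v = y v
  · rw [if_pos agree]
    exact (if_pos (agree_iff.1 agree)).trans <|
      (I.prod_commitBlock N i fun v => I.branchProj N a z c v (x v) (y v)).symm
  · rw [if_neg agree]
    exact if_neg (mt agree_iff.2 agree)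

theorem chalProj_eq (i : Fin (I.rounds n)) :
    I.chalProj N c i = localProd (I.chalBlock N i) (I.branchProj N a z c) := by
  ext x y
  have agree_iff : (x = y ∧ ∀ j : Fin (I.chalLen n), x (Sum.inr (i, j)) = c (i, j)) ↔
      (∀ v, v ∉ I.chalBlock N i → x v = y v) ∧
        ∀ j : Fin (I.chalLen n), x (Sum.inr (i, j)) = c (i, j) ∧ y (Sum.inr (i, j)) = c (i, j) := by
    refine ⟨fun ⟨h, hc⟩ => h ▸ ⟨fun _ _ => rfl, fun j => ⟨hc j, hc j⟩⟩, fun ⟨h, hc⟩ =>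
      ⟨funext fun v => ?_, fun j => (hc j).1⟩⟩
    by_cases hv : v ∈ I.chalBlock N i
    · obtain q | ⟨i', j⟩ := v
      · exact absurd hv (I.inl_notMem_chalBlock N)
      · obtain rfl : i' = i := (I.inr_mem_chalBlock N).1 hv
        exact (hc j).1.trans (hc j).2.symm
    · exact h v hv
  have prod_eq : ∏ v ∈ I.chalBlock N i, I.branchProj N a z c v (x v) (y v) =
      if ∀ j : Fin (I.chalLen n), x (Sum.inr (i, j)) = c (i, j) ∧ y (Sum.inr (i, j)) = c (i, j)
      then 1 else 0 := by
    refine (I.prod_chalBlock N i fun v => I.branchProj N a z c v (x v) (y v)).trans <|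
      (Finset.prod_congr rfl fun j _ => I.branchProj_inr N a z c (i, j) _ _).trans ?_
    simp only [Finset.prod_ite_zero, Finset.prod_const_one, Finset.mem_univ, true_imp_iff]
  rw [localProd_apply, prod_eq, ← ite_and]
  by_cases h : x = y ∧ ∀ j : Fin (I.chalLen n), x (Sum.inr (i, j)) = c (i, j)
  · rw [if_pos (agree_iff.1 h)]
    exact if_pos h
  · rw [if_neg (mt agree_iff.2 h)]
    exact if_neg h

theorem trace_localProd_univ_branchProj (ρ : Op ((I.rrQuery N).Idx n)) :
    (localProd Finset.univ (I.branchProj N a z c) * ρ *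
      localProd Finset.univ (I.branchProj N a z c)).trace =
      codeWeight (Sum.elim (a ∘ I.commitBit N) fun _ => false) (Sum.elim z c) ρ :=
  trace_localProd_univ_codeProj _ _ _

theorem trace_rrBranch (x w : List Bool) (a : I.ansReg.Idx x.length → Bool)
    (z : (I.commitReg N).Idx x.length → Bool) (c : I.chalReg.Idx x.length → Bool)
    (ρ : Op ((I.rrQuery N).Idx x.length)) :
    (I.rrBranch N x w a z c ρ).trace = (I.transcriptProb x w a c : ℂ) *
      codeWeight (Sum.elim (a ∘ I.commitBit N) fun _ => false) (Sum.elim z c) ρ := by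
  have pairwise_disjoint : Pairwise (Function.onFun Disjoint fun i =>
      I.commitBlock N (n := x.length) i ∪ I.chalBlock N i) := fun i j hij =>
    Finset.disjoint_union_left.2
      ⟨Finset.disjoint_union_right.2
        ⟨I.pairwise_disjoint_commitBlock N hij, I.disjoint_commitBlock_chalBlock N i j⟩,
      Finset.disjoint_union_right.2
        ⟨(I.disjoint_commitBlock_chalBlock N j i).symm, I.pairwise_disjoint_chalBlock N hij⟩⟩
  have rounds := foldl_localProd_conj pairwise_disjoint
    (fun i => (I.nextProb x w a c i.succ : ℂ)) (List.nodup_finRange _) (I.branchProj N a z c)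
    ((I.nextProb x w a c 0 : ℂ) • ρ)
  have first_round (i) := localProd_conj (I.disjoint_commitBlock_chalBlock N i i).symm
    (I.branchProj N a z c)
  simp only [Finset.union_comm (I.chalBlock N _), ← I.commitProj_eq, ← I.chalProj_eq] at first_round
  rw [List.toFinset_finRange, I.biUnion_commitBlock_union_chalBlock] at rounds
  simp only [← first_round] at rounds
  refine (congrArg Matrix.trace rounds).trans ?_
  rw [Matrix.mul_smul, Matrix.smul_mul, smul_smul, Matrix.trace_smul,
    trace_localProd_univ_branchProj, smul_eq_mul, transcriptProb, Fin.prod_univ_succ,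
    Complex.ofReal_mul, Complex.ofReal_prod, ← List.ofFn_eq_map, List.prod_ofFn, mul_comm (∏ i, _)]

theorem trace_rrSimBranch
    (S : ∀ x : List Bool, Op (I.chalReg.Idx x.length) → Op (I.ansReg.Idx x.length))
    (x : List Bool) (a : I.ansReg.Idx x.length → Bool)
    (z : (I.commitReg N).Idx x.length → Bool) (c : I.chalReg.Idx x.length → Bool)
    (ρ : Op ((I.rrQuery N).Idx x.length)) :
    (I.rrSimBranch N S x a z c ρ).trace = I.simProb S x a c *
      codeWeight (Sum.elim (a ∘ I.commitBit N) fun _ => false) (Sum.elim z c) ρ := by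
  have measure_commit := foldl_localProd_conj (I.pairwise_disjoint_commitBlock N) (fun _ => 1)
    (List.nodup_finRange _) (I.branchProj N a z c)
  have measure_chal := foldl_localProd_conj (I.pairwise_disjoint_chalBlock N) (fun _ => 1)
    (List.nodup_finRange _) (I.branchProj N a z c)
  simp only [one_smul, List.toFinset_finRange, List.map_const', List.prod_replicate, one_pow,
    ← I.commitProj_eq] at measure_commit
  simp only [one_smul, List.toFinset_finRange, List.map_const', List.prod_replicate, one_pow,
    ← I.chalProj_eq] at measure_chal
  have disjoint : Disjoint (Finset.univ.biUnion (I.commitBlock N (n := x.length)))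
      (Finset.univ.biUnion (I.chalBlock N)) := by
    simp only [Finset.disjoint_biUnion_left, Finset.disjoint_biUnion_right]
    exact fun i _ j _ => I.disjoint_commitBlock_chalBlock N _ _
  rw [rrSimBranch, measure_chal, measure_commit, Matrix.mul_smul, Matrix.smul_mul,
    Matrix.trace_smul, smul_eq_mul, localProd_conj disjoint, ← Finset.biUnion_union,
    I.biUnion_commitBlock_union_chalBlock, trace_localProd_univ_branchProj]

/-! ### The prover and the simulator as oracle algorithms -/

/-- The channel that answers the query in the challenge registers by the oracle `O` and then
measures the commitment registers as in commitments to the answer. -/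
noncomputable def answerAndCommit (O : Op (I.chalReg.Idx n) → Op (I.ansReg.Idx n)) :
    Op ((I.rrQuery N).Idx n) → Op ((I.rrReply N).Idx n) :=
  I.commitChan N n ∘ onFirst ((I.commitReg N).Idx n) O ∘
    relabel (Equiv.sumComm (I.chalReg.Idx n) ((I.commitReg N).Idx n))

theorem answerAndCommit_diagonal (p : (I.ansReg.Idx n → Bool) → (I.chalReg.Idx n → Bool) → ℂ)
    (ρ : Op ((I.rrQuery N).Idx n)) :
    I.answerAndCommit N (fun ρ => Matrix.diagonal fun a => ∑ c, ρ c c * p a c) ρ =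
      Matrix.diagonal fun r => ∑ c, p (r ∘ Sum.inl) c *
        codeWeight (Sum.elim ((r ∘ Sum.inl) ∘ I.commitBit N) fun _ => false)
          (Sum.elim (r ∘ Sum.inr) c) ρ := by
  refine congrArg Matrix.diagonal (funext fun r => ?_)
  have oracle_answer : (Matrix.of fun z z' => onFirst ((I.commitReg N).Idx n)
        (fun ρ => Matrix.diagonal fun a => ∑ c, ρ c c * p a c)
        (relabel (Equiv.sumComm (I.chalReg.Idx n) ((I.commitReg N).Idx n)) ρ)
        (Sum.elim (r ∘ Sum.inl) z) (Sum.elim (r ∘ Sum.inl) z')) =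
      ∑ c, p (r ∘ Sum.inl) c • Matrix.of fun z z' => ρ (Sum.elim z c) (Sum.elim z' c) := by
    ext z z'
    simp only [onFirst, Matrix.of_apply, Sum.elim_comp_inl, Sum.elim_comp_inr,
      Matrix.diagonal_apply_eq, Matrix.sum_apply]
    have sumComm_elim (c : I.chalReg.Idx n → Bool) (z : (I.commitReg N).Idx n → Bool) :
        Sum.elim c z ∘ (Equiv.sumComm _ _).symm = Sum.elim z c :=
      funext fun i => i.rec (fun _ => rfl) fun _ => rfl
    exact Finset.sum_congr rfl fun c _ => (mul_comm _ _).trans <|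
      congrArg (_ * ·) (congrArg₂ ρ (sumComm_elim c z) (sumComm_elim c z'))
  refine (congrArg (codeWeight _ _) oracle_answer).trans ((codeWeight_sum_smul ..).trans ?_)
  exact Finset.sum_congr rfl fun c _ => congrArg _ (codeWeight_elim_false ..).symm

theorem rrProver_eq (x w : List Bool) :
    I.rrProver N x w = I.answerAndCommit N (I.realOracle x w) :=
  funext fun ρ => Eq.trans
    (congrArg Matrix.diagonal <| funext fun _ => Finset.sum_congr rfl fun c _ =>
      I.trace_rrBranch N x w _ _ c ρ)
    (I.answerAndCommit_diagonal N (fun a c => (I.transcriptProb x w a c : ℂ)) ρ).symm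

theorem rrSimulator_eq
    (S : ∀ x : List Bool, Op (I.chalReg.Idx x.length) → Op (I.ansReg.Idx x.length))
    (x w : List Bool) :
    I.rrSimulator N S x = I.answerAndCommit N (I.simOracle S x w) :=
  funext fun ρ => Eq.trans
    (congrArg Matrix.diagonal <| funext fun _ => Finset.sum_congr rfl fun c _ =>
      I.trace_rrSimBranch N S x _ _ c ρ)
    (I.answerAndCommit_diagonal N (I.simProb S x) ρ).symm

variable {N}

theorem polyTime_answerAndCommit (hN : PolyTimeLength N)
    {O : ∀ x : List Bool, Op (I.chalReg.Idx x.length) → Op (I.ansReg.Idx x.length)}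
    (hO : PolyTime I.chalReg I.ansReg O) :
    PolyTime (I.rrQuery N) (I.rrReply N) fun x => I.answerAndCommit N (O x) :=
  have hP := enumerableRegister_commitReg I hN
  have hC := enumerableRegister_chalReg I
  (I.polyTime_commitChan hN).comp (I.enumerableRegister_rrReply hN) <|
    (hO.onFirst (enumerableRegister_ansReg I) hP).comp (hC.sum hP) (polyTime_sumComm hP hC)

theorem polyTime_simOracle
    {S : ∀ x : List Bool, Op (I.chalReg.Idx x.length) → Op (I.ansReg.Idx x.length)}
    (hS : PolyTime I.chalReg I.ansReg S) :
    PolyTime I.chalReg I.ansReg fun x => I.simOracle S x [] := by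
  have hA := enumerableRegister_ansReg I
  have hC := enumerableRegister_chalReg I
  have measured := (polyTime_dephase hA).comp hA (hS.comp hC (polyTime_dephase hC))
  convert measured using 2 with x
  funext ρ
  change I.simOracle S x [] ρ = dephase (S x (dephase ρ))
  rw [dephase_eq_sum ρ, (hS.isCPTP x).map_sum_smul]
  refine congrArg Matrix.diagonal (funext fun a => ?_)
  rw [Matrix.sum_apply]
  rfl

theorem polyTime_rrSimulator (hN : PolyTimeLength N)
    {S : ∀ x : List Bool, Op (I.chalReg.Idx x.length) → Op (I.ansReg.Idx x.length)}
    (hS : PolyTime I.chalReg I.ansReg S) :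
    PolyTime (I.rrQuery N) (I.rrReply N) (I.rrSimulator N S) := by
  rw [funext fun x => I.rrSimulator_eq N S x []]
  exact I.polyTime_answerAndCommit hN (I.polyTime_simOracle hS)

end PublicCoinProof

/-! ### Closure of indistinguishability under composition -/

theorem onFirst_comp {ι κ μ : Type} (K : Type) (Ψ : Op κ → Op μ) (Φ : Op ι → Op κ) :
    onFirst K (Ψ ∘ Φ) = onFirst K Ψ ∘ onFirst K Φ := by
  funext σ
  ext x y
  simp only [onFirst, Function.comp_apply, Matrix.of_apply, Sum.elim_comp_inl, Sum.elim_comp_inr]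
  rfl

theorem onFirst_onFirst {ι κ : Type} (R K : Type) (Φ : Op ι → Op κ) :
    onFirst K (onFirst R Φ) = relabel (Equiv.sumAssoc κ R K) ∘
      onFirst (R ⊕ K) Φ ∘ relabel (Equiv.sumAssoc ι R K).symm := by
  have elim_comp_sumAssoc (a : ι → Bool) (r : R → Bool) (k : K → Bool) :
      Sum.elim a (Sum.elim r k) ∘ Equiv.sumAssoc ι R K = Sum.elim (Sum.elim a r) k := by
    funext i
    obtain (i | i) | i := i <;> rfl
  have comp_sumAssoc_symm_inr (x : (κ ⊕ R) ⊕ K → Bool) :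
      (x ∘ (Equiv.sumAssoc κ R K).symm) ∘ Sum.inr =
        Sum.elim (x ∘ Sum.inl ∘ Sum.inr) (x ∘ Sum.inr) := by
    funext i
    obtain i | i := i <;> rfl
  funext σ
  ext x y
  simp only [onFirst, relabel, Function.comp_apply, Matrix.of_apply, Equiv.symm_symm,
    comp_sumAssoc_symm_inr, elim_comp_sumAssoc]
  rfl

theorem length_moveGates {ι W : Type} (src dst : ι → W) (l : List ι) :
    (moveGates src dst l).length = 2 * l.length := by
  simp [moveGates, mul_comm]

section MeasCircuit

variable {ι κ K : Type} [Fintype ι] [DecidableEq ι] [Fintype κ] [DecidableEq κ] [Fintype K]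
  [DecidableEq K]

theorem MeasCircuit.exists_prob_relabel (e : κ ≃ ι) (D : MeasCircuit κ) :
    ∃ D' : MeasCircuit ι, D'.gates.length = D.gates.length ∧ D'.prob = D.prob ∘ relabel e :=
  ⟨⟨D.gates, D.input ∘ e.symm, D.input_inj.comp e.symm.injective, D.output⟩, rfl, funext fun τ =>
    congrArg (fun ρ : Op Unit => (ρ (fun _ => true) (fun _ => true)).re)
      (circuitChannel_comp_equiv D.gates D.input_inj _ e.symm τ)⟩

theorem MeasCircuit.exists_prob_comp_onFirst (G : List (Gate Wire)) {inp : ι → Wire}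
    {out : κ → Wire} (hinp : Function.Injective inp) (hout : Function.Injective out)
    (D : MeasCircuit (κ ⊕ K)) :
    ∃ D' : MeasCircuit (ι ⊕ K),
      D'.gates.length = G.length + 2 * (Fintype.card κ + Fintype.card K) + D.gates.length ∧
        D'.prob = D.prob ∘ onFirst K (circuitChannel G inp out) := by
  let f₁ : Wire ⊕ K → Wire := Sum.elim (tagWire 0)
    fun k => tagWire 1 ([], [(Fintype.equivFin K k).val])
  have hf₁ : Function.Injective f₁ := elim_tagWire_injective zero_ne_one Function.injective_id
    fun k k' h => (Fintype.equivFin K).injective (Fin.ext (by simpa using h))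
  have hf : Function.Injective (Sum.elim f₁ (tagWire 2)) := by
    refine hf₁.sumElim (tagWire_injective 2) ?_
    rintro (w | k) w' h <;> exact absurd (tagWire_inj h).1 (by decide)
  have hinp' := hinp.sumMap (Function.injective_id (α := K))
  have wiring := circuitChannel_comp (Finset.nodup_toList Finset.univ) (by simp) hf
    (G.map (Gate.map Sum.inl)) D.gates hinp' (hout.sumMap Function.injective_id) D.input_inj
    fun _ : Unit => D.output
  rw [circuitChannel_map_inl G hinp] at wiring
  refine ⟨⟨_, _, hf₁.comp hinp', tagWire 2 D.output⟩, ?_, funext fun τ =>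
    congrArg (fun ρ : Op Unit => (ρ (fun _ => true) (fun _ => true)).re) (congrFun wiring τ)⟩
  simp [length_moveGates, add_assoc]

end MeasCircuit

section Indistinguishability

variable {A B C : Register} {J : Set (List Bool × List Bool)}

theorem CompIndist.symm {Φ Ψ : ChannelFamily A B} (h : CompIndist J Φ Ψ) : CompIndist J Ψ Φ := by
  intro b
  obtain ⟨ε, hε, h⟩ := h b
  refine ⟨ε, hε, fun x w hxw K _ _ hK D hD σ hσ => ?_⟩
  rw [abs_sub_comm]
  exact h x w hxw K hK D hD σ hσ

theorem StatIndist.symm {Φ Ψ : ChannelFamily A B} (h : StatIndist J Φ Ψ) : StatIndist J Ψ Φ := by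
  obtain ⟨ε, hε, h⟩ := h
  refine ⟨ε, hε, fun x w hxw K _ _ D hD σ hσ => ?_⟩
  rw [abs_sub_comm]
  exact h x w hxw K D hD σ hσ

theorem CompIndist.precomp {Φ Ψ : ChannelFamily B C} (h : CompIndist J Φ Ψ)
    {Θ : ∀ x : List Bool, Op (A.Idx x.length) → Op (B.Idx x.length)} (hΘ : ∀ x, IsCPTP (Θ x)) :
    CompIndist (A := A) (B := C) J (fun x w => Φ x w ∘ Θ x) (fun x w => Ψ x w ∘ Θ x) := by
  intro b
  obtain ⟨ε, hε, h⟩ := h b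
  refine ⟨ε, hε, fun x w hxw K _ _ hK D hD σ hσ => ?_⟩
  rw [onFirst_comp, onFirst_comp]
  exact h x w hxw K hK D hD _ (((hΘ x).onFirst K).isDensity hσ)

theorem StatIndist.precomp {Φ Ψ : ChannelFamily B C} (h : StatIndist J Φ Ψ)
    {Θ : ∀ x : List Bool, Op (A.Idx x.length) → Op (B.Idx x.length)} (hΘ : ∀ x, IsCPTP (Θ x)) :
    StatIndist (A := A) (B := C) J (fun x w => Φ x w ∘ Θ x) (fun x w => Ψ x w ∘ Θ x) := by
  obtain ⟨ε, hε, h⟩ := h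
  refine ⟨ε, hε, fun x w hxw K _ _ D hD σ hσ => ?_⟩
  rw [onFirst_comp, onFirst_comp]
  exact h x w hxw K D hD _ (((hΘ x).onFirst K).isDensity hσ)

theorem CompIndist.postcomp {Φ Ψ : ChannelFamily A B} (h : CompIndist J Φ Ψ)
    (hC : PolyBounded fun n => Fintype.card (C.Idx n))
    {Θ : ∀ x : List Bool, Op (B.Idx x.length) → Op (C.Idx x.length)} (hΘ : PolyTime B C Θ) :
    CompIndist (A := A) (B := C) J (fun x w => Θ x ∘ Φ x w) (fun x w => Θ x ∘ Ψ x w) := by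
  intro b
  obtain ⟨c, card_le⟩ := hC
  obtain ⟨G, hG, hΘ⟩ := polyTime_iff.1 hΘ
  obtain ⟨g, length_le⟩ := hG.length_le
  obtain ⟨ε, hε, h⟩ := h (g + 2 * (c + b) + b)
  refine ⟨ε, hε, fun x w hxw K _ _ hK D hD σ hσ => ?_⟩
  obtain ⟨D', hD', prob_eq⟩ := D.exists_prob_comp_onFirst (G x)
    (tagWire_label_injective 0 B x.length) (tagWire_label_injective 1 C x.length)
  rw [← hΘ] at prob_eq
  have card_le_x : Fintype.card (C.Idx x.length) ≤ _ := card_le x.length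
  have length_le_x := length_le x
  simp only [Polynomial.eval_add, Polynomial.eval_mul, Polynomial.eval_ofNat] at h
  have advantage_le := h x w hxw K (by lia) D' (by lia) σ hσ
  rw [prob_eq] at advantage_le
  rw [onFirst_comp, onFirst_comp]
  exact advantage_le

theorem StatIndist.postcomp {Φ Ψ : ChannelFamily A B} (h : StatIndist J Φ Ψ)
    {Θ : ∀ x : List Bool, Op (B.Idx x.length) → Op (C.Idx x.length)} (hΘ : ∀ x, IsCPTP (Θ x)) :
    StatIndist (A := A) (B := C) J (fun x w => Θ x ∘ Φ x w) (fun x w => Θ x ∘ Ψ x w) := by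
  obtain ⟨ε, hε, h⟩ := h
  refine ⟨ε, hε, fun x w hxw K _ _ D hD σ hσ => ?_⟩
  rw [onFirst_comp, onFirst_comp]
  exact h x w hxw K (D ∘ onFirst K (Θ x)) (hD.comp ((hΘ x).onFirst K)) σ hσ

theorem CompIndist.onFirst {Φ Ψ : ChannelFamily A B} (h : CompIndist J Φ Ψ) {R : Register}
    (hR : PolyBounded fun n => Fintype.card (R.Idx n)) :
    CompIndist (A := A.sum R) (B := B.sum R) J (fun x w => onFirst (R.Idx x.length) (Φ x w))
      (fun x w => onFirst (R.Idx x.length) (Ψ x w)) := by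
  intro b
  obtain ⟨r, card_le⟩ := hR
  obtain ⟨ε, hε, h⟩ := h (r + b)
  refine ⟨ε, hε, fun x w hxw K _ _ hK D hD σ hσ => ?_⟩
  obtain ⟨D', hD', prob_eq⟩ := D.exists_prob_relabel
    (Equiv.sumAssoc (B.Idx x.length) (R.Idx x.length) K)
  have advantage_le := h x w hxw (R.Idx x.length ⊕ K) ?_ D' ?_
    (relabel (Equiv.sumAssoc (A.Idx x.length) (R.Idx x.length) K).symm σ)
    ((isCPTP_relabel _).isDensity hσ)
  · rw [prob_eq] at advantage_le
    exact (congrArg₂ (fun ρ τ => |D.prob ρ - D.prob τ|) (congrFun (onFirst_onFirst _ K (Φ x w)) σ)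
      (congrFun (onFirst_onFirst _ K (Ψ x w)) σ)).trans_le advantage_le
  · rw [Fintype.card_sum, Polynomial.eval_add]
    exact Nat.add_le_add (card_le _) hK
  · rw [hD', Polynomial.eval_add]
    exact hD.trans (Nat.le_add_left _ _)

theorem StatIndist.onFirst {Φ Ψ : ChannelFamily A B} (h : StatIndist J Φ Ψ) (R : Register) :
    StatIndist (A := A.sum R) (B := B.sum R) J (fun x w => onFirst (R.Idx x.length) (Φ x w))
      (fun x w => onFirst (R.Idx x.length) (Ψ x w)) := by
  obtain ⟨ε, hε, h⟩ := h
  refine ⟨ε, hε, fun x w hxw K _ _ D hD σ hσ => ?_⟩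
  let e := Equiv.sumAssoc (B.Idx x.length) (R.Idx x.length) K
  have advantage_le := h x w hxw (R.Idx x.length ⊕ K) (D ∘ relabel e) (hD.comp (isCPTP_relabel e))
    (relabel (Equiv.sumAssoc (A.Idx x.length) (R.Idx x.length) K).symm σ)
    ((isCPTP_relabel _).isDensity hσ)
  exact (congrArg₂ (fun ρ τ =>
      |(D ρ (fun _ => true) (fun _ => true)).re - (D τ (fun _ => true) (fun _ => true)).re|)
    (congrFun (onFirst_onFirst _ K (Φ x w)) σ)
    (congrFun (onFirst_onFirst _ K (Ψ x w)) σ)).trans_le advantage_le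

end Indistinguishability

/-! ### Zero-knowledge of the compressed protocol -/

namespace PublicCoinProof

variable (I : PublicCoinProof) {N : ℕ → ℕ}
  {S : ∀ x : List Bool, Op (I.chalReg.Idx x.length) → Op (I.ansReg.Idx x.length)}

theorem compIndist_answerAndCommit (hN : PolyTimeLength N) {J : Set (List Bool × List Bool)}
    {O O' : ChannelFamily I.chalReg I.ansReg} (h : CompIndist J O O') :
    CompIndist (A := I.rrQuery N) (B := I.rrReply N) J (fun x w => I.answerAndCommit N (O x w))
      fun x w => I.answerAndCommit N (O' x w) :=
  ((h.onFirst (enumerableRegister_commitReg I hN).polyBounded).precomp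
    fun _ => isCPTP_relabel (Equiv.sumComm _ _)).postcomp
    (I.enumerableRegister_rrReply hN).polyBounded (I.polyTime_commitChan hN)

theorem statIndist_answerAndCommit (hN : PolyTimeLength N) {J : Set (List Bool × List Bool)}
    {O O' : ChannelFamily I.chalReg I.ansReg} (h : StatIndist J O O') :
    StatIndist (A := I.rrQuery N) (B := I.rrReply N) J (fun x w => I.answerAndCommit N (O x w))
      fun x w => I.answerAndCommit N (O' x w) :=
  ((h.onFirst (I.commitReg N)).precomp fun _ => isCPTP_relabel (Equiv.sumComm _ _)).postcomp
    (I.polyTime_commitChan hN).isCPTP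

theorem compIndist_rrProver (hN : PolyTimeLength N) (hS : I.IsSpecialCompSimulator S) :
    CompIndist (I.RR N).instances (I.RR N).prover fun x _ => I.rrSimulator N S x := by
  change CompIndist I.instances (I.rrProver N) fun x _ => I.rrSimulator N S x
  rw [funext₂ (I.rrProver_eq N), funext₂ (I.rrSimulator_eq N S)]
  exact I.compIndist_answerAndCommit hN hS.2.symm

theorem statIndist_rrProver (hN : PolyTimeLength N) (hS : I.IsSpecialStatSimulator S) :
    StatIndist (I.RR N).instances (I.RR N).prover fun x _ => I.rrSimulator N S x := by
  change StatIndist I.instances (I.rrProver N) fun x _ => I.rrSimulator N S x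
  rw [funext₂ (I.rrProver_eq N), funext₂ (I.rrSimulator_eq N S)]
  exact I.statIndist_answerAndCommit hN hS.2.symm

end PublicCoinProof

namespace TwoMessageProof

variable {T : TwoMessageProof} {e e' o : ℕ → ℕ} {V : T.Verifier e e' o}
  {J : Set (List Bool × List Bool)} {P Q : ChannelFamily T.fromVerifier T.fromProver}

theorem Verifier.IsPolyTime.isChannel (hV : V.IsPolyTime) : V.IsChannel :=
  fun x => ⟨hV.1.isCPTP x, hV.2.isCPTP x⟩

theorem Verifier.IsPolyTime.polyTime_interact (hV : V.IsPolyTime)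
    (hQ : EnumerableRegister T.fromVerifier) (hR : EnumerableRegister T.fromProver)
    (he' : PolyTimeLength e')
    {S : ∀ x : List Bool, Op (T.fromVerifier.Idx x.length) → Op (T.fromProver.Idx x.length)}
    (hS : PolyTime T.fromVerifier T.fromProver S) :
    PolyTime (Register.ofSize e) (Register.ofSize o) fun x => V.interact (fun x _ => S x) x [] :=
  have hM := enumerableRegister_ofSize he'
  hV.2.comp (hR.sum hM) ((hS.onFirst hR hM).comp (hQ.sum hM) hV.1)

theorem Verifier.IsPolyTime.compIndist_interact (hV : V.IsPolyTime) (he' : PolyTimeLength e')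
    (ho : PolyBounded o) (h : CompIndist J P Q) : CompIndist J (V.interact P) (V.interact Q) :=
  ((h.onFirst (enumerableRegister_ofSize he').polyBounded).precomp hV.1.isCPTP).postcomp
    (ho.imp fun _ h n => (Fintype.card_fin (o n)).trans_le (h n)) hV.2

theorem Verifier.IsChannel.statIndist_interact (hV : V.IsChannel) (h : StatIndist J P Q) :
    StatIndist J (V.interact P) (V.interact Q) :=
  ((h.onFirst (Register.ofSize e')).precomp fun x => (hV x).1).postcomp fun x => (hV x).2

end TwoMessageProof

theorem mainTheorem4 (I : PublicCoinProof) (N : ℕ → ℕ) (hN : PolyTimeLength N) :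
    (I.IsSpecialHVCZK → (I.RR N).IsCompQZK) ∧
    (I.IsSpecialHVSZK → (I.RR N).IsStatQZK) ∧
    (∀ S, I.IsSpecialCompSimulator S →
      PolyTime (I.rrQuery N) (I.rrReply N) (I.rrSimulator N S) ∧
        CompIndist (I.RR N).instances (I.RR N).prover (fun x _ => I.rrSimulator N S x)) ∧
    (∀ S, I.IsSpecialStatSimulator S →
      PolyTime (I.rrQuery N) (I.rrReply N) (I.rrSimulator N S) ∧
        StatIndist (I.RR N).instances (I.RR N).prover (fun x _ => I.rrSimulator N S x)) := by
  have hQ := I.enumerableRegister_rrQuery hN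
  have hR := I.enumerableRegister_rrReply hN
  refine ⟨?_, ?_, fun S hS => ⟨I.polyTime_rrSimulator hN hS.1, I.compIndist_rrProver hN hS⟩,
    fun S hS => ⟨I.polyTime_rrSimulator hN hS.1, I.statIndist_rrProver hN hS⟩⟩
  · rintro ⟨S, hS⟩ e e' o - he' ho V hV
    exact ⟨_, hV.polyTime_interact hQ hR he' (I.polyTime_rrSimulator hN hS.1),
      hV.compIndist_interact he' ho (I.compIndist_rrProver hN hS)⟩
  · rintro ⟨S, hS⟩
    have polyTime_simulator := I.polyTime_rrSimulator hN hS.1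
    have indist := I.statIndist_rrProver hN hS
    exact ⟨fun e e' o V hV => ⟨_, polyTime_simulator, hV.statIndist_interact indist⟩,
      fun e e' o _ he' _ V hV => ⟨_, hV.polyTime_interact hQ hR he' polyTime_simulator,
        hV.isChannel.statIndist_interact indist⟩⟩
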